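/- Let $d\ge 1$ and $T>0$. For $\varepsilon>0$ and $g\in L^2(\mathbb R^d)$, the Wigner and Husimi transforms are $$W_\varepsilon(x,\xi)=\frac1{(2\pi)^d}\int_{\mathbb R^d}e^{-i\xi\cdot z}\,g\big(x+\tfrac{\varepsilon z}2\big)\overline{g\big(x-\tfrac{\varepsilon z}2\big)}\,dz,\qquad W^H_\varepsilon=W_\varepsilon*G_\varepsilon,\quad G_\varepsilon(x,\xi)=\frac{1}{(\pi\varepsilon)^{d}}e^{-(|x|^2+|\xi|^2)/\varepsilon}.$$ Let $\mathcal A=\{\phi\in C_0(\mathbb R^d_x\times\mathbb R^d_\xi):\ \mathcal F_\xi\phi\in L^1(\mathbb R^d_z,C_0(\mathbb R^d_x))\}$ with norm $\|\phi\|_{\mathcal A}=\|\mathcal F_\xi\phi\|_{L^1_zL^\infty_x}$; $W_\varepsilon$ is regarded as the element of $\mathcal A'$ obtained by extending $\phi\mapsto\iint\phi\,W_\varepsilon\,dx\,d\xi$ continuously. $\mathcal M(X)$ denotes the nonnegative finite measures on $X$, and $W\in L^\infty((0,T),\mathcal M(X))$ means a weakly measurable family $t\mapsto W(t)\in\mathcal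 M(X)$ with uniformly bounded mass. With $p'$ the conjugate exponent of $p$: * $W_{\varepsilon_n}\rightharpoonup W$ in $L^p((0,T),\mathcal A'_{w*})$ means $\int_0^T\langle W_{\varepsilon_n}(t),\phi(t)\rangle dt\to\int_0^T\iint\phi(t,x,\xi)\,W(t,dx,d\xi)\,dt$ for all $\phi\in L^{p'}((0,T),\mathcal A)$; * $w_n\rightharpoonup\mu$ (resp. $w_n\to\mu$) in $L^p((0,T),\mathcal M(X))$ means $\int_0^T\!\int_X\phi\,w_n\,dy\,dt\to\int_0^T\!\int_X\phi(t,y)\,\mu(t,dy)\,dt$, the former integrals being absolutely convergent, for all measurable $\phi=\phi(t,y)$ with $\phi(t)\in C_0(X)$ (resp. $\phi(t)\in C_b(X)$) and $\|\phi(t)\|_{L^\infty}\in L^{p'}(0,T)$. Let $(f_\varepsilon)_{\varepsilon>0}$, $f_\varepsilon=f_\varepsilon(t,x)$, be uniformly bounded in $L^\infty((0,T),L^2(\mathbb R^d))$, and let $W_\varepsilon(t)$, $W^H_\varepsilon(t)$ be the transforms of $f_\varepsilon(t)$. 1. There are positive $\varepsilon_n\to0$ and $W\in L^\infty((0,T),\mathcal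 M(\mathbb R^d\times\mathbb R^d))$ such that, for every $p\in(1,\infty)$, $$W_{\varepsilon_n}\rightharpoonup W\ \text{ in }L^p((0,T),\mathcal A'_{w*}),\qquad W^H_{\varepsilon_n}\rightharpoonup W\ \text{ in }L^p((0,T),\mathcal M(\mathbb R^d\times\mathbb R^d)).$$ 2. Let $(\varepsilon_n)_n$ and $W$ be any such sequence and measure, and suppose moreover that $f_\varepsilon$, $x f_\varepsilon$ and $\varepsilon\nabla f_\varepsilon$ (weak gradient in $x$) are uniformly bounded in $L^\infty((0,T),L^2(\mathbb R^d))$. Then for all $p\in(1,\infty]$, $$W^H_{\varepsilon_n}\to W,\qquad |x|^2W^H_{\varepsilon_n}\rightharpoonup|x|^2W,\qquad|\xi|^2W^H_{\varepsilon_n}\rightharpoonup|\xi|^2W\qquad\text{in }L^p((0,T),\mathcal M(\mathbb R^d\times\mathbb R^d)),$$ $$|f_{\varepsilon_n}|^2\to\rho:=\int_{\mathbb R^d}W(\cdot,\cdot,d\xi)\ \text{ in }L^p((0,T),\mathcal M(\mathbb R^d)),\qquad\|f_{\varepsilon_n}\|_{L^2}^2\rightharpoonup\rho(\cdot,\mathbb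 R^d)\ \text{ in }L^p((0,T)),$$ (the last one meaning convergence against all functions in $L^{p'}(0,T)$), and for a.e. $t\in(0,T)$, $$\iint|x|^2\,W(t,dx,d\xi)\le\liminf_{n\to\infty}\|xf_{\varepsilon_n}\|^2_{L^\infty_tL^2_x},\qquad\iint|\xi|^2\,W(t,dx,d\xi)\le\liminf_{n\to\infty}\varepsilon_n^2\|\nabla f_{\varepsilon_n}\|^2_{L^\infty_tL^2_x}.$$ -/

import Mathlib

open MeasureTheory Filter Topology Set
open scoped ENNReal NNReal ZeroAtInfty BoundedContinuousFunction ContDiff ComplexConjugate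

noncomputable section

namespace SemiclassicalWigner

/-- The Euclidean space `ℝ^d`. -/
abbrev Eu (d : ℕ) : Type := EuclideanSpace ℝ (Fin d)

/-- The Lebesgue measure on the time interval `(0, T)`. -/
abbrev timeMeasure (T : ℝ) : Measure ℝ := volume.restrict (Ioo 0 T)

section Fourier

open scoped FourierTransform

variable {V : Type*} [NormedAddCommGroup V] [InnerProductSpace ℝ V] [FiniteDimensional ℝ V] [MeasurableSpace V] [BorelSpace V]

theorem integral_fourier_mul {a b : V → ℂ} (ha : Integrable a) (hb : Integrable b) :
    ∫ w, 𝓕 a w * b w = ∫ w, a w * 𝓕 b w := by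
  have := VectorFourier.integral_bilin_fourierIntegral_eq_flip (μ := (volume : Measure V)) (ν := (volume : Measure V)) (e := Real.fourierChar) (L := innerₗ V)
    (ContinuousLinearMap.mul ℂ ℂ) (by fun_prop) (by simpa using continuous_inner) ha hb
  rw [flip_innerₗ] at this
  simpa using! this

theorem integral_fourierInv_mul {a b : V → ℂ} (ha : Integrable a) (hb : Integrable b) :
    ∫ w, 𝓕⁻ a w * b w = ∫ w, a w * 𝓕⁻ b w := by
  have h := integral_fourier_mul ha hb.comp_neg
  rw [← integral_neg_eq_self] at h
  simp only [neg_neg] at h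
  simp only [Real.fourierInv_eq_fourier_neg]
  rw [h]
  congr 1; ext w; congr 1
  rw [← Real.fourierInv_eq_fourier_neg, Real.fourierInv_eq_fourier_comp_neg]

theorem fourier_fourierInv_ae_eq {u : V → ℂ} (hu : Integrable u) (hk : Integrable (𝓕⁻ u)) : 𝓕 (𝓕⁻ u) =ᵐ[volume] u := by
  have hc : Continuous (𝓕 (𝓕⁻ u)) := VectorFourier.fourierIntegral_continuous (by fun_prop) (by simpa using continuous_inner) hk
  apply ae_eq_of_integral_contDiff_smul_eq hc.locallyIntegrable hu.locallyIntegrable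
  intro g hg hs
  let S : SchwartzMap V ℂ := (hs.comp_left (g := ((↑) : ℝ → ℂ)) rfl).toSchwartzMap (Complex.ofRealCLM.contDiff.comp hg)
  have hS : ∀ x, S x = (g x : ℂ) := fun x => rfl
  have e1 : ∀ F : V → ℂ, ∫ x, g x • F x = ∫ x, F x * S x := fun F => by
    congr 1; ext x; rw [hS, mul_comm]; simp
  rw [e1, e1, integral_fourier_mul hk S.integrable, ← SchwartzMap.fourier_coe, integral_fourierInv_mul hu (𝓕 S).integrable, SchwartzMap.fourier_coe]
  rw [S.continuous.fourierInv_fourier_eq S.integrable (by rw [← SchwartzMap.fourier_coe]; exact (𝓕 S).integrable)]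

theorem integral_fourierInv_mul_fourier {u r : V → ℂ} (hu : Integrable u) (hr : Integrable r) (hk : Integrable (𝓕⁻ u)) :
    ∫ w, 𝓕⁻ u w * 𝓕 r w = ∫ z, u z * r z := by
  rw [← integral_fourier_mul hk hr]
  exact integral_congr_ae ((fourier_fourierInv_ae_eq hu hk).mono fun x hx => by simp [hx])
end Fourier

section Transforms

open scoped FourierTransform

variable {d : ℕ}

/-- `ρ̃_ε(x, z) = g(x + ε z / 2) * conj (g(x - ε z / 2))`. -/
def correlation (ε : ℝ) (g : Eu d → ℂ) (x z : Eu d) : ℂ :=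
  g (x + (ε / 2) • z) * conj (g (x - (ε / 2) • z))

/-- The Wigner transform
`W_ε(x, ξ) = (2π)^{-d} ∫ e^{-i ξ·z} g(x + ε z / 2) conj (g(x - ε z / 2)) dz`. -/
def wigner (ε : ℝ) (g : Eu d → ℂ) (x ξ : Eu d) : ℂ :=
  ((2 * Real.pi) ^ d : ℝ)⁻¹ *
    ∫ z, Complex.exp (-(Complex.I * (inner ℝ ξ z : ℝ))) * correlation ε g x z

/-- The Gaussian `γ_ε(x) = (π ε)^{-d/2} exp(-|x|^2 / ε)`. -/
def gaussian (ε : ℝ) (x : Eu d) : ℝ :=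
  ((Real.pi * ε) ^ ((d : ℝ) / 2))⁻¹ * Real.exp (-(‖x‖ ^ 2 / ε))

/-- The Husimi transform `W_ε^H = W_ε * G_ε`, where `G_ε(x, ξ) = γ_ε(x) γ_ε(ξ)`. -/
def husimi (ε : ℝ) (g : Eu d → ℂ) (x ξ : Eu d) : ℂ :=
  ∫ p : Eu d × Eu d,
    wigner ε g p.1 p.2 * ((gaussian ε (x - p.1) * gaussian ε (ξ - p.2) : ℝ) : ℂ)

/-- The space `L^1(ℝ^d_z, C_0(ℝ^d_x))`. -/
abbrev L1C0 (d : ℕ) : Type := Lp C₀(Eu d, ℂ) 1 (volume : Measure (Eu d))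

/-- `ψ = F_ξ φ`, with the normalisation `(F_ξ φ)(x, z) = (2π)^{-d} ∫ e^{-i ξ·z} φ(x, ξ) dξ`.
As `φ(x, ·)` need not be integrable, this is expressed through the inverse transform of
`ψ ∈ L^1(ℝ^d_z, C_0(ℝ^d_x))`. -/
def IsXiFourier (φ : C₀(Eu d × Eu d, ℂ)) (ψ : L1C0 d) : Prop :=
  ∀ x ξ : Eu d, φ (x, ξ) = ∫ z, Complex.exp (Complex.I * (inner ℝ ξ z : ℝ)) * ψ z x

/-- `φ ∈ L^q((0, T), 𝒜)`, where `𝒜 = {φ ∈ C_0 : F_ξ φ ∈ L^1(ℝ^d_z, C_0(ℝ^d_x))}` carries the norm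
`‖φ‖_𝒜 = ‖F_ξ φ‖_{L^1_z L^∞_x}`; here `ψ(t) = F_ξ φ(t)`. -/
def IsTestA (T : ℝ) (q : ℝ≥0∞) (φ : ℝ → C₀(Eu d × Eu d, ℂ)) (ψ : ℝ → L1C0 d) : Prop :=
  (∀ᵐ t ∂(timeMeasure T), IsXiFourier (φ t) (ψ t)) ∧ MemLp ψ q (timeMeasure T)

/-- The action of the Wigner transform `W_ε` of `g ∈ L^2`, as an element of `𝒜'`, on the element
`φ` of `𝒜` with `F_ξ φ = ψ`. It is the continuous extension of `φ ↦ ∬ φ W_ε dx dξ` to `𝒜`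
(see `wignerAct_eq_integral`; for a general `φ ∈ 𝒜` the product `φ W_ε` is not integrable). -/
def wignerAct (ε : ℝ) (g : Eu d → ℂ) (ψ : L1C0 d) : ℂ :=
  ∫ z, ∫ x, ψ z x * correlation ε g x z

theorem wigner_eq_fourier (ε : ℝ) (g : Eu d → ℂ) (x ξ : Eu d) :
    wigner ε g x ξ = ((2 * Real.pi) ^ d : ℝ)⁻¹ *
      𝓕 (correlation ε g x) ((2 * Real.pi)⁻¹ • ξ) := by
  rw [wigner, Real.fourier_eq']
  congr 1
  refine integral_congr_ae (.of_forall fun z => ?_)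
  simp only [smul_eq_mul]
  congr 2
  rw [inner_smul_right, real_inner_comm]
  push_cast
  field_simp

theorem xiFourier_eq {φ : C₀(Eu d × Eu d, ℂ)} {ψ : L1C0 d} (h : IsXiFourier φ ψ) (x ξ : Eu d) :
    φ (x, ξ) = 𝓕⁻ (fun z => ψ z x) ((2 * Real.pi)⁻¹ • ξ) := by
  rw [h, Real.fourierInv_eq']
  refine integral_congr_ae (.of_forall fun z => ?_)
  simp only [smul_eq_mul]
  congr 2
  rw [inner_smul_right, real_inner_comm]
  push_cast
  field_simp

theorem norm_correlation_le (ε : ℝ) (g : Eu d → ℂ) (x z : Eu d) : ‖correlation ε g x z‖ ≤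
    (‖g (x + (ε / 2) • z)‖ ^ 2 + ‖g (x - (ε / 2) • z)‖ ^ 2) / 2 := by
  rw [correlation, norm_mul, RCLike.norm_conj]
  nlinarith [sq_nonneg (‖g (x + (ε / 2) • z)‖ - ‖g (x - (ε / 2) • z)‖)]

theorem correlation_left {ε : ℝ} {g : Eu d → ℂ} (hm : Measurable g)
    (hg : Integrable (fun x => ‖g x‖ ^ 2)) (z : Eu d) :
    Integrable (fun x => correlation ε g x z) ∧
      ∫ x, ‖correlation ε g x z‖ ≤ ∫ x, ‖g x‖ ^ 2 := by
  have h1 : Integrable (fun x => ‖g (x + (ε / 2) • z)‖ ^ 2) := hg.comp_add_right ((ε / 2) • z)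
  have h2 : Integrable (fun x => ‖g (x - (ε / 2) • z)‖ ^ 2) := hg.comp_sub_right ((ε / 2) • z)
  have h3 := (h1.add h2).div_const 2
  have h4 : Integrable (fun x => correlation ε g x z) :=
    h3.mono' (Measurable.aestronglyMeasurable (by unfold correlation; fun_prop)) (.of_forall fun x => norm_correlation_le ε g x z)
  refine ⟨h4, (integral_mono h4.norm h3 fun x => norm_correlation_le ε g x z).trans_eq ?_⟩
  simp only [Pi.add_apply]
  rw [integral_div, integral_add h1 h2, integral_add_right_eq_self (fun x => ‖g x‖ ^ 2),
    integral_sub_right_eq_self (fun x => ‖g x‖ ^ 2)]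
  ring

theorem correlation_right {ε : ℝ} (hε : 0 < ε) {g : Eu d → ℂ} (hm : Measurable g)
    (hg : Integrable (fun x => ‖g x‖ ^ 2)) (x : Eu d) :
    Integrable (correlation ε g x) ∧
      ∫ z, ‖correlation ε g x z‖ ≤ |((ε / 2) ^ d)⁻¹| * ∫ x, ‖g x‖ ^ 2 := by
  have hc : ε / 2 ≠ 0 := by positivity
  have h1 : Integrable (fun z => ‖g (x + (ε / 2) • z)‖ ^ 2) :=
    (integrable_comp_smul_iff volume (fun y => ‖g (x + y)‖ ^ 2) hc).2 (hg.comp_add_left x)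
  have h2 : Integrable (fun z => ‖g (x - (ε / 2) • z)‖ ^ 2) :=
    (integrable_comp_smul_iff volume (fun y => ‖g (x - y)‖ ^ 2) hc).2 (hg.comp_sub_left x)
  have h3 := (h1.add h2).div_const 2
  have h4 : Integrable (fun z => correlation ε g x z) :=
    h3.mono' (Measurable.aestronglyMeasurable (by unfold correlation; fun_prop)) (.of_forall fun z => norm_correlation_le ε g x z)
  refine ⟨h4, (integral_mono h4.norm h3 fun z => norm_correlation_le ε g x z).trans_eq ?_⟩
  simp only [Pi.add_apply]
  rw [integral_div, integral_add h1 h2,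
    Measure.integral_comp_smul volume (fun y => ‖g (x + y)‖ ^ 2),
    Measure.integral_comp_smul volume (fun y => ‖g (x - y)‖ ^ 2),
    integral_add_left_eq_self (fun x => ‖g x‖ ^ 2),
    integral_sub_left_eq_self (fun x => ‖g x‖ ^ 2)]
  simp only [finrank_euclideanSpace, Fintype.card_fin, smul_eq_mul]
  ring

theorem wignerAct_eq_integral_aux {ε : ℝ} (hε : 0 < ε) {g : Eu d → ℂ} (hm : Measurable g)
    (hg : Integrable (fun x => ‖g x‖ ^ 2)) {φ : C₀(Eu d × Eu d, ℂ)} {ψ : L1C0 d}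
    (h : IsXiFourier φ ψ) (hφ : Integrable (φ : Eu d × Eu d → ℂ)) :
    wignerAct ε g ψ = ∫ y : Eu d × Eu d, φ y * wigner ε g y.1 y.2 := by
  have hψ : Integrable ψ := L1.integrable_coeFn ψ
  have hle : ∀ z x, ‖ψ z x‖ ≤ ‖ψ z‖ := fun z x => (ψ z).toBCF.norm_coe_le_norm x
  have hcm : Measurable (fun p : Eu d × Eu d => correlation ε g p.1 p.2) := by
    unfold correlation; fun_prop
  have hψm : StronglyMeasurable (fun p : Eu d × Eu d => ψ p.1 p.2) := by
    have e : Continuous (fun q : C₀(Eu d, ℂ) × Eu d => q.1 q.2) := by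
      have := (continuous_eval (F := Eu d →ᵇ ℂ) (X := Eu d) (Y := ℂ)).comp
        ((ZeroAtInftyContinuousMap.isometry_toBCF (α := Eu d) (β := ℂ)).continuous.prodMap
          (continuous_id (X := Eu d)))
      exact this
    exact e.comp_stronglyMeasurable
      (((Lp.stronglyMeasurable ψ).comp_measurable measurable_fst).prodMk
        measurable_snd.stronglyMeasurable)
  have hI : Integrable (fun p : Eu d × Eu d => ψ p.1 p.2 * correlation ε g p.2 p.1)
      (volume.prod volume) := by
    have hmeas : AEStronglyMeasurable
        (fun p : Eu d × Eu d => ψ p.1 p.2 * correlation ε g p.2 p.1) (volume.prod volume) :=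
      (hψm.mul (hcm.comp measurable_swap).stronglyMeasurable).aestronglyMeasurable
    have hz : ∀ z, Integrable (fun x => ψ z x * correlation ε g x z) := fun z =>
      (correlation_left hm hg z).1.bdd_mul (c := ‖ψ z‖)
        (ψ z).continuous.aestronglyMeasurable (.of_forall fun x => hle z x)
    rw [integrable_prod_iff hmeas]
    refine ⟨.of_forall hz, ?_⟩
    refine (hψ.norm.mul_const (∫ x, ‖g x‖ ^ 2)).mono' hmeas.norm.integral_prod_right'
      (.of_forall fun z => ?_)
    rw [Real.norm_of_nonneg (integral_nonneg fun _ => norm_nonneg _)]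
    refine (integral_mono (hz z).norm ((correlation_left (ε := ε) hm hg z).1.norm.const_mul ‖ψ z‖)
      fun x => ?_).trans ?_
    · simp only [norm_mul]
      exact mul_le_mul_of_nonneg_right (hle z x) (norm_nonneg _)
    · rw [integral_const_mul]
      exact mul_le_mul_of_nonneg_left (correlation_left hm hg z).2 (norm_nonneg _)
  have hwm : StronglyMeasurable (fun y : Eu d × Eu d => wigner ε g y.1 y.2) := by
    unfold wigner
    refine stronglyMeasurable_const.mul ?_
    refine StronglyMeasurable.integral_prod_right' (f := fun p : (Eu d × Eu d) × Eu d =>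
      Complex.exp (-(Complex.I * (inner ℝ p.1.2 p.2 : ℝ))) * correlation ε g p.1.1 p.2) ?_
    refine Measurable.stronglyMeasurable ?_
    exact (Continuous.measurable (by fun_prop)).mul
      (hcm.comp ((measurable_fst.comp measurable_fst).prodMk measurable_snd))
  have hW : Integrable (fun y : Eu d × Eu d => φ y * wigner ε g y.1 y.2) := by
    refine hφ.mul_bdd (c := ((2 * Real.pi) ^ d)⁻¹ * (|((ε / 2) ^ d)⁻¹| * ∫ x, ‖g x‖ ^ 2))
      hwm.aestronglyMeasurable (.of_forall fun y => ?_)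
    rw [wigner, norm_mul]
    refine mul_le_mul ?_ ?_ (norm_nonneg _) (by positivity)
    · rw [Complex.norm_real, Real.norm_of_nonneg (by positivity)]
    · refine (norm_integral_le_integral_norm _).trans (le_trans (le_of_eq ?_)
        (correlation_right hε hm hg y.1).2)
      refine integral_congr_ae (.of_forall fun z => ?_)
      simp [Complex.norm_exp]
  rw [wignerAct, integral_integral_swap hI, Measure.volume_eq_prod, integral_prod _ hW]
  refine integral_congr_ae ?_
  filter_upwards [hφ.prod_right_ae] with x hx
  have hu : Integrable (fun z => ψ z x) := hψ.norm.mono'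
    (hψm.comp_measurable (measurable_id.prodMk measurable_const)).aestronglyMeasurable
    (.of_forall fun z => hle z x)
  have hpi : (2 * Real.pi)⁻¹ ≠ 0 := by positivity
  have hk : Integrable (𝓕⁻ (fun z => ψ z x)) := by
    rw [← integrable_comp_smul_iff volume _ hpi]
    exact hx.congr (.of_forall fun ξ => xiFourier_eq h x ξ)
  rw [← integral_fourierInv_mul_fourier hu (correlation_right hε hm hg x).1 hk]
  have key := Measure.integral_comp_smul (volume : Measure (Eu d))
    (fun w => 𝓕⁻ (fun z => ψ z x) w * 𝓕 (correlation ε g x) w) (2 * Real.pi)⁻¹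
  simp only [finrank_euclideanSpace, Fintype.card_fin] at key
  have e : ∀ ξ, φ (x, ξ) * wigner ε g x ξ = ((((2 * Real.pi) ^ d)⁻¹ : ℝ) : ℂ) *
      (𝓕⁻ (fun z => ψ z x) ((2 * Real.pi)⁻¹ • ξ) *
        𝓕 (correlation ε g x) ((2 * Real.pi)⁻¹ • ξ)) := fun ξ => by
    rw [xiFourier_eq h, wigner_eq_fourier]; ring
  simp only [e]
  rw [integral_const_mul, key, abs_of_pos (by positivity), inv_pow, inv_inv, Complex.real_smul,
    ← mul_assoc, ← Complex.ofReal_mul, inv_mul_cancel₀ (by positivity), Complex.ofReal_one,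
    one_mul]

/-- For `φ ∈ 𝒜` integrable, the action of `W_ε` on `φ` is the integral `∬ φ W_ε dx dξ`. -/
theorem wignerAct_eq_integral {ε : ℝ} (hε : 0 < ε) {g : Eu d → ℂ} (hg : MemLp g 2)
    {φ : C₀(Eu d × Eu d, ℂ)} {ψ : L1C0 d}
    (h : IsXiFourier φ ψ) (hφ : Integrable (φ : Eu d × Eu d → ℂ)) :
    wignerAct ε g ψ = ∫ y : Eu d × Eu d, φ y * wigner ε g y.1 y.2 := by
  have hae := hg.aestronglyMeasurable.ae_eq_mk
  have hc : ε / 2 ≠ 0 := by positivity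
  have hL : ∀ z, ∀ᵐ x, correlation ε g x z = correlation ε (hg.aestronglyMeasurable.mk g) x z := fun z => by
    filter_upwards [(measurePreserving_add_right volume ((ε / 2) • z)).quasiMeasurePreserving.ae hae,
      (measurePreserving_sub_right volume ((ε / 2) • z)).quasiMeasurePreserving.ae hae] with x h1 h2
    rw [correlation, correlation, h1, h2]
  have hs : Measure.QuasiMeasurePreserving (fun z : Eu d => (ε / 2) • z) volume volume :=
    ⟨by fun_prop, by
      rw [Measure.map_addHaar_smul volume hc]; exact Measure.smul_absolutelyContinuous⟩
  have hR : ∀ x, ∀ᵐ z, correlation ε g x z = correlation ε (hg.aestronglyMeasurable.mk g) x z := fun x => by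
    filter_upwards [((measurePreserving_add_left volume x).quasiMeasurePreserving.comp hs).ae hae,
      ((quasiMeasurePreserving_sub_left volume x).comp hs).ae hae] with z h1 h2
    simp only [Function.comp] at h1 h2
    rw [correlation, correlation, h1, h2]
  have e1 : wignerAct ε g ψ = wignerAct ε (hg.aestronglyMeasurable.mk g) ψ := by
    refine integral_congr_ae (.of_forall fun z => integral_congr_ae ?_)
    filter_upwards [hL z] with x hx
    rw [hx]
  have e2 : ∀ x ξ, wigner ε g x ξ = wigner ε (hg.aestronglyMeasurable.mk g) x ξ := fun x ξ => by
    unfold wigner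
    congr 1
    refine integral_congr_ae ?_
    filter_upwards [hR x] with z hz
    rw [hz]
  simp only [e1, e2]
  refine wignerAct_eq_integral_aux hε hg.aestronglyMeasurable.stronglyMeasurable_mk.measurable ?_ h hφ
  exact ((memLp_congr_ae hae).1 hg).integrable_norm_pow (by norm_num)

end Transforms

section Convergence

variable {X : Type*} [TopologicalSpace X] [MeasureSpace X]

/-- Convergence of `∫_0^T ∫ φ(t, y) w_n(t, y) dy dt` to `∫_0^T ∫ φ(t, y) μ(t, dy) dt`, the
former integrals being absolutely convergent. -/
def PairingTendsto (T : ℝ) (φ : ℝ → X → ℂ) (w : ℕ → ℝ → X → ℂ) (μ : ℝ → Measure X) : Prop :=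
  (∀ n, Integrable (fun p : ℝ × X => φ p.1 p.2 * w n p.1 p.2) ((timeMeasure T).prod volume)) ∧
  Tendsto (fun n => ∫ t in Ioo 0 T, ∫ y, φ t y * w n t y) atTop
    (𝓝 (∫ t in Ioo 0 T, ∫ y, φ t y ∂(μ t)))

/-- `w_n ⇀ μ` in `L^p((0, T), ℳ(X))`: convergence against all `φ = φ(t, y)` with
`φ(t) ∈ C_0(X)` and `‖φ(t)‖_∞ ∈ L^{p'}(0, T)`. -/
def WeakTendsto (T : ℝ) (p : ℝ≥0∞) (w : ℕ → ℝ → X → ℂ) (μ : ℝ → Measure X) : Prop :=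
  ∀ q : ℝ≥0∞, p.HolderConjugate q → ∀ φ : ℝ → C₀(X, ℂ),
    (∀ y, AEStronglyMeasurable (fun t => φ t y) (timeMeasure T)) →
    MemLp (fun t => ‖φ t‖) q (timeMeasure T) →
    PairingTendsto T (fun t y => φ t y) w μ

/-- `w_n → μ` in `L^p((0, T), ℳ(X))`: convergence against all `φ = φ(t, y)` with
`φ(t) ∈ C_b(X)` and `‖φ(t)‖_∞ ∈ L^{p'}(0, T)`. -/
def NarrowTendsto (T : ℝ) (p : ℝ≥0∞) (w : ℕ → ℝ → X → ℂ) (μ : ℝ → Measure X) : Prop :=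
  ∀ q : ℝ≥0∞, p.HolderConjugate q → ∀ φ : ℝ → X →ᵇ ℂ,
    (∀ y, AEStronglyMeasurable (fun t => φ t y) (timeMeasure T)) →
    MemLp (fun t => ‖φ t‖) q (timeMeasure T) →
    PairingTendsto T (fun t y => φ t y) w μ

end Convergence

section Families

variable {d : ℕ}

/-- `‖g‖_{L^∞((0, T), L^2(ℝ^d))}`. -/
def normLinfL2 {F : Type*} [NormedAddCommGroup F] (T : ℝ) (g : ℝ → Eu d → F) : ℝ≥0∞ :=
  essSup (fun t => eLpNorm (g t) 2 volume) (timeMeasure T)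

/-- `(f_ε)_{ε > 0}`, `f_ε = f_ε(t, x)`, is uniformly bounded in `L^∞((0, T), L^2(ℝ^d))`. -/
def BoundedFamily (T : ℝ) (f : ℝ → ℝ → Eu d → ℂ) : Prop :=
  (∀ ε > 0, AEStronglyMeasurable (fun p : ℝ × Eu d => f ε p.1 p.2)
    ((timeMeasure T).prod volume)) ∧
  ∃ C : ℝ≥0, ∀ ε > 0, normLinfL2 T (f ε) ≤ C

/-- `G` is the gradient of `g` in the sense of distributions on `ℝ^d`. -/
def HasWeakGradient (g : Eu d → ℂ) (G : Eu d → EuclideanSpace ℂ (Fin d)) : Prop :=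
  LocallyIntegrable g volume ∧ LocallyIntegrable G volume ∧
  ∀ χ : Eu d → ℝ, ContDiff ℝ ∞ χ → HasCompactSupport χ → ∀ i : Fin d,
    ∫ x, g x * (fderiv ℝ χ x (EuclideanSpace.single i 1) : ℂ) = -∫ x, G x i * (χ x : ℂ)

/-- The functions `f_ε` have weak gradients `∇f_ε(t) = Df ε t`, and `f_ε`, `x f_ε` and `ε ∇f_ε` are
uniformly bounded in `L^∞((0, T), L^2(ℝ^d))`. -/
def MomentBounds (T : ℝ) (f : ℝ → ℝ → Eu d → ℂ)
    (Df : ℝ → ℝ → Eu d → EuclideanSpace ℂ (Fin d)) : Prop :=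
  BoundedFamily T f ∧
  (∀ ε > 0, ∀ᵐ t ∂(timeMeasure T), HasWeakGradient (f ε t) (Df ε t)) ∧
  (∃ C : ℝ≥0, ∀ ε > 0, normLinfL2 T (fun t x => ‖x‖ • f ε t x) ≤ C) ∧
  (∃ C : ℝ≥0, ∀ ε > 0, normLinfL2 T (fun t x => ε • Df ε t x) ≤ C)

/-- `ε_n → 0` and `W`, a weakly measurable, bounded family `t ↦ W(t)` of nonnegative finite measures
on `ℝ^d × ℝ^d` (that is, `W ∈ L^∞((0, T), ℳ(ℝ^d × ℝ^d))`), is the limit of the Wigner transforms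
in `L^p((0, T), 𝒜'_{w*})` and of the Husimi transforms in `L^p((0, T), ℳ(ℝ^d × ℝ^d))`, weakly,
for all `p ∈ (1, ∞)`. -/
structure IsWignerMeasure (T : ℝ) (f : ℝ → ℝ → Eu d → ℂ) (ε : ℕ → ℝ)
    (W : ProbabilityTheory.Kernel ℝ (Eu d × Eu d)) : Prop where
  eps_pos : ∀ n, 0 < ε n
  eps_tendsto : Tendsto ε atTop (𝓝 0)
  bounded : ∃ C : ℝ≥0, ∀ t, W t univ ≤ C
  wigner_tendsto : ∀ p q : ℝ≥0∞, 1 < p → p < ⊤ → p.HolderConjugate q →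
    ∀ (φ : ℝ → C₀(Eu d × Eu d, ℂ)) (ψ : ℝ → L1C0 d), IsTestA T q φ ψ →
      (∀ n, IntegrableOn (fun t => wignerAct (ε n) (f (ε n) t) (ψ t)) (Ioo 0 T)) ∧
      Tendsto (fun n => ∫ t in Ioo 0 T, wignerAct (ε n) (f (ε n) t) (ψ t)) atTop
        (𝓝 (∫ t in Ioo 0 T, ∫ y, φ t y ∂(W t)))
  husimi_tendsto : ∀ p : ℝ≥0∞, 1 < p → p < ⊤ →
    WeakTendsto T p (fun n t y => husimi (ε n) (f (ε n) t) y.1 y.2) (fun t => W t)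

/-- The measure `|x|^2 μ(dx, dξ)`. -/
def xMoment (μ : Measure (Eu d × Eu d)) : Measure (Eu d × Eu d) :=
  μ.withDensity fun y => ENNReal.ofReal (‖y.1‖ ^ 2)

/-- The measure `|ξ|^2 μ(dx, dξ)`. -/
def xiMoment (μ : Measure (Eu d × Eu d)) : Measure (Eu d × Eu d) :=
  μ.withDensity fun y => ENNReal.ofReal (‖y.2‖ ^ 2)

/-- The density `∫ μ(·, dξ)`, i.e. the marginal of `μ` in `x`. -/
def density (μ : Measure (Eu d × Eu d)) : Measure (Eu d) :=
  μ.map Prod.fst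

end Families

end SemiclassicalWigner

end

set_option linter.unusedSectionVars false

noncomputable section

namespace SemiclassicalWigner

/-! ### Truncation, separability and measurability in `C₀`. -/

section Cutoff

variable {X : Type*} [NormedAddCommGroup X]

/-! The mechanism is that the Husimi transform is a squared modulus. Convolving `W_ε` with the
Gaussian turns the correlation `g(x + εz/2) conj g(x - εz/2)` into its spatial average against
`γ_ε`, multiplied by `exp(-ε|z|²/4)`. By the parallelogram law, this factor times `γ_ε` at the
midpoint of two points equals the product of the values of `γ_ε^{1/2}` at the two points. The double
integral then separates, and `W^H_ε(x, ξ)` becomes `(2πε)^{-d}` times the squared modulus of the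
Fourier transform of `g γ_ε(x - ·)^{1/2}` at `ξ/(2πε)` (`husimi_eq`). So it is nonnegative, and
Plancherel in `ξ` gives its `x`-marginal `|g|² * γ_ε`, hence its mass `‖g‖²`.

Existence of a limit is compactness of the measures `W^H_ε dt dy` on `ℝ × ℝ^{2d}`. Their time
marginals are at most `C dt` on `(0, T)`. A subsequence converges vaguely by Banach-Alaoglu and
Riesz (`exists_vague_limit`), the limit inherits the bound on the time marginal (`fst_le_of_vague`),
and so it disintegrates into a bounded kernel (`exists_kernel_of_fst_le`). Convergence on tensors
extends by density to all of `L¹(0, T; C₀)` (`pairingTendsto_of_tensor`). On a bounded interval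
every `L^{p'}` lies in `L¹`, so one convergence statement serves all exponents.

The Wigner transforms have the same limit. In a pairing with `ψ = F_ξ φ`, passing from Wigner to
Husimi amounts to replacing `ψ(z)` by its Gaussian regularisation times `exp(-ε|z|²/4)`. The error
is at most `‖g‖²` times `wignerError`, which tends to zero by dominated convergence.

For the second part, the second moments of the Husimi transform are bounded by those of `|g|²` and
of `ε²|∇g|²` up to `O(ε)`. In `x` this follows from the marginal. In `ξ`, multiplication by `ξ`
becomes a derivative of the localised function, and the cross term it creates is odd against an even
Gaussian. Lower semicontinuity carries these bounds to the limit and gives the two final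
inequalities. The uniform moments are also tightness, so weak convergence becomes narrow
(`narrow_pairingTendsto`); and a continuous weight times a compactly supported test function is
again a test function, which gives the weighted limits. For the density, narrow convergence is
tested on functions of `x` alone, the Gaussian in the marginal is moved onto the test function, and
the bound on `x f` supplies tightness once more. -/

/-- A continuous cutoff, equal to `1` on the ball of radius `R + 1` and to `0` outside the ball of
radius `2 (R + 1)`. -/
def cutoff (R : ℕ) (y : X) : ℝ := max 0 (min 1 (2 - ‖y‖ / (R + 1)))

theorem continuous_cutoff (R : ℕ) : Continuous (cutoff R : X → ℝ) := by
  unfold cutoff; fun_prop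

theorem cutoff_nonneg (R : ℕ) (y : X) : 0 ≤ cutoff R y := le_max_left _ _

theorem cutoff_le_one (R : ℕ) (y : X) : cutoff R y ≤ 1 :=
  max_le zero_le_one (min_le_left _ _)

theorem cutoff_eq_one {R : ℕ} {y : X} (h : ‖y‖ ≤ R + 1) : cutoff R y = 1 := by
  have : ‖y‖ / (R + 1) ≤ 1 := (div_le_one (by positivity)).2 h
  rw [cutoff, min_eq_left (by linarith), max_eq_right zero_le_one]

theorem cutoff_eq_zero {R : ℕ} {y : X} (h : 2 * (R + 1) < ‖y‖) : cutoff R y = 0 := by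
  have : 2 ≤ ‖y‖ / (R + 1) := (le_div_iff₀ (by positivity)).2 h.le
  rw [cutoff, max_eq_left]
  exact (min_le_right _ _).trans (by linarith)

theorem norm_lt_of_cutoff_ne_one {R : ℕ} {y : X} (h : cutoff R y ≠ 1) : (R : ℝ) + 1 < ‖y‖ :=
  lt_of_not_ge fun h' => h (cutoff_eq_one h')

theorem norm_one_sub_cutoff_le (R : ℕ) (y : X) : |1 - cutoff R y| ≤ 1 := by
  rw [abs_le]
  constructor <;> linarith [cutoff_nonneg R y, cutoff_le_one R y]

theorem tendsto_cutoff (y : X) : Tendsto (fun R => cutoff R y) atTop (𝓝 1) := by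
  refine tendsto_const_nhds.congr' ?_
  filter_upwards [eventually_ge_atTop ⌈‖y‖⌉₊] with R hR
  exact (cutoff_eq_one ((Nat.le_ceil _).trans (by exact_mod_cast hR.trans (Nat.le_succ R)))).symm

variable {𝕜 : Type*} [RCLike 𝕜]

theorem C0_norm_le {f : C₀(X, 𝕜)} {C : ℝ} (hC : 0 ≤ C) (h : ∀ y, ‖f y‖ ≤ C) : ‖f‖ ≤ C := by
  rw [← ZeroAtInftyContinuousMap.norm_toBCF_eq_norm]
  exact (BoundedContinuousFunction.norm_le hC).2 h

theorem C0_norm_coe_le (f : C₀(X, 𝕜)) (y : X) : ‖f y‖ ≤ ‖f‖ := by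
  rw [← ZeroAtInftyContinuousMap.norm_toBCF_eq_norm]
  exact f.toBCF.norm_coe_le_norm y

theorem continuous_C0_eval : Continuous (fun q : C₀(X, 𝕜) × X => q.1 q.2) :=
  (continuous_eval (F := X →ᵇ 𝕜) (X := X) (Y := 𝕜)).comp
    ((ZeroAtInftyContinuousMap.isometry_toBCF (α := X) (β := 𝕜)).continuous.prodMap
      (continuous_id (X := X)))

theorem aestronglyMeasurable_C0_uncurry [SecondCountableTopology X] [MeasurableSpace X]
    [OpensMeasurableSpace X] {α : Type*} [MeasurableSpace α] {μ : Measure α} {ν : Measure X}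
    [SFinite ν] {φ : α → C₀(X, 𝕜)} (h : AEStronglyMeasurable φ μ) :
    AEStronglyMeasurable (fun p : α × X => φ p.1 p.2) (μ.prod ν) := by
  refine continuous_C0_eval.comp_aestronglyMeasurable (f := fun p : α × X => (φ p.1, p.2)) ?_
  exact h.comp_fst.prodMk measurable_snd.stronglyMeasurable.aestronglyMeasurable

variable [ProperSpace X]

theorem hasCompactSupport_cutoff (R : ℕ) : HasCompactSupport (cutoff R : X → ℝ) :=
  HasCompactSupport.of_support_subset_isCompact (isCompact_closedBall (0 : X) (2 * (R + 1)))
    fun y hy => by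
      by_contra h
      exact hy (cutoff_eq_zero (by simpa using h))

/-- The product of the cutoff with a continuous function. -/
def cutoffMul (R : ℕ) (b : X → 𝕜) (hb : Continuous b) : C₀(X, 𝕜) where
  toFun y := (cutoff R y : 𝕜) * b y
  continuous_toFun := ((RCLike.continuous_ofReal.comp (continuous_cutoff R))).mul hb
  zero_at_infty' := by
    refine HasCompactSupport.is_zero_at_infty ?_
    exact ((hasCompactSupport_cutoff R).comp_left (g := ((↑) : ℝ → 𝕜)) (by simp)).mul_right

@[simp] theorem cutoffMul_apply (R : ℕ) (b : X → 𝕜) (hb : Continuous b) (y : X) :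
    cutoffMul R b hb y = (cutoff R y : 𝕜) * b y := rfl

theorem hasCompactSupport_cutoffMul (R : ℕ) (b : X → 𝕜) (hb : Continuous b) :
    HasCompactSupport (cutoffMul R b hb) :=
  ((hasCompactSupport_cutoff R).comp_left (g := ((↑) : ℝ → 𝕜)) (by simp)).mul_right

theorem tendsto_cutoffMul (h : C₀(X, 𝕜)) :
    Tendsto (fun R => cutoffMul R h h.continuous) atTop (𝓝 h) := by
  rw [Metric.tendsto_atTop]
  intro δ hδ
  obtain ⟨r, hr⟩ := ZeroAtInftyContinuousMapClass.norm_le h (δ / 2) (by positivity)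
  refine ⟨⌈r⌉₊, fun R hR => ?_⟩
  rw [dist_eq_norm]
  refine (C0_norm_le (by positivity) fun y => ?_).trans_lt (half_lt_self hδ)
  rw [ZeroAtInftyContinuousMap.sub_apply, cutoffMul_apply]
  by_cases hy : cutoff R y = 1
  · simp [hy]; positivity
  · have h1 := norm_lt_of_cutoff_ne_one hy
    have h2 : r < ‖y‖ := ((Nat.le_ceil r).trans (Nat.cast_le.2 hR)).trans_lt (by linarith)
    have e : (cutoff R y : 𝕜) * h y - h y = ((cutoff R y - 1 : ℝ) : 𝕜) * h y := by
      push_cast; ring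
    rw [e, norm_mul, RCLike.norm_ofReal, abs_sub_comm]
    nlinarith [norm_one_sub_cutoff_le R y, hr y h2, norm_nonneg (h y), abs_nonneg (1 - cutoff R y)]

/-- `C(X)` with the compact-open topology is second countable. For fixed `R`, multiplication by the
cutoff is continuous from it into `C₀`, because only uniform convergence on one closed ball matters.
The images are therefore separable, and their union over `R` is dense. -/
instance C0_separableSpace [SecondCountableTopology X] : SecondCountableTopology C₀(X, 𝕜) := by
  have hc : ∀ R : ℕ, Continuous (fun b : C(X, 𝕜) => cutoffMul R b b.continuous) := fun R => by
    rw [continuous_iff_continuousAt]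
    intro b
    have h := (ContinuousMap.tendsto_iff_forall_isCompact_tendstoUniformlyOn.1
      (tendsto_id (α := C(X, 𝕜)) (x := 𝓝 b))) _ (isCompact_closedBall (0 : X) (2 * (R + 1)))
    rw [ContinuousAt, Metric.tendsto_nhds]
    intro δ hδ
    rw [Metric.tendstoUniformlyOn_iff] at h
    filter_upwards [h (δ / 2) (by positivity)] with c hc'
    rw [dist_eq_norm]
    refine (C0_norm_le (by positivity) fun y => ?_).trans_lt (half_lt_self hδ)
    rw [ZeroAtInftyContinuousMap.sub_apply, cutoffMul_apply, cutoffMul_apply, ← mul_sub, norm_mul,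
      RCLike.norm_ofReal, abs_of_nonneg (cutoff_nonneg R y)]
    by_cases hy : 2 * ((R : ℝ) + 1) < ‖y‖
    · rw [cutoff_eq_zero hy]; simp; positivity
    · have := (hc' y (by simpa using hy)).le
      rw [dist_comm, dist_eq_norm] at this
      exact (mul_le_of_le_one_left (norm_nonneg _) (cutoff_le_one R y)).trans this
  have hs : TopologicalSpace.IsSeparable
      (⋃ R : ℕ, Set.range (fun b : C(X, 𝕜) => cutoffMul R b b.continuous)) :=
    TopologicalSpace.IsSeparable.iUnion fun R => TopologicalSpace.isSeparable_range (hc R)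
  have : TopologicalSpace.SeparableSpace C₀(X, 𝕜) := by
    rw [← TopologicalSpace.isSeparable_univ_iff]
    refine hs.closure.mono fun h _ => ?_
    refine mem_closure_of_tendsto (tendsto_cutoffMul h) (.of_forall fun R => ?_)
    exact mem_iUnion.2 ⟨R, ⟨(h : C(X, 𝕜)), rfl⟩⟩
  exact UniformSpace.secondCountable_of_separable _

/-- Pointwise measurability suffices. Evaluation on a dense sequence is a continuous injection of
the Polish space `C₀` into a countable product, hence a measurable embedding by Lusin-Souslin. -/
theorem aestronglyMeasurable_C0 [SecondCountableTopology X] {α : Type*} [MeasurableSpace α]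
    {μ : Measure α} {φ : α → C₀(X, 𝕜)} (h : ∀ y, AEStronglyMeasurable (fun t => φ t y) μ) :
    AEStronglyMeasurable φ μ := by
  borelize C₀(X, 𝕜)
  let E : C₀(X, 𝕜) → ℕ → 𝕜 := fun f i => f (TopologicalSpace.denseSeq X i)
  have hE : Continuous E := continuous_pi fun i =>
    continuous_C0_eval.comp (continuous_id.prodMk continuous_const)
  have hi : Function.Injective E := fun f g hfg => by
    refine DFunLike.coe_injective (Continuous.ext_on (TopologicalSpace.denseRange_denseSeq X)
      f.continuous g.continuous ?_)
    rintro _ ⟨i, rfl⟩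
    exact congrFun hfg i
  have hm : MeasurableEmbedding E := hE.measurableEmbedding hi
  refine AEMeasurable.aestronglyMeasurable ?_
  refine hm.aemeasurable_comp_iff.1 ?_
  exact aemeasurable_pi_lambda _ fun i => (h _).aemeasurable

end Cutoff

/-! ### Convergence of pairings on `L¹(0, T; C₀)` by density of tensors. -/

section Pairings

/-- The usual interchange of limits: the approximation has to be uniform in `n`. -/
theorem tendsto_of_approx {a : ℕ → ℂ} {l : ℂ}
    (h : ∀ δ > 0, ∃ (b : ℕ → ℂ) (m : ℂ), Tendsto b atTop (𝓝 m) ∧ (∀ n, ‖a n - b n‖ ≤ δ) ∧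
      ‖l - m‖ ≤ δ) : Tendsto a atTop (𝓝 l) := by
  rw [Metric.tendsto_atTop]
  intro δ hδ
  obtain ⟨b, m, hb, h1, h2⟩ := h (δ / 4) (by positivity)
  obtain ⟨N, hN⟩ := Metric.tendsto_atTop.1 hb (δ / 4) (by positivity)
  refine ⟨N, fun n hn => ?_⟩
  have h3 := hN n hn
  have h4 := h1 n
  rw [dist_eq_norm] at h3 ⊢
  calc ‖a n - l‖ = ‖(a n - b n) + (b n - m) - (l - m)‖ := by congr 1; ring
    _ ≤ ‖a n - b n‖ + ‖b n - m‖ + ‖l - m‖ :=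
      (norm_sub_le _ _).trans (add_le_add_left (norm_add_le _ _) _)
    _ < δ := by linarith

variable {X : Type*} [MeasureSpace X] [SFinite (volume : Measure X)]

theorem norm_integral_le_of_lintegral {α : Type*} [MeasurableSpace α] {μ : Measure α} {F : α → ℂ}
    {c : ℝ} (hc : 0 ≤ c) (h : ∫⁻ y, ‖F y‖ₑ ∂μ ≤ ENNReal.ofReal c) : ‖∫ y, F y ∂μ‖ ≤ c := by
  have := (enorm_integral_le_lintegral_enorm F).trans h
  rwa [← ofReal_norm, ENNReal.ofReal_le_ofReal_iff hc] at this

theorem integrable_of_slice_bound {T : ℝ} {F : ℝ → X → ℂ} {N : ℝ → ℝ}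
    (hF : AEStronglyMeasurable (fun p : ℝ × X => F p.1 p.2) ((timeMeasure T).prod volume))
    (hN : Integrable N (timeMeasure T))
    (h : ∀ᵐ t ∂(timeMeasure T), ∫⁻ y, ‖F t y‖ₑ ≤ ENNReal.ofReal (N t)) :
    Integrable (fun p : ℝ × X => F p.1 p.2) ((timeMeasure T).prod volume) := by
  refine ⟨hF, ?_⟩
  rw [hasFiniteIntegral_iff_enorm, lintegral_prod _ hF.enorm]
  exact (lintegral_mono_ae h).trans_lt hN.lintegral_lt_top

theorem norm_pairing_le {T : ℝ} {F : ℝ → X → ℂ} {N : ℝ → ℝ}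
    (hN : Integrable N (timeMeasure T)) (hN0 : ∀ᵐ t ∂(timeMeasure T), 0 ≤ N t)
    (h : ∀ᵐ t ∂(timeMeasure T), ∫⁻ y, ‖F t y‖ₑ ≤ ENNReal.ofReal (N t)) :
    ‖∫ t in Ioo 0 T, ∫ y, F t y‖ ≤ ∫ t in Ioo 0 T, N t := by
  refine norm_integral_le_of_norm_le hN ?_
  filter_upwards [h, hN0] with t ht h0
  exact norm_integral_le_of_lintegral h0 ht

variable [NormedAddCommGroup X] [ProperSpace X] [SecondCountableTopology X] [BorelSpace X]

theorem lintegral_C0_mul_le {φ : C₀(X, ℂ)} {w : X → ℂ} {C : ℝ≥0} (h : ∫⁻ y, ‖w y‖ₑ ≤ C) :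
    ∫⁻ y, ‖φ y * w y‖ₑ ≤ ENNReal.ofReal (‖φ‖ * C) := by
  calc ∫⁻ y, ‖φ y * w y‖ₑ ≤ ∫⁻ y, ‖φ‖ₑ * ‖w y‖ₑ := by
        refine lintegral_mono fun y => ?_
        rw [enorm_mul]
        gcongr
        rw [← ofReal_norm, ← ofReal_norm]
        exact ENNReal.ofReal_le_ofReal (C0_norm_coe_le φ y)
    _ = ‖φ‖ₑ * ∫⁻ y, ‖w y‖ₑ := lintegral_const_mul' _ _ enorm_ne_top
    _ ≤ ‖φ‖ₑ * C := by gcongr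
    _ = _ := by
      rw [ENNReal.ofReal_mul (norm_nonneg _), ofReal_norm, ENNReal.ofReal_coe_nnreal]

theorem integrable_C0 (μ : Measure X) [IsFiniteMeasure μ] (φ : C₀(X, ℂ)) : Integrable φ μ :=
  Integrable.of_bound φ.continuous.aestronglyMeasurable ‖φ‖ (.of_forall (C0_norm_coe_le φ))

theorem norm_integral_C0_le {μ : Measure X} {C : ℝ≥0} (h : μ univ ≤ C) (φ : C₀(X, ℂ)) :
    ‖∫ y, φ y ∂μ‖ ≤ ‖φ‖ * C := by
  have : IsFiniteMeasure μ := ⟨h.trans_lt ENNReal.coe_lt_top⟩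
  refine (norm_integral_le_of_norm_le_const (.of_forall (C0_norm_coe_le φ))).trans ?_
  gcongr
  exact ENNReal.toReal_le_coe_of_le_coe h

theorem integrable_integral_C0 {T : ℝ} {κ : ProbabilityTheory.Kernel ℝ X}
    [ProbabilityTheory.IsSFiniteKernel κ] {C : ℝ≥0} (hκ : ∀ᵐ t ∂(timeMeasure T), κ t univ ≤ C)
    {φ : ℝ → C₀(X, ℂ)} (hφ : Integrable φ (timeMeasure T)) :
    Integrable (fun t => ∫ y, φ t y ∂(κ t)) (timeMeasure T) := by
  refine (hφ.norm.mul_const (C : ℝ)).mono' ?_ ?_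
  · have h1 : StronglyMeasurable (fun t => ∫ y, (hφ.1.mk φ) t y ∂(κ t)) := by
      refine StronglyMeasurable.integral_kernel_prod_right'
        (f := fun p : ℝ × X => (hφ.1.mk φ) p.1 p.2) (κ := κ) ?_
      exact continuous_C0_eval.comp_stronglyMeasurable
        ((hφ.1.stronglyMeasurable_mk.comp_measurable measurable_fst).prodMk
          measurable_snd.stronglyMeasurable)
    refine h1.aestronglyMeasurable.congr ?_
    filter_upwards [hφ.1.ae_eq_mk] with t ht
    rw [← ht]
  · filter_upwards [hκ] with t ht
    exact norm_integral_C0_le ht _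

/-- `L^1(0, T; C_0)` pairings converge as soon as they do on elementary tensors. -/
theorem pairingTendsto_of_tensor {T : ℝ} {w : ℕ → ℝ → X → ℂ} {κ : ProbabilityTheory.Kernel ℝ X}
    [ProbabilityTheory.IsSFiniteKernel κ] {C : ℝ≥0}
    (hm : ∀ n, AEStronglyMeasurable (fun p : ℝ × X => w n p.1 p.2) ((timeMeasure T).prod volume))
    (hw : ∀ n, ∀ᵐ t ∂(timeMeasure T), ∫⁻ y, ‖w n t y‖ₑ ≤ C)
    (hκ : ∀ᵐ t ∂(timeMeasure T), κ t univ ≤ C)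
    (hb : ∀ A : Set ℝ, MeasurableSet A → ∀ b : C₀(X, ℂ), HasCompactSupport b →
      Tendsto (fun n => ∫ t in Ioo 0 T, ∫ y, A.indicator (fun _ => b) t y * w n t y) atTop
        (𝓝 (∫ t in Ioo 0 T, ∫ y, A.indicator (fun _ => b) t y ∂(κ t))))
    {φ : ℝ → C₀(X, ℂ)} (hφ : Integrable φ (timeMeasure T)) :
    PairingTendsto T (fun t y => φ t y) w κ := by
  have hI : ∀ {φ : ℝ → C₀(X, ℂ)}, Integrable φ (timeMeasure T) → ∀ n,
      Integrable (fun p : ℝ × X => φ p.1 p.2 * w n p.1 p.2) ((timeMeasure T).prod volume) :=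
    fun {φ} hφ n => integrable_of_slice_bound (F := fun t y => φ t y * w n t y)
      ((aestronglyMeasurable_C0_uncurry hφ.1).mul (hm n)) (hφ.norm.mul_const (C : ℝ))
      ((hw n).mono fun t ht => lintegral_C0_mul_le ht)
  have hIt : ∀ {φ : ℝ → C₀(X, ℂ)}, Integrable φ (timeMeasure T) → ∀ n,
      Integrable (fun t => ∫ y, φ t y * w n t y) (timeMeasure T) :=
    fun hφ n => (hI hφ n).integral_prod_left
  refine ⟨hI hφ, ?_⟩
  let P : (ℝ → C₀(X, ℂ)) → Prop := fun φ =>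
    Tendsto (fun n => ∫ t in Ioo 0 T, ∫ y, φ t y * w n t y) atTop
      (𝓝 (∫ t in Ioo 0 T, ∫ y, φ t y ∂(κ t)))
  change P φ
  -- Every pairing, and the limit functional too, is Lipschitz on `L¹(0, T; C₀)` with the same
  -- constant `C`, so the set of good test functions is closed.
  have approx : ∀ φ, Integrable φ (timeMeasure T) → (∀ δ > 0, ∃ φ', Integrable φ' (timeMeasure T) ∧
      P φ' ∧ ∫ t in Ioo 0 T, ‖φ t - φ' t‖ ≤ δ) → P φ := by
    intro φ hφ h
    refine tendsto_of_approx fun δ hδ => ?_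
    -- Dividing by `C + 1` rather than by `C` covers the case `C = 0`.
    obtain ⟨φ', hφ', hP, hd⟩ := h (δ / (C + 1)) (by positivity)
    have hle : ∫ t in Ioo 0 T, ‖φ t - φ' t‖ * C ≤ δ := by
      rw [integral_mul_const]
      calc _ ≤ δ / (C + 1) * C := by gcongr
        _ ≤ δ / (C + 1) * (C + 1) := by gcongr; simp
        _ = δ := by field_simp
    have hN : Integrable (fun t => ‖φ t - φ' t‖ * C) (timeMeasure T) :=
      (hφ.sub hφ').norm.mul_const _
    refine ⟨_, _, hP, fun n => ?_, ?_⟩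
    · rw [← integral_sub (hIt hφ n) (hIt hφ' n)]
      refine le_trans (le_of_eq ?_) ((norm_pairing_le (F := fun t y => (φ t - φ' t) y * w n t y) hN
        (.of_forall fun t => by positivity)
        ((hw n).mono fun t ht => lintegral_C0_mul_le ht)).trans hle)
      congr 1
      refine integral_congr_ae ?_
      filter_upwards [(hI hφ n).prod_right_ae, (hI hφ' n).prod_right_ae] with t h1 h2
      rw [← integral_sub h1 h2]
      simp only [ZeroAtInftyContinuousMap.sub_apply, sub_mul]
    · rw [← integral_sub (integrable_integral_C0 hκ hφ) (integrable_integral_C0 hκ hφ')]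
      refine (norm_integral_le_of_norm_le hN ?_).trans hle
      filter_upwards [hκ] with t ht
      have : IsFiniteMeasure (κ t) := ⟨ht.trans_lt ENNReal.coe_lt_top⟩
      rw [← integral_sub (integrable_C0 _ _) (integrable_C0 _ _)]
      exact norm_integral_C0_le ht (φ t - φ' t)
  -- Indicators times a constant in `C₀` are reached from compactly supported constants by
  -- truncation; then come sums, `L¹`-closure and a.e. equality.
  refine Integrable.induction (μ := timeMeasure T) P ?_ ?_ ?_ ?_ hφ
  · intro c s hs hsf
    have hi : ∀ c : C₀(X, ℂ), Integrable (s.indicator fun _ => c) (timeMeasure T) := fun c =>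
      (integrable_const c).indicator hs
    refine approx _ (hi c) fun δ hδ => ?_
    have hT : 0 ≤ (timeMeasure T).real univ := measureReal_nonneg
    have h1 := (Metric.tendsto_atTop.1 (tendsto_cutoffMul c))
      (δ / ((timeMeasure T).real univ + 1)) (by positivity)
    obtain ⟨R, hR⟩ := h1
    refine ⟨_, hi (cutoffMul R c c.continuous), hb s hs _ (hasCompactSupport_cutoffMul _ _ _), ?_⟩
    have h2 := (hR R le_rfl).le
    rw [dist_comm, dist_eq_norm] at h2
    have h3 : ∫ t in Ioo 0 T, ‖s.indicator (fun _ => c) t -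
        s.indicator (fun _ => cutoffMul R c c.continuous) t‖ ≤
        ∫ t in Ioo 0 T, δ / ((timeMeasure T).real univ + 1) := by
      refine integral_mono ((hi _).sub (hi _)).norm (integrable_const _) fun t => ?_
      by_cases ht : t ∈ s
      · simpa [ht] using h2
      · simp [ht]; positivity
    refine h3.trans ?_
    rw [integral_const, smul_eq_mul, mul_div_assoc', div_le_iff₀ (by positivity)]
    nlinarith
  · intro f g _ hf hg hPf hPg
    have : P f ∧ P g → P (f + g) := fun ⟨h1, h2⟩ => by
      refine (h1.add h2).congr (fun n => ?_) |>.trans (le_of_eq ?_)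
      · rw [← integral_add (hIt hf n) (hIt hg n)]
        refine integral_congr_ae ?_
        filter_upwards [(hI hf n).prod_right_ae, (hI hg n).prod_right_ae] with t h1 h2
        rw [← integral_add h1 h2]
        simp only [Pi.add_apply, ZeroAtInftyContinuousMap.add_apply, add_mul]
      · rw [← integral_add (integrable_integral_C0 hκ hf) (integrable_integral_C0 hκ hg)]
        congr 1
        refine integral_congr_ae ?_
        filter_upwards [hκ] with t ht
        have : IsFiniteMeasure (κ t) := ⟨ht.trans_lt ENNReal.coe_lt_top⟩
        rw [← integral_add (integrable_C0 _ _) (integrable_C0 _ _)]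
        rfl
    exact this ⟨hPf, hPg⟩
  · refine isClosed_of_closure_subset fun f hf => ?_
    refine approx _ (L1.integrable_coeFn f) fun δ hδ => ?_
    obtain ⟨g, hg, hd⟩ := Metric.mem_closure_iff.1 hf δ hδ
    refine ⟨g, L1.integrable_coeFn g, hg, ?_⟩
    rw [L1.dist_eq_integral_dist] at hd
    simpa [dist_eq_norm] using hd.le
  · intro f g hfg hf hP
    refine Tendsto.congr (fun n => ?_) (hP.trans (le_of_eq ?_))
    · refine integral_congr_ae ?_
      filter_upwards [hfg] with t ht
      rw [ht]
    · congr 1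
      refine integral_congr_ae ?_
      filter_upwards [hfg] with t ht
      rw [ht]

/-- The time interval is bounded and `q ≥ 1`. This is why all exponents reduce to `L¹` in time. -/
theorem integrable_of_holderConjugate {T : ℝ} {p q : ℝ≥0∞} (h : p.HolderConjugate q)
    {F : Type*} [NormedAddCommGroup F] {φ : ℝ → F} (hφ : MemLp φ q (timeMeasure T)) :
    Integrable φ (timeMeasure T) := by
  have : q.HolderConjugate p := h.symm
  exact hφ.integrable (ENNReal.HolderConjugate.one_le q p)

theorem weakTendsto_of_forall {T : ℝ} {w : ℕ → ℝ → X → ℂ} {μ : ℝ → Measure X}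
    (h : ∀ φ : ℝ → C₀(X, ℂ), Integrable φ (timeMeasure T) →
      PairingTendsto T (fun t y => φ t y) w μ) (p : ℝ≥0∞) : WeakTendsto T p w μ := by
  intro q hq φ hφ hN
  have hφ' := aestronglyMeasurable_C0 hφ
  exact h φ ((integrable_norm_iff hφ').1 (integrable_of_holderConjugate hq hN))

end Pairings

/-! ### Tightness: from weak to narrow convergence, and lower semicontinuity of moments. -/

section Narrow

variable {X : Type*} [MeasureSpace X] [SFinite (volume : Measure X)] [NormedAddCommGroup X]
  [ProperSpace X] [SecondCountableTopology X] [BorelSpace X]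

/-- Chebyshev's inequality in pointwise form: `1 - cutoff R` is supported where `‖y‖ > R + 1`. -/
theorem enorm_one_sub_cutoff_le (R : ℕ) (y : X) :
    ‖((1 - cutoff R y : ℝ) : ℂ)‖ₑ ≤ ENNReal.ofReal (1 / ((R : ℝ) + 1) ^ 2) * ‖y‖ₑ ^ 2 := by
  rw [← ofReal_norm, ← ofReal_norm, ← ENNReal.ofReal_pow (norm_nonneg _),
    ← ENNReal.ofReal_mul (by positivity)]
  refine ENNReal.ofReal_le_ofReal ?_
  rw [Complex.norm_real, Real.norm_eq_abs]
  by_cases h : cutoff R y = 1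
  · rw [h]; simp; positivity
  · have h1 := norm_lt_of_cutoff_ne_one h
    refine (norm_one_sub_cutoff_le R y).trans ?_
    rw [one_div, ← div_eq_inv_mul, one_le_div (by positivity)]
    have : (0 : ℝ) ≤ (R : ℝ) + 1 := by positivity
    gcongr

/-- Convergence against `C_0`, together with bounds for the second moments, yields convergence
against `C_b`. -/
theorem narrow_pairingTendsto {T : ℝ} {w : ℕ → ℝ → X → ℂ} {κ : ProbabilityTheory.Kernel ℝ X}
    [ProbabilityTheory.IsSFiniteKernel κ] {C : ℝ≥0}
    (hm : ∀ n, AEStronglyMeasurable (fun p : ℝ × X => w n p.1 p.2) ((timeMeasure T).prod volume))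
    (hw : ∀ n, ∀ᵐ t ∂(timeMeasure T), ∫⁻ y, ‖w n t y‖ₑ ≤ C)
    (hκ : ∀ᵐ t ∂(timeMeasure T), κ t univ ≤ C)
    (hmom : ∀ n, ∀ᵐ t ∂(timeMeasure T), ∫⁻ y, ‖y‖ₑ ^ 2 * ‖w n t y‖ₑ ≤ C)
    (h : ∀ φ : ℝ → C₀(X, ℂ), Integrable φ (timeMeasure T) →
      PairingTendsto T (fun t y => φ t y) w κ)
    {φ : ℝ → X →ᵇ ℂ} (hφ : ∀ y, AEStronglyMeasurable (fun t => φ t y) (timeMeasure T))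
    (hN : Integrable (fun t => ‖φ t‖) (timeMeasure T)) :
    PairingTendsto T (fun t y => φ t y) w κ := by
  obtain ⟨Φ, hΦ⟩ : ∃ Φ : ℕ → ℝ → C₀(X, ℂ), ∀ R t y, Φ R t y = (cutoff R y : ℂ) * φ t y :=
    ⟨fun R t => cutoffMul R (φ t) (φ t).continuous, fun _ _ _ => rfl⟩
  have hΦle : ∀ R t y, ‖Φ R t y‖ ≤ ‖φ t‖ := fun R t y => by
    rw [hΦ, norm_mul, Complex.norm_real, Real.norm_of_nonneg (cutoff_nonneg R y)]
    exact (mul_le_of_le_one_left (norm_nonneg _) (cutoff_le_one R y)).trans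
      ((φ t).norm_coe_le_norm y)
  have hΦm : ∀ R, AEStronglyMeasurable (Φ R) (timeMeasure T) := fun R =>
    aestronglyMeasurable_C0 fun y => by simpa only [hΦ] using (hφ y).const_mul _
  have hΦI : ∀ R, Integrable (Φ R) (timeMeasure T) := fun R =>
    hN.mono' (hΦm R) (.of_forall fun t => C0_norm_le (norm_nonneg _) (hΦle R t))
  have hlim : ∀ t y, Tendsto (fun R => Φ R t y) atTop (𝓝 (φ t y)) := fun t y => by
    simp only [hΦ]
    have := ((Complex.continuous_ofReal.tendsto _).comp (tendsto_cutoff y)).mul_const (φ t y)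
    simpa using this
  -- `C_b` is not separable, so joint measurability comes from the pointwise limit of the
  -- truncations, which take values in the separable space `C₀`.
  have hφm : AEStronglyMeasurable (fun p : ℝ × X => φ p.1 p.2) ((timeMeasure T).prod volume) :=
    aestronglyMeasurable_of_tendsto_ae atTop (f := fun R p => Φ R p.1 p.2)
      (fun R => aestronglyMeasurable_C0_uncurry (hΦm R)) (.of_forall fun p => hlim p.1 p.2)
  have hI : ∀ n, Integrable (fun p : ℝ × X => φ p.1 p.2 * w n p.1 p.2)
      ((timeMeasure T).prod volume) := fun n => by
    refine integrable_of_slice_bound (F := fun t y => φ t y * w n t y) (hφm.mul (hm n))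
      (hN.mul_const (C : ℝ)) ?_
    filter_upwards [hw n] with t ht
    calc ∫⁻ y, ‖φ t y * w n t y‖ₑ ≤ ∫⁻ y, ‖φ t‖ₑ * ‖w n t y‖ₑ := by
          refine lintegral_mono fun y => ?_
          rw [enorm_mul]
          gcongr
          rw [← ofReal_norm, ← ofReal_norm]
          exact ENNReal.ofReal_le_ofReal ((φ t).norm_coe_le_norm y)
      _ = ‖φ t‖ₑ * ∫⁻ y, ‖w n t y‖ₑ := lintegral_const_mul' _ _ enorm_ne_top
      _ ≤ ‖φ t‖ₑ * C := by gcongr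
      _ = _ := by
        rw [ENNReal.ofReal_mul (norm_nonneg _), ofReal_norm, ENNReal.ofReal_coe_nnreal]
  refine ⟨hI, ?_⟩
  -- On the limit side, removing the truncation needs only the finite mass of `κ t` and dominated
  -- convergence, in `y` and then in `t`.
  have hL : Tendsto (fun R => ∫ t in Ioo 0 T, ∫ y, Φ R t y ∂(κ t)) atTop
      (𝓝 (∫ t in Ioo 0 T, ∫ y, φ t y ∂(κ t))) := by
    refine tendsto_integral_of_dominated_convergence (fun t => ‖φ t‖ * C)
      (fun R => (integrable_integral_C0 hκ (hΦI R)).1) (hN.mul_const _) (fun R => ?_) ?_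
    · filter_upwards [hκ] with t ht
      exact (norm_integral_C0_le ht _).trans
        (mul_le_mul_of_nonneg_right (C0_norm_le (norm_nonneg _) (hΦle R t)) C.2)
    · filter_upwards [hκ] with t ht
      have : IsFiniteMeasure (κ t) := ⟨ht.trans_lt ENNReal.coe_lt_top⟩
      exact tendsto_integral_of_dominated_convergence (fun _ => ‖φ t‖)
        (fun R => (Φ R t).continuous.aestronglyMeasurable) (integrable_const _)
        (fun R => .of_forall (hΦle R t)) (.of_forall (hlim t))
  -- On the side of the sequence, the second moments make the truncation error `O(R⁻²)` uniformly in
  -- `n`.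
  have hpair : ∀ R n, ‖(∫ t in Ioo 0 T, ∫ y, φ t y * w n t y) -
      ∫ t in Ioo 0 T, ∫ y, Φ R t y * w n t y‖ ≤
      1 / ((R : ℝ) + 1) ^ 2 * (C * ∫ t in Ioo 0 T, ‖φ t‖) := fun R n => by
    have h1 := hI n
    have h2 := (h _ (hΦI R)).1 n
    rw [← integral_sub h1.integral_prod_left h2.integral_prod_left]
    have e : ∫ t in Ioo 0 T, ((∫ y, φ t y * w n t y) - ∫ y, Φ R t y * w n t y) =
        ∫ t in Ioo 0 T, ∫ y, ((1 - cutoff R y : ℝ) : ℂ) * φ t y * w n t y := by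
      refine integral_congr_ae ?_
      filter_upwards [h1.prod_right_ae, h2.prod_right_ae] with t h1 h2
      rw [← integral_sub h1 h2]
      refine integral_congr_ae (.of_forall fun y => ?_)
      simp only [hΦ]
      push_cast
      ring
    rw [e, ← mul_assoc, ← integral_const_mul]
    refine norm_pairing_le (F := fun t y => ((1 - cutoff R y : ℝ) : ℂ) * φ t y * w n t y)
      (hN.const_mul _) (.of_forall fun t => by positivity) ?_
    filter_upwards [hmom n] with t ht
    calc ∫⁻ y, ‖((1 - cutoff R y : ℝ) : ℂ) * φ t y * w n t y‖ₑ
        ≤ ∫⁻ y, ENNReal.ofReal (1 / ((R : ℝ) + 1) ^ 2) * ‖φ t‖ₑ * (‖y‖ₑ ^ 2 * ‖w n t y‖ₑ) := by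
          refine lintegral_mono fun y => ?_
          rw [enorm_mul, enorm_mul]
          calc _ ≤ ENNReal.ofReal (1 / ((R : ℝ) + 1) ^ 2) * ‖y‖ₑ ^ 2 * ‖φ t‖ₑ * ‖w n t y‖ₑ := by
                gcongr
                · exact enorm_one_sub_cutoff_le R y
                · rw [← ofReal_norm, ← ofReal_norm]
                  exact ENNReal.ofReal_le_ofReal ((φ t).norm_coe_le_norm y)
            _ = _ := by ring
      _ = ENNReal.ofReal (1 / ((R : ℝ) + 1) ^ 2) * ‖φ t‖ₑ * ∫⁻ y, ‖y‖ₑ ^ 2 * ‖w n t y‖ₑ :=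
        lintegral_const_mul' _ _ (ENNReal.mul_ne_top ENNReal.ofReal_ne_top enorm_ne_top)
      _ ≤ ENNReal.ofReal (1 / ((R : ℝ) + 1) ^ 2) * ‖φ t‖ₑ * C := by gcongr
      _ = _ := by
        rw [ENNReal.ofReal_mul (by positivity), ENNReal.ofReal_mul (by positivity), ofReal_norm,
          ENNReal.ofReal_coe_nnreal]
        ring
  refine tendsto_of_approx fun δ hδ => ?_
  have hz : Tendsto (fun R : ℕ => 1 / ((R : ℝ) + 1) ^ 2 * (C * ∫ t in Ioo 0 T, ‖φ t‖)) atTop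
      (𝓝 0) := by
    have h1 : Tendsto (fun R : ℕ => 1 / ((R : ℝ) + 1)) atTop (𝓝 0) :=
      tendsto_one_div_add_atTop_nhds_zero_nat
    have h2 := (h1.pow 2).mul_const (C * ∫ t in Ioo 0 T, ‖φ t‖)
    simpa [div_pow] using h2
  have h1 := (hz.eventually_lt_const hδ).and (Metric.tendsto_nhds.1 hL δ hδ)
  obtain ⟨R, hR1, hR2⟩ := h1.exists
  refine ⟨_, _, (h _ (hΦI R)).2, fun n => (hpair R n).trans hR1.le, ?_⟩
  rw [dist_comm, dist_eq_norm] at hR2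
  exact hR2.le

theorem narrowTendsto_of_forall {T : ℝ} {w : ℕ → ℝ → X → ℂ} {μ : ℝ → Measure X}
    (h : ∀ φ : ℝ → X →ᵇ ℂ, (∀ y, AEStronglyMeasurable (fun t => φ t y) (timeMeasure T)) →
      Integrable (fun t => ‖φ t‖) (timeMeasure T) →
      PairingTendsto T (fun t y => φ t y) w μ) (p : ℝ≥0∞) : NarrowTendsto T p w μ :=
  fun _ hq φ hφ hN => h φ hφ (integrable_of_holderConjugate hq hN)

/-- Moments are lower semicontinuous under weak convergence of nonnegative densities. -/
theorem lintegral_le_liminf_of_pairingTendsto {T : ℝ} {H : ℕ → ℝ → X → ℝ}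
    {κ : ProbabilityTheory.Kernel ℝ X} [ProbabilityTheory.IsSFiniteKernel κ] {C : ℝ≥0}
    (hκ : ∀ᵐ t ∂(timeMeasure T), κ t univ ≤ C)
    (h : ∀ φ : ℝ → C₀(X, ℂ), Integrable φ (timeMeasure T) →
      PairingTendsto T (fun t y => φ t y) (fun n t y => (H n t y : ℂ)) κ)
    {m : X → ℝ} (hmc : Continuous m) (hm0 : ∀ y, 0 ≤ m y) {B : ℕ → ℝ≥0∞}
    (hB : ∀ n, ∀ᵐ t ∂(timeMeasure T), ∫⁻ y, ENNReal.ofReal (m y) * ‖H n t y‖ₑ ≤ B n) :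
    ∀ᵐ t ∂(timeMeasure T), ∫⁻ y, ENNReal.ofReal (m y) ∂(κ t) ≤ liminf B atTop := by
  by_cases hBtop : liminf B atTop = ⊤
  · simp [hBtop]
  let r : ℕ → X → ℝ := fun R y => cutoff R y * m y
  have hr0 : ∀ R y, 0 ≤ r R y := fun R y => mul_nonneg (cutoff_nonneg R y) (hm0 y)
  obtain ⟨b, hbr⟩ : ∃ b : ℕ → C₀(X, ℂ), ∀ R y, b R y = (r R y : ℂ) :=
    ⟨fun R => cutoffMul R (fun y => (m y : ℂ)) (Complex.continuous_ofReal.comp hmc),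
      fun R y => (Complex.ofReal_mul _ _).symm⟩
  have hrc : ∀ R, Continuous (r R) := fun R => (continuous_cutoff R).mul hmc
  have hrm : ∀ R y, r R y ≤ m y := fun R y => mul_le_of_le_one_left (hm0 y) (cutoff_le_one R y)
  -- The truncated weight is an admissible test function. Testing with `1_A(t)` times it, for every
  -- measurable `A` of finite measure, turns a bound on integrals into a bound for a.e. `t`.
  have key : ∀ R, ∀ᵐ t ∂(timeMeasure T), ∫⁻ y, ENNReal.ofReal (r R y) ∂(κ t) ≤ liminf B atTop := by
    intro R
    refine ae_le_of_forall_setLIntegral_le_of_sigmaFinite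
      (Measurable.lintegral_kernel (κ := κ) (hrc R).measurable.ennreal_ofReal) fun A hA hAT => ?_
    have hi : Integrable (A.indicator fun _ => b R) (timeMeasure T) :=
      (integrable_const (b R)).indicator hA
    obtain ⟨hin, ht⟩ := h _ hi
    have eκ : ∫ t in Ioo 0 T, ∫ y, (A.indicator (fun _ => b R) t) y ∂(κ t) =
        ((∫⁻ t in A, ∫⁻ y, ENNReal.ofReal (r R y) ∂(κ t) ∂(timeMeasure T)).toReal : ℂ) := by
      have e1 : ∀ᵐ t ∂(timeMeasure T), ∫ y, (A.indicator (fun _ => b R) t) y ∂(κ t) =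
          ((A.indicator (fun t => (∫⁻ y, ENNReal.ofReal (r R y) ∂(κ t)).toReal) t : ℝ) : ℂ) := by
        filter_upwards with t
        by_cases htA : t ∈ A
        · simp only [htA, indicator_of_mem, hbr]
          rw [integral_complex_ofReal, integral_eq_lintegral_of_nonneg_ae (.of_forall (hr0 R))
            (hrc R).aestronglyMeasurable]
        · simp [htA]
      rw [integral_congr_ae e1, integral_complex_ofReal, integral_indicator hA, integral_toReal]
      · exact (Measurable.lintegral_kernel (κ := κ)
          (hrc R).measurable.ennreal_ofReal).aemeasurable
      · refine ae_restrict_of_ae ?_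
        filter_upwards [hκ] with t ht
        have : IsFiniteMeasure (κ t) := ⟨ht.trans_lt ENNReal.coe_lt_top⟩
        have := (integrable_C0 (κ t) (b R)).re
        simp only [hbr] at this
        exact Integrable.lintegral_lt_top (by simpa using this)
    have en : ∀ n, ‖∫ t in Ioo 0 T, ∫ y, (A.indicator (fun _ => b R) t) y * (H n t y : ℂ)‖ₑ ≤
        B n * timeMeasure T A := fun n => by
      refine (enorm_integral_le_lintegral_enorm _).trans ?_
      rw [← setLIntegral_const, ← lintegral_indicator hA]
      refine lintegral_mono_ae ?_
      filter_upwards [hB n] with t ht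
      by_cases htA : t ∈ A
      · simp only [htA, indicator_of_mem]
        refine (enorm_integral_le_lintegral_enorm _).trans (le_trans ?_ ht)
        refine lintegral_mono fun y => ?_
        rw [hbr, enorm_mul]
        gcongr
        · rw [← ofReal_norm, Complex.norm_real, Real.norm_of_nonneg (hr0 R y)]
          exact ENNReal.ofReal_le_ofReal (hrm R y)
        · rw [← ofReal_norm, ← ofReal_norm, Complex.norm_real]
      · simp [htA]
    have hfin : ∫⁻ t in A, ∫⁻ y, ENNReal.ofReal (r R y) ∂(κ t) ∂(timeMeasure T) ≠ ⊤ := by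
      refine ne_top_of_le_ne_top (b := ENNReal.ofReal (‖b R‖ * C) * timeMeasure T A)
        (ENNReal.mul_ne_top ENNReal.ofReal_ne_top hAT.ne) ?_
      rw [← setLIntegral_const]
      refine lintegral_mono_ae (ae_restrict_of_ae ?_)
      filter_upwards [hκ] with t ht
      calc ∫⁻ y, ENNReal.ofReal (r R y) ∂(κ t) ≤ ∫⁻ _, ENNReal.ofReal ‖b R‖ ∂(κ t) := by
            refine lintegral_mono fun y => ENNReal.ofReal_le_ofReal ?_
            have := C0_norm_coe_le (b R) y
            rwa [hbr, Complex.norm_real, Real.norm_of_nonneg (hr0 R y)] at this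
        _ = ENNReal.ofReal ‖b R‖ * κ t univ := lintegral_const _
        _ ≤ ENNReal.ofReal ‖b R‖ * C := by gcongr
        _ = _ := by rw [ENNReal.ofReal_mul (norm_nonneg _), ENNReal.ofReal_coe_nnreal]
    have h1 := (continuous_enorm.tendsto _).comp ht
    rw [eκ] at h1
    have h2 : ‖((∫⁻ t in A, ∫⁻ y, ENNReal.ofReal (r R y) ∂(κ t) ∂(timeMeasure T)).toReal : ℂ)‖ₑ =
        ∫⁻ t in A, ∫⁻ y, ENNReal.ofReal (r R y) ∂(κ t) ∂(timeMeasure T) := by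
      rw [← ofReal_norm, Complex.norm_real, Real.norm_of_nonneg ENNReal.toReal_nonneg,
        ENNReal.ofReal_toReal hfin]
    rw [h2] at h1
    rw [setLIntegral_const, ← h1.liminf_eq]
    refine (liminf_le_liminf (.of_forall en)).trans (le_of_eq ?_)
    simp only [mul_comm (B _), mul_comm (liminf B atTop)]
    exact ENNReal.liminf_const_mul_of_ne_top hAT.ne
  rw [← ae_all_iff] at key
  filter_upwards [key] with t ht
  have hl : ∀ y, liminf (fun R => ENNReal.ofReal (r R y)) atTop = ENNReal.ofReal (m y) := fun y => by
    have := (tendsto_cutoff y).mul_const (m y)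
    rw [one_mul] at this
    exact (ENNReal.tendsto_ofReal this).liminf_eq
  -- The truncation is removed by Fatou's lemma; the a.e. bound holds for all natural `R`
  -- simultaneously.
  simp only [← hl]
  refine (lintegral_liminf_le fun R => (hrc R).measurable.ennreal_ofReal).trans ?_
  exact liminf_le_of_le (by isBoundedDefault) fun c hc => by
    obtain ⟨R, hR⟩ := hc.exists
    exact hR.trans (ht R)

end Narrow

/-! ### Plancherel's identity for the Fourier integral. -/

section Plancherel

open scoped FourierTransform SchwartzMap

variable {V : Type*} [NormedAddCommGroup V] [InnerProductSpace ℝ V] [FiniteDimensional ℝ V]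
  [MeasurableSpace V] [BorelSpace V]

/-- The abstract `L²` Fourier transform and the Fourier integral define the same distribution:
against a test function, both move the transform onto it. -/
theorem fourier_toLp_ae_eq {h : V → ℂ} (h1 : Integrable h) (h2 : MemLp h 2) :
    (𝓕 (h2.toLp h) : Lp ℂ 2 (volume : Measure V)) =ᵐ[volume] 𝓕 h := by
  have hc : Continuous (𝓕 h) :=
    VectorFourier.fourierIntegral_continuous (by fun_prop) (by simpa using continuous_inner) h1
  have hl : LocallyIntegrable (𝓕 (h2.toLp h) : Lp ℂ 2 (volume : Measure V)) :=
    (Lp.memLp _).locallyIntegrable one_le_two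
  refine ae_eq_of_integral_contDiff_smul_eq hl hc.locallyIntegrable fun g hg hs => ?_
  let S : 𝓢(V, ℂ) := (hs.comp_left (g := ((↑) : ℝ → ℂ)) rfl).toSchwartzMap
    (Complex.ofRealCLM.contDiff.comp hg)
  have hS : ∀ x, S x = (g x : ℂ) := fun x => rfl
  have e1 : ∀ F : V → ℂ, ∫ x, g x • F x = ∫ x, F x * S x := fun F => by
    congr 1; ext x; rw [hS, mul_comm]; simp
  have e2 := congrArg (fun D => D S) (Lp.fourier_toTemperedDistribution_eq (h2.toLp h))
  simp only [TemperedDistribution.fourier_apply, Lp.toTemperedDistribution_apply] at e2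
  rw [e1, e1, integral_fourier_mul h1 S.integrable]
  calc _ = ∫ x, S x • (𝓕 (h2.toLp h) : Lp ℂ 2 (volume : Measure V)) x := by
        simp only [smul_eq_mul, mul_comm]
    _ = _ := e2.symm
    _ = _ := by
      refine integral_congr_ae ?_
      filter_upwards [h2.coeFn_toLp] with x hx
      rw [hx, smul_eq_mul, mul_comm, SchwartzMap.fourier_coe]

theorem lintegral_enorm_sq_eq_eLpNorm {α F : Type*} [MeasurableSpace α] [NormedAddCommGroup F]
    (μ : Measure α) (h : α → F) : ∫⁻ x, ‖h x‖ₑ ^ 2 ∂μ = eLpNorm h 2 μ ^ 2 := by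
  rw [eLpNorm_eq_lintegral_rpow_enorm_toReal two_ne_zero ENNReal.ofNat_ne_top,
    ← ENNReal.rpow_natCast, ← ENNReal.rpow_mul]
  simp

/-- Plancherel's identity on `L^1 ∩ L^2`. -/
theorem lintegral_fourier_sq {h : V → ℂ} (h1 : Integrable h) (h2 : MemLp h 2) :
    ∫⁻ w, ‖𝓕 h w‖ₑ ^ 2 = ∫⁻ x, ‖h x‖ₑ ^ 2 := by
  rw [lintegral_enorm_sq_eq_eLpNorm, lintegral_enorm_sq_eq_eLpNorm,
    ← eLpNorm_congr_ae (fourier_toLp_ae_eq h1 h2), ← Lp.enorm_def, ← ofReal_norm,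
    Lp.norm_fourier_eq, ofReal_norm, Lp.enorm_def, eLpNorm_congr_ae h2.coeFn_toLp]

/-- No measurability of `f` is needed, since a dilation is a homeomorphism. -/
theorem lintegral_comp_smul_pos {ι : Type*} [Fintype ι] (f : EuclideanSpace ℝ ι → ℝ≥0∞) {R : ℝ}
    (hR : 0 < R) : ∫⁻ x, f (R • x) =
      ENNReal.ofReal ((R ^ Fintype.card ι)⁻¹) * ∫⁻ x, f x := by
  have h := (Homeomorph.smulOfNeZero R hR.ne').measurableEmbedding.lintegral_map
    (μ := (volume : Measure (EuclideanSpace ℝ ι))) f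
  simp only [Homeomorph.smulOfNeZero_apply] at h
  rw [← h]
  change ∫⁻ a, f a ∂(Measure.map (R • ·) volume) = _
  rw [Measure.map_addHaar_smul volume hR.ne', lintegral_smul_measure, finrank_euclideanSpace,
    abs_of_pos (by positivity), smul_eq_mul]

end Plancherel

/-! ### Gaussian integrals and moments. -/

section Gaussian

variable {d : ℕ}

/-- The square root of the Gaussian `γ_ε`. -/
def sqrtGaussian (ε : ℝ) (x : Eu d) : ℝ :=
  ((Real.pi * ε) ^ ((d : ℝ) / 4))⁻¹ * Real.exp (-(‖x‖ ^ 2 / (2 * ε)))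

theorem continuous_gaussian (ε : ℝ) : Continuous (gaussian ε : Eu d → ℝ) := by
  unfold gaussian; fun_prop

theorem continuous_sqrtGaussian (ε : ℝ) : Continuous (sqrtGaussian ε : Eu d → ℝ) := by
  unfold sqrtGaussian; fun_prop

theorem gaussian_nonneg {ε : ℝ} (hε : 0 < ε) (x : Eu d) : 0 ≤ gaussian ε x := by
  unfold gaussian; positivity

theorem sqrtGaussian_nonneg {ε : ℝ} (hε : 0 < ε) (x : Eu d) : 0 ≤ sqrtGaussian ε x := by
  unfold sqrtGaussian; positivity

theorem gaussian_neg (ε : ℝ) (x : Eu d) : gaussian ε (-x) = gaussian ε x := by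
  unfold gaussian; rw [norm_neg]

theorem sqrtGaussian_mul {ε : ℝ} (hε : 0 < ε) (x y : Eu d) :
    sqrtGaussian ε x * sqrtGaussian ε y =
      ((Real.pi * ε) ^ ((d : ℝ) / 2))⁻¹ * Real.exp (-((‖x‖ ^ 2 + ‖y‖ ^ 2) / 2 / ε)) := by
  unfold sqrtGaussian
  have h1 : (Real.pi * ε) ^ ((d : ℝ) / 2) =
      (Real.pi * ε) ^ ((d : ℝ) / 4) * (Real.pi * ε) ^ ((d : ℝ) / 4) := by
    rw [← Real.rpow_add (by positivity)]; congr 1; ring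
  have h2 : Real.exp (-((‖x‖ ^ 2 + ‖y‖ ^ 2) / 2 / ε)) =
      Real.exp (-(‖x‖ ^ 2 / (2 * ε))) * Real.exp (-(‖y‖ ^ 2 / (2 * ε))) := by
    rw [← Real.exp_add]; congr 1; field_simp; ring
  rw [h1, h2, mul_inv]; ring

theorem sqrtGaussian_sq {ε : ℝ} (hε : 0 < ε) (x : Eu d) :
    sqrtGaussian ε x ^ 2 = gaussian ε x := by
  rw [sq, sqrtGaussian_mul hε, gaussian, add_self_div_two]

theorem gaussian_eq {ε : ℝ} (x : Eu d) : gaussian ε x =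
    ((Real.pi * ε) ^ ((d : ℝ) / 2))⁻¹ * Real.exp (-(1 / ε) * ‖x‖ ^ 2) := by
  unfold gaussian; congr 2; ring

theorem integral_gaussian {ε : ℝ} (hε : 0 < ε) : ∫ x : Eu d, gaussian ε x = 1 := by
  simp only [gaussian_eq]
  rw [integral_const_mul, GaussianFourier.integral_rexp_neg_mul_sq_norm (by positivity),
    finrank_euclideanSpace, Fintype.card_fin, div_div_eq_mul_div, div_one]
  exact inv_mul_cancel₀ (by positivity)

theorem integrable_gaussian {ε : ℝ} (hε : 0 < ε) : Integrable (gaussian ε : Eu d → ℝ) := by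
  by_contra h
  have := integral_gaussian (d := d) hε
  rw [integral_undef h] at this
  exact zero_ne_one this

theorem lintegral_gaussian {ε : ℝ} (hε : 0 < ε) :
    ∫⁻ x : Eu d, ENNReal.ofReal (gaussian ε x) = 1 := by
  rw [← ofReal_integral_eq_lintegral_ofReal (integrable_gaussian hε)
    (.of_forall (gaussian_nonneg hε)), integral_gaussian hε, ENNReal.ofReal_one]

theorem lintegral_gaussian_sub {ε : ℝ} (hε : 0 < ε) (a : Eu d) :
    ∫⁻ x : Eu d, ENNReal.ofReal (gaussian ε (x - a)) = 1 := by
  rw [lintegral_sub_right_eq_self (fun x => ENNReal.ofReal (gaussian ε x)) a,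
    lintegral_gaussian hε]

/-- Source of the factor `exp(-ε|z|²/4)`: convolution with `γ_ε` in `ξ` is multiplication by it on
the side of `z`. -/
theorem integral_exp_mul_gaussian {ε : ℝ} (hε : 0 < ε) (ξ z : Eu d) :
    ∫ η, Complex.exp (-(Complex.I * (inner ℝ η z : ℝ))) * (gaussian ε (ξ - η) : ℂ) =
      Complex.exp (-(Complex.I * (inner ℝ ξ z : ℝ))) * Real.exp (-(ε / 4 * ‖z‖ ^ 2)) := by
  have h1 : ∫ η, Complex.exp (-(Complex.I * (inner ℝ η z : ℝ))) * (gaussian ε (ξ - η) : ℂ) =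
      ∫ η, Complex.exp (-(Complex.I * (inner ℝ (ξ - η) z : ℝ))) * (gaussian ε η : ℂ) := by
    rw [← integral_sub_left_eq_self
      (fun η => Complex.exp (-(Complex.I * (inner ℝ η z : ℝ))) * (gaussian ε (ξ - η) : ℂ)) volume ξ]
    simp
  have hb : 0 < ((1 / ε : ℝ) : ℂ).re := by simpa using hε
  have h2 := GaussianFourier.integral_cexp_neg_mul_sq_norm_add hb Complex.I z
  have hpe : (0 : ℝ) < (Real.pi * ε) ^ ((d : ℝ) / 2) := by positivity
  have h3 : ∀ η : Eu d, Complex.exp (-(Complex.I * (inner ℝ (ξ - η) z : ℝ))) * (gaussian ε η : ℂ) =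
      Complex.exp (-(Complex.I * (inner ℝ ξ z : ℝ))) *
        ((((Real.pi * ε) ^ ((d : ℝ) / 2))⁻¹ : ℝ) : ℂ) *
        Complex.exp (-((1 / ε : ℝ) : ℂ) * ‖η‖ ^ 2 + Complex.I * (inner ℝ z η : ℝ)) := fun η => by
    rw [gaussian_eq, inner_sub_left, Complex.exp_add, real_inner_comm z η]
    push_cast
    rw [mul_sub, neg_sub, sub_eq_add_neg, Complex.exp_add]
    ring
  rw [h1]
  simp only [h3]
  rw [integral_const_mul, h2, finrank_euclideanSpace, Fintype.card_fin]
  have h4 : ((Real.pi : ℂ) / ((1 / ε : ℝ) : ℂ)) ^ ((d : ℂ) / 2) =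
      (((Real.pi * ε) ^ ((d : ℝ) / 2) : ℝ) : ℂ) := by
    rw [Complex.ofReal_cpow (by positivity)]
    push_cast
    congr 1
    field_simp
  have h5 : Complex.I ^ 2 * (‖z‖ : ℂ) ^ 2 / (4 * ((1 / ε : ℝ) : ℂ)) =
      ((-(ε / 4 * ‖z‖ ^ 2) : ℝ) : ℂ) := by
    rw [Complex.I_sq]
    have : (ε : ℂ) ≠ 0 := by exact_mod_cast hε.ne'
    push_cast
    field_simp
  have h6 : ((((Real.pi * ε) ^ ((d : ℝ) / 2))⁻¹ : ℝ) : ℂ) *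
      (((Real.pi * ε) ^ ((d : ℝ) / 2) : ℝ) : ℂ) = 1 := by
    rw [← Complex.ofReal_mul, inv_mul_cancel₀ hpe.ne', Complex.ofReal_one]
  rw [h4, h5, ← Complex.ofReal_exp]
  linear_combination Complex.exp (-(Complex.I * (inner ℝ ξ z : ℝ))) *
    (Real.exp (-(ε / 4 * ‖z‖ ^ 2)) : ℂ) * h6

/-- A bound, up to the factor `ε`, for the second moment of `γ_ε`. -/
def gaussianMoment (d : ℕ) : ℝ≥0 := ⟨2 * 2 ^ ((d : ℝ) / 2), by positivity⟩

/-- Half of the exponent absorbs `‖x‖²`, at the price of `2ε`, and the other half leaves a multiple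
of the normalised Gaussian `γ_{2ε}`. The constant is not sharp; only the order `ε` matters. -/
theorem lintegral_sq_gaussian_le {ε : ℝ} (hε : 0 < ε) :
    ∫⁻ x : Eu d, ‖x‖ₑ ^ 2 * ENNReal.ofReal (gaussian ε x) ≤
      ENNReal.ofReal ε * gaussianMoment d := by
  have h2ε : 0 < 2 * ε := by positivity
  have h : ∀ x : Eu d, ‖x‖ ^ 2 * gaussian ε x ≤ ε * (2 * 2 ^ ((d : ℝ) / 2)) * gaussian (2 * ε) x := by
    intro x
    have e1 : (Real.pi * (2 * ε)) ^ ((d : ℝ) / 2) =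
        2 ^ ((d : ℝ) / 2) * (Real.pi * ε) ^ ((d : ℝ) / 2) := by
      rw [← Real.mul_rpow (by positivity) (by positivity)]; congr 1; ring
    have e2 : Real.exp (-(‖x‖ ^ 2 / ε)) =
        Real.exp (-(‖x‖ ^ 2 / (2 * ε))) * Real.exp (-(‖x‖ ^ 2 / (2 * ε))) := by
      rw [← Real.exp_add]; congr 1; field_simp; ring
    have e3 : ‖x‖ ^ 2 * Real.exp (-(‖x‖ ^ 2 / (2 * ε))) ≤ 2 * ε := by
      rw [Real.exp_neg, ← div_eq_mul_inv, div_le_iff₀ (Real.exp_pos _)]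
      have := Real.add_one_le_exp (‖x‖ ^ 2 / (2 * ε))
      calc ‖x‖ ^ 2 = 2 * ε * (‖x‖ ^ 2 / (2 * ε)) := by field_simp
        _ ≤ _ := by gcongr; linarith
    unfold gaussian
    rw [e1, e2, mul_inv]
    have hp : (0 : ℝ) < 2 ^ ((d : ℝ) / 2) := by positivity
    calc _ = ((Real.pi * ε) ^ ((d : ℝ) / 2))⁻¹ * Real.exp (-(‖x‖ ^ 2 / (2 * ε))) *
          (‖x‖ ^ 2 * Real.exp (-(‖x‖ ^ 2 / (2 * ε)))) := by ring
      _ ≤ ((Real.pi * ε) ^ ((d : ℝ) / 2))⁻¹ * Real.exp (-(‖x‖ ^ 2 / (2 * ε))) * (2 * ε) := by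
        gcongr
      _ = _ := by field_simp
  calc ∫⁻ x : Eu d, ‖x‖ₑ ^ 2 * ENNReal.ofReal (gaussian ε x)
      ≤ ∫⁻ x : Eu d, ENNReal.ofReal (ε * (2 * 2 ^ ((d : ℝ) / 2))) *
        ENNReal.ofReal (gaussian (2 * ε) x) := by
        refine lintegral_mono fun x => ?_
        rw [← ofReal_norm, ← ENNReal.ofReal_pow (norm_nonneg _),
          ← ENNReal.ofReal_mul (by positivity), ← ENNReal.ofReal_mul (by positivity)]
        exact ENNReal.ofReal_le_ofReal (h x)
    _ = ENNReal.ofReal (ε * (2 * 2 ^ ((d : ℝ) / 2))) := by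
      rw [lintegral_const_mul' _ _ ENNReal.ofReal_ne_top, lintegral_gaussian h2ε, mul_one]
    _ = _ := by
      rw [ENNReal.ofReal_mul hε.le]
      congr 1
      exact ENNReal.ofReal_eq_coe_nnreal _

/-- The parallelogram law, integrated against the even function `γ_ε`. -/
theorem lintegral_sq_add_odd_gaussian_le {F : Type*} [NormedAddCommGroup F] [InnerProductSpace ℝ F]
    {ε : ℝ} (hε : 0 < ε) {u : Eu d → F} (hu : Continuous u) (hodd : ∀ s, u (-s) = -u s) (p : F) :
    ∫⁻ s : Eu d, ‖p + u s‖ₑ ^ 2 * ENNReal.ofReal (gaussian ε s) ≤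
      ‖p‖ₑ ^ 2 + ∫⁻ s : Eu d, ‖u s‖ₑ ^ 2 * ENNReal.ofReal (gaussian ε s) := by
  have hm : Measurable fun x : Eu d => ENNReal.ofReal (gaussian ε x) :=
    (continuous_gaussian ε).measurable.ennreal_ofReal
  have hpm : Measurable fun s => ‖p + u s‖ₑ ^ 2 * ENNReal.ofReal (gaussian ε s) :=
    ((continuous_enorm.comp (continuous_const.add hu)).measurable.pow_const 2).mul hm
  have h2 : ∫⁻ s : Eu d, ‖p + u s‖ₑ ^ 2 * ENNReal.ofReal (gaussian ε s) =
      ∫⁻ s : Eu d, ‖p - u s‖ₑ ^ 2 * ENNReal.ofReal (gaussian ε s) := by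
    rw [← lintegral_neg_eq_self
      (fun s : Eu d => ‖p + u s‖ₑ ^ 2 * ENNReal.ofReal (gaussian ε s))]
    refine lintegral_congr fun s => ?_
    rw [gaussian_neg, hodd, ← sub_eq_add_neg]
  have h3 : ∀ s : Eu d, ‖p + u s‖ₑ ^ 2 + ‖p - u s‖ₑ ^ 2 = 2 * (‖p‖ₑ ^ 2 + ‖u s‖ₑ ^ 2) := fun s => by
    simp only [← ofReal_norm, ← ENNReal.ofReal_pow (norm_nonneg _)]
    have e : ∀ r : ℝ, 2 * ENNReal.ofReal r = ENNReal.ofReal (2 * r) := fun r => by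
      rw [ENNReal.ofReal_mul (by norm_num), ENNReal.ofReal_ofNat]
    rw [← ENNReal.ofReal_add (by positivity) (by positivity),
      ← ENNReal.ofReal_add (by positivity) (by positivity), e]
    congr 1
    have := parallelogram_law_with_norm ℝ p (u s)
    nlinarith
  have h4 : 2 * ∫⁻ s : Eu d, ‖p + u s‖ₑ ^ 2 * ENNReal.ofReal (gaussian ε s) =
      2 * (‖p‖ₑ ^ 2 + ∫⁻ s : Eu d, ‖u s‖ₑ ^ 2 * ENNReal.ofReal (gaussian ε s)) := by
    calc _ = (∫⁻ s : Eu d, ‖p + u s‖ₑ ^ 2 * ENNReal.ofReal (gaussian ε s)) +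
          ∫⁻ s : Eu d, ‖p - u s‖ₑ ^ 2 * ENNReal.ofReal (gaussian ε s) := by rw [← h2, two_mul]
      _ = ∫⁻ s : Eu d, 2 * (‖p‖ₑ ^ 2 * ENNReal.ofReal (gaussian ε s) +
          ‖u s‖ₑ ^ 2 * ENNReal.ofReal (gaussian ε s)) := by
        rw [← lintegral_add_left hpm]
        refine lintegral_congr fun s => ?_
        rw [← add_mul, h3]; ring
      _ = _ := by
        rw [lintegral_const_mul' _ _ ENNReal.ofNat_ne_top, lintegral_add_left (hm.const_mul _),
          lintegral_const_mul' _ _ (by simp), lintegral_gaussian hε, mul_one]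
  exact (ENNReal.mul_le_mul_iff_right two_ne_zero ENNReal.ofNat_ne_top).1 h4.le

/-- After translating by `a`, the cross term in `‖a + s‖²` is odd in `s` and integrates to zero. -/
theorem lintegral_sq_gaussian_sub_le {ε : ℝ} (hε : 0 < ε) (a : Eu d) :
    ∫⁻ x : Eu d, ‖x‖ₑ ^ 2 * ENNReal.ofReal (gaussian ε (x - a)) ≤
      ‖a‖ₑ ^ 2 + ENNReal.ofReal ε * gaussianMoment d := by
  rw [← lintegral_add_left_eq_self
    (fun x : Eu d => ‖x‖ₑ ^ 2 * ENNReal.ofReal (gaussian ε (x - a))) a]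
  simp only [add_sub_cancel_left]
  exact (lintegral_sq_add_odd_gaussian_le hε continuous_id (fun _ => rfl) a).trans
    (add_le_add_right (lintegral_sq_gaussian_le hε) _)

end Gaussian

/-! ### The Husimi transform as a squared modulus; its mass and `x`-moment. -/

section Husimi

open scoped FourierTransform

variable {d : ℕ}

/-- The localisation `a ↦ g(a) γ_ε(x - a)^{1/2}` of `g` near `x`. -/
def localized (ε : ℝ) (g : Eu d → ℂ) (x a : Eu d) : ℂ := g a * (sqrtGaussian ε (x - a) : ℂ)

/-- The Husimi transform as a squared modulus. -/
@[irreducible] def husimiDensity (ε : ℝ) (g : Eu d → ℂ) (x ξ : Eu d) : ℝ :=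
  ((2 * Real.pi * ε) ^ d)⁻¹ * ‖𝓕 (localized ε g x) ((2 * Real.pi * ε)⁻¹ • ξ)‖ ^ 2

/-- `F_ξ` of the Husimi transform. -/
def smoothedCorrelation (ε : ℝ) (g : Eu d → ℂ) (x z : Eu d) : ℂ :=
  (Real.exp (-(ε / 4 * ‖z‖ ^ 2)) : ℂ) * ∫ y, correlation ε g y z * (gaussian ε (x - y) : ℂ)

theorem husimiDensity_nonneg {ε : ℝ} (hε : 0 < ε) (g : Eu d → ℂ) (x ξ : Eu d) :
    0 ≤ husimiDensity ε g x ξ := by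
  unfold husimiDensity; positivity

theorem measurable_correlation {ε : ℝ} {g : Eu d → ℂ} (hm : Measurable g) :
    Measurable (fun p : Eu d × Eu d => correlation ε g p.1 p.2) := by
  unfold correlation; fun_prop

theorem norm_exp_neg_I (r : ℝ) : ‖Complex.exp (-(Complex.I * (r : ℂ)))‖ = 1 := by
  simp [Complex.norm_exp]

theorem integrable_correlation_mul_gaussian {ε : ℝ} (hε : 0 < ε) {g : Eu d → ℂ} (hm : Measurable g)
    (hg : Integrable (fun x => ‖g x‖ ^ 2)) (x : Eu d) :
    Integrable (fun p : Eu d × Eu d => correlation ε g p.1 p.2 * (gaussian ε (x - p.1) : ℂ))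
      (volume.prod volume) := by
  have hmeas : AEStronglyMeasurable (fun p : Eu d × Eu d =>
      correlation ε g p.1 p.2 * (gaussian ε (x - p.1) : ℂ)) (volume.prod volume) := by
    have := (continuous_gaussian (d := d) ε).measurable
    exact ((measurable_correlation hm).mul (by fun_prop)).aestronglyMeasurable
  have hγ : Integrable (fun y => gaussian ε (x - y)) := (integrable_gaussian hε).comp_sub_left x
  rw [integrable_prod_iff hmeas]
  refine ⟨.of_forall fun y => by
    exact (correlation_right hε hm hg y).1.mul_const ((gaussian ε (x - y) : ℝ) : ℂ), ?_⟩
  refine (hγ.const_mul (|((ε / 2) ^ d)⁻¹| * ∫ x, ‖g x‖ ^ 2)).mono'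
    hmeas.norm.integral_prod_right' (.of_forall fun y => ?_)
  rw [Real.norm_of_nonneg (integral_nonneg fun _ => norm_nonneg _)]
  simp only [norm_mul, Complex.norm_real, Real.norm_of_nonneg (gaussian_nonneg hε _)]
  rw [integral_mul_const]
  exact mul_le_mul_of_nonneg_right (correlation_right hε hm hg y).2 (gaussian_nonneg hε _)

theorem integrable_smoothedCorrelation {ε : ℝ} (hε : 0 < ε) {g : Eu d → ℂ} (hm : Measurable g)
    (hg : Integrable (fun x => ‖g x‖ ^ 2)) (x : Eu d) :
    Integrable (smoothedCorrelation ε g x) := by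
  refine (integrable_correlation_mul_gaussian hε hm hg x).integral_prod_right.bdd_mul (c := 1)
    (Continuous.aestronglyMeasurable (by fun_prop)) (.of_forall fun z => ?_)
  rw [Complex.norm_real, Real.norm_of_nonneg (Real.exp_pos _).le, Real.exp_le_one_iff]
  have : 0 ≤ ε / 4 * ‖z‖ ^ 2 := by positivity
  linarith

/-- Fubini: the `z`-integral of the Wigner transform is pulled outside, and the two Gaussian
convolutions act separately, as an average in `x` and as a multiplier in `z`. The uniform bound on
`∫ ‖correlation‖ dz` and the integrability of the Gaussians justify the exchange. -/
theorem husimi_eq_integral {ε : ℝ} (hε : 0 < ε) {g : Eu d → ℂ} (hm : Measurable g)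
    (hg : Integrable (fun x => ‖g x‖ ^ 2)) (x ξ : Eu d) :
    husimi ε g x ξ = ((2 * Real.pi) ^ d : ℝ)⁻¹ *
      ∫ z, Complex.exp (-(Complex.I * (inner ℝ ξ z : ℝ))) * smoothedCorrelation ε g x z := by
  have hγ : Measurable (gaussian ε : Eu d → ℝ) := (continuous_gaussian ε).measurable
  let K : (Eu d × Eu d) × Eu d → ℂ := fun q =>
    Complex.exp (-(Complex.I * (inner ℝ q.1.2 q.2 : ℝ))) * correlation ε g q.1.1 q.2 *
      ((gaussian ε (x - q.1.1) * gaussian ε (ξ - q.1.2) : ℝ) : ℂ)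
  have hKm : AEStronglyMeasurable K ((volume.prod volume).prod volume) := by
    refine Measurable.aestronglyMeasurable ?_
    refine ((Continuous.measurable (by fun_prop)).mul ((measurable_correlation hm).comp
      ((measurable_fst.comp measurable_fst).prodMk measurable_snd))).mul (by fun_prop)
  have hγx : ∀ x : Eu d, Integrable (fun y => gaussian ε (x - y)) :=
    fun x => (integrable_gaussian hε).comp_sub_left x
  have hK : Integrable K ((volume.prod volume).prod volume) := by
    rw [integrable_prod_iff hKm]
    constructor
    · refine .of_forall fun p => ?_
      refine Integrable.mul_const (f := fun z => Complex.exp (-(Complex.I * (inner ℝ p.2 z : ℝ))) *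
        correlation ε g p.1 z) ?_ ((gaussian ε (x - p.1) * gaussian ε (ξ - p.2) : ℝ) : ℂ)
      exact (correlation_right hε hm hg p.1).1.bdd_mul (c := 1)
        (Continuous.aestronglyMeasurable (by fun_prop)) (.of_forall fun z => (norm_exp_neg_I _).le)
    · refine (((hγx x).mul_prod (hγx ξ)).const_mul
        (|((ε / 2) ^ d)⁻¹| * ∫ x, ‖g x‖ ^ 2)).mono'
        hKm.norm.integral_prod_right' (.of_forall fun p => ?_)
      rw [Real.norm_of_nonneg (integral_nonneg fun _ => norm_nonneg _)]
      have h0 := mul_nonneg (gaussian_nonneg hε (x - p.1)) (gaussian_nonneg hε (ξ - p.2))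
      simp only [K, norm_mul, norm_exp_neg_I, one_mul, Complex.norm_real, norm_mul,
        Real.norm_of_nonneg (gaussian_nonneg hε _)]
      rw [integral_mul_const]
      exact mul_le_mul_of_nonneg_right (correlation_right hε hm hg p.1).2 h0
  have e1 : husimi ε g x ξ = ((2 * Real.pi) ^ d : ℝ)⁻¹ *
      ∫ p : Eu d × Eu d, ∫ z, K (p, z) := by
    rw [husimi, ← integral_const_mul]
    refine integral_congr_ae (.of_forall fun p => ?_)
    simp only [K]
    rw [integral_mul_const, wigner]
    ring
  rw [e1, Measure.volume_eq_prod, integral_integral_swap hK]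
  congr 1
  refine integral_congr_ae (.of_forall fun z => ?_)
  have e2 : ∀ p : Eu d × Eu d, K (p, z) =
      (correlation ε g p.1 z * (gaussian ε (x - p.1) : ℂ)) *
      (Complex.exp (-(Complex.I * (inner ℝ p.2 z : ℝ))) * (gaussian ε (ξ - p.2) : ℂ)) :=
    fun p => by simp only [K]; push_cast; ring
  simp only [e2]
  rw [integral_prod_mul (fun y => correlation ε g y z * (gaussian ε (x - y) : ℂ))
    (fun η => Complex.exp (-(Complex.I * (inner ℝ η z : ℝ))) * (gaussian ε (ξ - η) : ℂ)),
    integral_exp_mul_gaussian hε, smoothedCorrelation]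
  ring

theorem memLp_localized {ε : ℝ} (hε : 0 < ε) {g : Eu d → ℂ} (hg : MemLp g 2) (x : Eu d) :
    MemLp (localized ε g x) 2 := by
  refine hg.of_le_mul (c := ((Real.pi * ε) ^ ((d : ℝ) / 4))⁻¹)
    (hg.1.mul (Continuous.aestronglyMeasurable ?_)) (.of_forall fun a => ?_)
  · have := continuous_sqrtGaussian (d := d) ε
    fun_prop
  · rw [localized, norm_mul, Complex.norm_real, Real.norm_of_nonneg (sqrtGaussian_nonneg hε _),
      mul_comm]
    refine mul_le_mul_of_nonneg_right ?_ (norm_nonneg _)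
    unfold sqrtGaussian
    refine mul_le_of_le_one_right (by positivity) (Real.exp_le_one_iff.2 ?_)
    have : 0 ≤ ‖x - a‖ ^ 2 / (2 * ε) := by positivity
    linarith

theorem memLp_sqrtGaussian {ε : ℝ} (hε : 0 < ε) (x : Eu d) :
    MemLp (fun a => (sqrtGaussian ε (x - a) : ℂ)) 2 := by
  have hc := continuous_sqrtGaussian (d := d) ε
  rw [memLp_two_iff_integrable_sq_norm (Continuous.aestronglyMeasurable (by fun_prop))]
  simp only [Complex.norm_real, Real.norm_eq_abs, sq_abs, sqrtGaussian_sq hε]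
  exact (integrable_gaussian hε).comp_sub_left x

theorem integrable_localized {ε : ℝ} (hε : 0 < ε) {g : Eu d → ℂ} (hg : MemLp g 2) (x : Eu d) :
    Integrable (localized ε g x) :=
  hg.integrable_mul (memLp_sqrtGaussian hε x)

/-- The localisation of `g`, modulated by the frequency `ξ / ε`. -/
def modulated (ε : ℝ) (g : Eu d → ℂ) (x ξ a : Eu d) : ℂ :=
  Complex.exp (-(Complex.I * (inner ℝ ξ (ε⁻¹ • a) : ℝ))) * localized ε g x a

/-- The identity behind nonnegativity. The points `b` and `b + εz` have midpoint `b + (ε/2)z` and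
half-difference `(ε/2)z`, and the parallelogram law splits the exponent accordingly. -/
theorem gaussian_mul_exp_eq {ε : ℝ} (hε : 0 < ε) (x b z : Eu d) :
    Real.exp (-(ε / 4 * ‖z‖ ^ 2)) * gaussian ε (x - (b + (ε / 2) • z)) =
      sqrtGaussian ε (x - (b + ε • z)) * sqrtGaussian ε (x - b) := by
  have h1 : b + (ε / 2) • z + (ε / 2) • z = b + ε • z := by
    rw [add_assoc, ← add_smul, add_halves]
  rw [sqrtGaussian_mul hε, gaussian, mul_left_comm, ← Real.exp_add]
  congr 2
  have hp := parallelogram_law_with_norm ℝ (x - (b + (ε / 2) • z)) ((ε / 2) • z)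
  have k1 : x - (b + (ε / 2) • z) + (ε / 2) • z = x - b := by abel
  have k2 : x - (b + (ε / 2) • z) - (ε / 2) • z = x - (b + ε • z) := by rw [← h1]; abel
  have k3 : ‖(ε / 2) • z‖ = ε / 2 * ‖z‖ := by
    rw [norm_smul, Real.norm_of_nonneg (by positivity)]
  rw [k1, k2, k3] at hp
  have k4 : (‖x - (b + ε • z)‖ ^ 2 + ‖x - b‖ ^ 2) / 2 =
      ‖x - (b + (ε / 2) • z)‖ ^ 2 + (ε / 2 * ‖z‖) ^ 2 := by nlinarith
  rw [k4]
  field_simp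
  ring

/-- The phase splits in the same way, as `z = ((b + εz) - b)/ε`, so the integrand is one function at
`b + εz` times its conjugate at `b`. -/
theorem correlation_eq_modulated {ε : ℝ} (hε : 0 < ε) (g : Eu d → ℂ) (x ξ z b : Eu d) :
    Complex.exp (-(Complex.I * (inner ℝ ξ z : ℝ))) *
      (Real.exp (-(ε / 4 * ‖z‖ ^ 2)) : ℂ) * (correlation ε g (b + (ε / 2) • z) z *
        (gaussian ε (x - (b + (ε / 2) • z)) : ℂ)) =
      modulated ε g x ξ (b + ε • z) * conj (modulated ε g x ξ b) := by
  have h1 : b + (ε / 2) • z + (ε / 2) • z = b + ε • z := by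
    rw [add_assoc, ← add_smul, add_halves]
  have h2 : b + (ε / 2) • z - (ε / 2) • z = b := by abel
  have h3 := gaussian_mul_exp_eq hε x b z
  have h4 : Complex.exp (-(Complex.I * (inner ℝ ξ z : ℝ))) =
      Complex.exp (-(Complex.I * (inner ℝ ξ (ε⁻¹ • (b + ε • z)) : ℝ))) *
      conj (Complex.exp (-(Complex.I * (inner ℝ ξ (ε⁻¹ • b) : ℝ)))) := by
    rw [← Complex.exp_conj, ← Complex.exp_add, smul_add, inv_smul_smul₀ hε.ne', inner_add_right]
    simp only [map_neg, map_mul, Complex.conj_I, Complex.conj_ofReal]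
    push_cast
    congr 1
    ring
  simp only [modulated, localized, map_mul, Complex.conj_ofReal]
  rw [correlation, h1, h2, h4]
  have h3' := congrArg (fun r : ℝ => (r : ℂ)) h3
  push_cast at h3' ⊢
  linear_combination (Complex.exp (-(Complex.I * (inner ℝ ξ (ε⁻¹ • (b + ε • z)) : ℝ))) *
      conj (Complex.exp (-(Complex.I * (inner ℝ ξ (ε⁻¹ • b) : ℝ)))) * g (b + ε • z) *
      conj (g b)) * h3'

/-- With `a = b + εz` the integral in `(b, z)` becomes `ε^{-d}` times the product of `∫ H` and its
conjugate. No sign or size information is needed beyond `H ∈ L¹`. -/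
theorem husimi_eq_aux {ε : ℝ} (hε : 0 < ε) {g : Eu d → ℂ} (hm : Measurable g) (hg : MemLp g 2)
    (x ξ : Eu d) : husimi ε g x ξ = (husimiDensity ε g x ξ : ℂ) := by
  have hg2 : Integrable (fun x => ‖g x‖ ^ 2) := hg.integrable_norm_pow two_ne_zero
  have hlm : Measurable (localized ε g x) := by
    have := (continuous_sqrtGaussian (d := d) ε).measurable
    unfold localized; fun_prop
  have hHdef : ∀ a, modulated ε g x ξ a = Complex.exp (-(Complex.I * (inner ℝ ξ (ε⁻¹ • a) : ℝ))) *
      localized ε g x a := fun _ => rfl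
  have hHm : Measurable (modulated ε g x ξ) := (Continuous.measurable (by fun_prop)).mul hlm
  have hH : Integrable (modulated ε g x ξ) := (integrable_localized hε hg x).bdd_mul (c := 1)
    (Continuous.aestronglyMeasurable (by fun_prop)) (.of_forall fun z => (norm_exp_neg_I _).le)
  have e1 := correlation_eq_modulated hε g x ξ
  -- Only the integrability, measurability and factorisation recorded above are used from here,
  -- together with `hHdef`.
  generalize modulated ε g x ξ = H at *
  have hHε : ∀ b, Integrable (fun z => H (b + ε • z)) := fun b =>
    (integrable_comp_smul_iff volume (fun y => H (b + y)) hε.ne').2 (hH.comp_add_left b)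
  have hsub : ∀ (F : Eu d → ℂ) (b : Eu d), ∫ z, F (b + ε • z) = ((ε ^ d)⁻¹ : ℝ) • ∫ a, F a := by
    intro F b
    rw [Measure.integral_comp_smul volume (fun y => F (b + y)), integral_add_left_eq_self,
      finrank_euclideanSpace, Fintype.card_fin, abs_of_pos (by positivity)]
  have hsubn : ∀ b : Eu d, ∫ z, ‖H (b + ε • z)‖ = (ε ^ d)⁻¹ * ∫ a, ‖H a‖ := by
    intro b
    rw [Measure.integral_comp_smul volume (fun y => ‖H (b + y)‖),
      integral_add_left_eq_self (fun y => ‖H y‖),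
      finrank_euclideanSpace, Fintype.card_fin, abs_of_pos (by positivity), smul_eq_mul]
  have hI : Integrable (fun p : Eu d × Eu d => H (p.1 + ε • p.2) * conj (H p.1))
      (volume.prod volume) := by
    have hmeas : AEStronglyMeasurable (fun p : Eu d × Eu d => H (p.1 + ε • p.2) * conj (H p.1))
        (volume.prod volume) :=
      ((hHm.comp (by fun_prop)).mul (Complex.continuous_conj.measurable.comp
        (hHm.comp measurable_fst))).aestronglyMeasurable
    rw [integrable_prod_iff hmeas]
    refine ⟨.of_forall fun b => by exact (hHε b).mul_const (conj (H b)), ?_⟩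
    refine (hH.norm.const_mul ((ε ^ d)⁻¹ * ∫ a, ‖H a‖)).congr (.of_forall fun b => ?_)
    simp only [norm_mul, RCLike.norm_conj]
    rw [integral_mul_const, hsubn]
  have e2 : ∀ z, Complex.exp (-(Complex.I * (inner ℝ ξ z : ℝ))) * smoothedCorrelation ε g x z =
      ∫ b, H (b + ε • z) * conj (H b) := by
    intro z
    rw [smoothedCorrelation, ← mul_assoc, ← integral_const_mul]
    -- The shift `y = b + (ε/2)z` passes from the midpoint to the endpoint `b`, where `e1` applies.
    rw [← integral_add_right_eq_self _ ((ε / 2) • z)]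
    exact integral_congr_ae (.of_forall fun b => e1 z b)
  have e3 : 𝓕 (localized ε g x) ((2 * Real.pi * ε)⁻¹ • ξ) = ∫ a, H a := by
    rw [Real.fourier_eq']
    refine integral_congr_ae (.of_forall fun a => ?_)
    simp only [hHdef, smul_eq_mul]
    congr 2
    rw [inner_smul_right, inner_smul_right, real_inner_comm]
    have : (ε : ℂ) ≠ 0 := by exact_mod_cast hε.ne'
    push_cast
    field_simp
  rw [husimi_eq_integral hε hm hg2]
  simp only [e2]
  rw [← integral_integral_swap hI]
  simp only [integral_mul_const, hsub]
  rw [integral_const_mul, integral_conj, husimiDensity, e3, smul_mul_assoc, Complex.mul_conj,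
    Complex.normSq_eq_norm_sq, Complex.real_smul]
  push_cast
  rw [mul_pow, mul_pow, mul_inv, mul_inv, mul_pow, mul_inv]
  ring

theorem ae_correlation_right {ε : ℝ} (hε : 0 < ε) {g g' : Eu d → ℂ} (h : g =ᵐ[volume] g')
    (x : Eu d) : ∀ᵐ z, correlation ε g x z = correlation ε g' x z := by
  have hc : ε / 2 ≠ 0 := by positivity
  have hs : Measure.QuasiMeasurePreserving (fun z : Eu d => (ε / 2) • z) volume volume :=
    ⟨by fun_prop, by
      rw [Measure.map_addHaar_smul volume hc]; exact Measure.smul_absolutelyContinuous⟩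
  filter_upwards [((measurePreserving_add_left volume x).quasiMeasurePreserving.comp hs).ae h,
    ((quasiMeasurePreserving_sub_left volume x).comp hs).ae h] with z h1 h2
  simp only [Function.comp] at h1 h2
  rw [correlation, correlation, h1, h2]

theorem ae_correlation_left (ε : ℝ) {g g' : Eu d → ℂ} (h : g =ᵐ[volume] g') (z : Eu d) :
    ∀ᵐ x, correlation ε g x z = correlation ε g' x z := by
  filter_upwards [(measurePreserving_add_right volume ((ε / 2) • z)).quasiMeasurePreserving.ae h,
    (measurePreserving_sub_right volume ((ε / 2) • z)).quasiMeasurePreserving.ae h] with x h1 h2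
  rw [correlation, correlation, h1, h2]

theorem husimi_congr_ae {ε : ℝ} (hε : 0 < ε) {g g' : Eu d → ℂ} (h : g =ᵐ[volume] g')
    (x ξ : Eu d) : husimi ε g x ξ = husimi ε g' x ξ := by
  have : ∀ x ξ, wigner ε g x ξ = wigner ε g' x ξ := fun x ξ => by
    unfold wigner
    congr 1
    refine integral_congr_ae ?_
    filter_upwards [ae_correlation_right hε h x] with z hz
    rw [hz]
  unfold husimi
  simp only [this]

theorem wignerAct_congr_ae (ε : ℝ) {g g' : Eu d → ℂ} (h : g =ᵐ[volume] g') (ψ : L1C0 d) :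
    wignerAct ε g ψ = wignerAct ε g' ψ := by
  refine integral_congr_ae (.of_forall fun z => integral_congr_ae ?_)
  filter_upwards [ae_correlation_left ε h z] with x hx
  rw [hx]

theorem husimiDensity_congr_ae (ε : ℝ) {g g' : Eu d → ℂ} (h : g =ᵐ[volume] g') (x ξ : Eu d) :
    husimiDensity ε g x ξ = husimiDensity ε g' x ξ := by
  unfold husimiDensity
  congr 3
  rw [Real.fourier_eq', Real.fourier_eq']
  refine integral_congr_ae ?_
  filter_upwards [h] with a ha
  rw [localized, localized, ha]

theorem husimi_eq {ε : ℝ} (hε : 0 < ε) {g : Eu d → ℂ} (hg : MemLp g 2) (x ξ : Eu d) :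
    husimi ε g x ξ = (husimiDensity ε g x ξ : ℂ) := by
  have hae := hg.1.ae_eq_mk
  rw [husimi_congr_ae hε hae, husimiDensity_congr_ae ε hae]
  exact husimi_eq_aux hε hg.1.stronglyMeasurable_mk.measurable ((memLp_congr_ae hae).1 hg) x ξ

/-- The parameter is the time variable in the application; a one-point parameter space recovers the
case of a single function. -/
theorem measurable_husimiDensity {α : Type*} [MeasurableSpace α] (ε : ℝ) {f : α → Eu d → ℂ}
    (hf : Measurable (fun p : α × Eu d => f p.1 p.2)) :
    Measurable (fun p : α × (Eu d × Eu d) => husimiDensity ε (f p.1) p.2.1 p.2.2) := by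
  unfold husimiDensity
  simp only [Real.fourier_eq']
  refine Measurable.const_mul (Measurable.pow_const (Measurable.norm ?_) 2) _
  refine (StronglyMeasurable.integral_prod_right' (f := fun q : (α × (Eu d × Eu d)) × Eu d =>
    Complex.exp (↑(-2 * Real.pi * inner ℝ q.2 ((2 * Real.pi * ε)⁻¹ • q.1.2.2)) * Complex.I) •
      localized ε (f q.1.1) q.1.2.1 q.2) ?_).measurable
  refine Measurable.stronglyMeasurable ?_
  have hs := (continuous_sqrtGaussian (d := d) ε).measurable
  have h1 : Measurable (fun q : (α × (Eu d × Eu d)) × Eu d => f q.1.1 q.2) :=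
    hf.comp ((measurable_fst.comp measurable_fst).prodMk measurable_snd)
  have h2 : Measurable (fun q : (α × (Eu d × Eu d)) × Eu d =>
      (sqrtGaussian ε (q.1.2.1 - q.2) : ℂ)) := by fun_prop
  have h3 : Measurable (fun q : (α × (Eu d × Eu d)) × Eu d => Complex.exp
      (↑(-2 * Real.pi * inner ℝ q.2 ((2 * Real.pi * ε)⁻¹ • q.1.2.2)) * Complex.I)) := by fun_prop
  exact h3.smul (h1.mul h2)

theorem measurable_husimiDensity_of_aestronglyMeasurable (ε : ℝ) {g : Eu d → ℂ}
    (hg : AEStronglyMeasurable g) :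
    Measurable (fun y : Eu d × Eu d => husimiDensity ε g y.1 y.2) := by
  obtain ⟨g', hg', hae⟩ := hg
  have e : (fun y : Eu d × Eu d => husimiDensity ε g y.1 y.2) =
      fun y => husimiDensity ε g' y.1 y.2 :=
    funext fun y => husimiDensity_congr_ae ε hae y.1 y.2
  have h := measurable_husimiDensity (α := Unit) ε (f := fun _ => g')
    (hg'.measurable.comp measurable_snd)
  have h' : Measurable (fun y : Eu d × Eu d => ((), y)) := measurable_prodMk_left
  have h2 := h.comp h'
  rw [e]
  exact h2

/-- Plancherel in `ξ`; the dilation by `(2πε)⁻¹` cancels the prefactor exactly. -/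
theorem lintegral_husimiDensity_slice {ε : ℝ} (hε : 0 < ε) {g : Eu d → ℂ} (hg : MemLp g 2)
    (x : Eu d) : ∫⁻ ξ, ENNReal.ofReal (husimiDensity ε g x ξ) =
      ∫⁻ a, ‖g a‖ₑ ^ 2 * ENNReal.ofReal (gaussian ε (x - a)) := by
  have h2 : 0 < (2 * Real.pi * ε)⁻¹ := by positivity
  have e : ∀ ξ, ENNReal.ofReal (husimiDensity ε g x ξ) = ENNReal.ofReal ((2 * Real.pi * ε) ^ d)⁻¹ *
      ‖𝓕 (localized ε g x) ((2 * Real.pi * ε)⁻¹ • ξ)‖ₑ ^ 2 := fun ξ => by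
    rw [husimiDensity, ENNReal.ofReal_mul (by positivity), ENNReal.ofReal_pow (norm_nonneg _),
      ofReal_norm]
  simp only [e]
  rw [lintegral_const_mul' _ _ ENNReal.ofReal_ne_top,
    lintegral_comp_smul_pos (fun w => ‖𝓕 (localized ε g x) w‖ₑ ^ 2) h2, Fintype.card_fin, inv_pow,
    inv_inv, ← mul_assoc, ← ENNReal.ofReal_mul (by positivity), inv_mul_cancel₀ (by positivity),
    ENNReal.ofReal_one, one_mul,
    lintegral_fourier_sq (integrable_localized hε hg x) (memLp_localized hε hg x)]
  refine lintegral_congr fun a => ?_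
  rw [localized, enorm_mul, mul_pow]
  congr 1
  rw [← ofReal_norm, ← ENNReal.ofReal_pow (norm_nonneg _), Complex.norm_real, Real.norm_eq_abs,
    sq_abs, sqrtGaussian_sq hε]

theorem lintegral_husimiDensity {ε : ℝ} (hε : 0 < ε) {g : Eu d → ℂ} (hg : MemLp g 2)
    {b : Eu d → ℝ≥0∞} (hb : Measurable b) :
    ∫⁻ y : Eu d × Eu d, b y.1 * ENNReal.ofReal (husimiDensity ε g y.1 y.2) =
      ∫⁻ a, ‖g a‖ₑ ^ 2 * ∫⁻ x, b x * ENNReal.ofReal (gaussian ε (x - a)) := by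
  have hm := measurable_husimiDensity_of_aestronglyMeasurable ε hg.1
  have hγ := (continuous_gaussian (d := d) ε).measurable
  have hgm := hg.1.enorm
  have hbm : AEMeasurable (fun y : Eu d × Eu d =>
      b y.1 * ENNReal.ofReal (husimiDensity ε g y.1 y.2)) (volume.prod volume) :=
    ((hb.comp measurable_fst).mul hm.ennreal_ofReal).aemeasurable
  rw [Measure.volume_eq_prod, lintegral_prod _ hbm]
  have e : ∀ x, ∫⁻ ξ, b x * ENNReal.ofReal (husimiDensity ε g x ξ) =
      ∫⁻ a, ‖g a‖ₑ ^ 2 * (b x * ENNReal.ofReal (gaussian ε (x - a))) := fun x => by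
    have hmx : Measurable (fun ξ => husimiDensity ε g x ξ) := by
      have h' : Measurable (fun ξ : Eu d => (x, ξ)) := measurable_prodMk_left
      exact hm.comp h'
    have hgx : AEMeasurable (fun a => ‖g a‖ₑ ^ 2 * ENNReal.ofReal (gaussian ε (x - a))) :=
      (hgm.pow_const 2).mul (by fun_prop)
    rw [lintegral_const_mul _ hmx.ennreal_ofReal,
      lintegral_husimiDensity_slice hε hg, ← lintegral_const_mul'' _ hgx]
    exact lintegral_congr fun a => by ring
  simp only [e]
  rw [lintegral_lintegral_swap]
  · refine lintegral_congr fun a => ?_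
    rw [lintegral_const_mul _ (by fun_prop)]
  · exact ((hgm.pow_const 2).comp_snd).mul (Measurable.aemeasurable (by fun_prop))

theorem lintegral_husimiDensity_mass {ε : ℝ} (hε : 0 < ε) {g : Eu d → ℂ} (hg : MemLp g 2) :
    ∫⁻ y : Eu d × Eu d, ENNReal.ofReal (husimiDensity ε g y.1 y.2) = ∫⁻ a, ‖g a‖ₑ ^ 2 := by
  have := lintegral_husimiDensity hε hg (b := fun _ => 1) measurable_const
  simpa [lintegral_gaussian_sub hε] using this

/-- The weight depends on `x` only, so it is integrated against `|g|² * γ_ε`, and the Gaussian adds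
its own second moment, of order `ε`. -/
theorem lintegral_husimiDensity_moment {ε : ℝ} (hε : 0 < ε) {g : Eu d → ℂ} (hg : MemLp g 2) :
    ∫⁻ y : Eu d × Eu d, ‖y.1‖ₑ ^ 2 * ENNReal.ofReal (husimiDensity ε g y.1 y.2) ≤
      (∫⁻ a, ‖‖a‖ • g a‖ₑ ^ 2) + ENNReal.ofReal ε * gaussianMoment d * ∫⁻ a, ‖g a‖ₑ ^ 2 := by
  rw [lintegral_husimiDensity hε hg (b := fun x => ‖x‖ₑ ^ 2) (by fun_prop)]
  have hgm := hg.1.enorm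
  calc _ ≤ ∫⁻ a, ‖g a‖ₑ ^ 2 * (‖a‖ₑ ^ 2 + ENNReal.ofReal ε * gaussianMoment d) := by
        refine lintegral_mono fun a => ?_
        gcongr
        exact lintegral_sq_gaussian_sub_le hε a
    _ = ∫⁻ a, (‖‖a‖ • g a‖ₑ ^ 2 + ENNReal.ofReal ε * gaussianMoment d * ‖g a‖ₑ ^ 2) := by
        refine lintegral_congr fun a => ?_
        rw [enorm_smul, enorm_norm]; ring
    _ = _ := by
        rw [lintegral_add_right' _ ((hgm.pow_const 2).const_mul _),
          lintegral_const_mul'' _ (hgm.pow_const 2)]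

end Husimi

/-! ### Enlarging the class of test functions for weak gradients. -/

section WeakGradient

open scoped FourierTransform

variable {d : ℕ}

theorem contDiff_fderiv_apply_continuous {χ : Eu d → ℂ} (hχ : ContDiff ℝ ∞ χ) (v : Eu d) :
    Continuous (fun x => fderiv ℝ χ x v) :=
  (hχ.continuous_fderiv (by simp)).clm_apply continuous_const

theorem memLp_apply {G : Eu d → EuclideanSpace ℂ (Fin d)} (hG : MemLp G 2) (i : Fin d) :
    MemLp (fun x => G x i) 2 :=
  hG.of_le ((EuclideanSpace.proj (𝕜 := ℂ) i).continuous.comp_aestronglyMeasurable hG.1)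
    (.of_forall fun _ => PiLp.norm_apply_le _ i)

/-- Real and imaginary parts of the test function are treated separately and recombined by
linearity. -/
theorem integral_weakGradient_complex {g : Eu d → ℂ} {G : Eu d → EuclideanSpace ℂ (Fin d)}
    (h : HasWeakGradient g G) (hg : MemLp g 2) (hG : MemLp G 2) {χ : Eu d → ℂ}
    (hχ : ContDiff ℝ ∞ χ) (hc : HasCompactSupport χ) (i : Fin d) :
    ∫ x, g x * fderiv ℝ χ x (EuclideanSpace.single i 1) = -∫ x, G x i * χ x := by
  have hint : ∀ {u : Eu d → ℂ}, MemLp u 2 → ∀ {θ : Eu d → ℝ}, Continuous θ → HasCompactSupport θ →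
      Integrable (fun x => u x * (θ x : ℂ)) := fun {_} hu {θ} hθ hcθ =>
    have h2 : MemLp (fun x => (θ x : ℂ)) 2 :=
      (Complex.continuous_ofReal.comp hθ).memLp_of_hasCompactSupport
        (hcθ.comp_left (g := ((↑) : ℝ → ℂ)) rfl)
    hu.integrable_mul h2
  have hGi := memLp_apply hG i
  have hre : ContDiff ℝ ∞ (fun x => (χ x).re) := Complex.reCLM.contDiff.comp hχ
  have him : ContDiff ℝ ∞ (fun x => (χ x).im) := Complex.imCLM.contDiff.comp hχ
  have hcre : HasCompactSupport (fun x => (χ x).re) := hc.comp_left (g := Complex.re) rfl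
  have hcim : HasCompactSupport (fun x => (χ x).im) := hc.comp_left (g := Complex.im) rfl
  have hd : ∀ x, DifferentiableAt ℝ χ x := fun x => hχ.differentiable (by simp) x
  have ere : ∀ x v, fderiv ℝ (fun x => (χ x).re) x v = (fderiv ℝ χ x v).re := fun x v => by
    have := (Complex.reCLM.hasFDerivAt.comp x (hd x).hasFDerivAt).fderiv
    exact congrArg (fun L => L v) this
  have eim : ∀ x v, fderiv ℝ (fun x => (χ x).im) x v = (fderiv ℝ χ x v).im := fun x v => by
    have := (Complex.imCLM.hasFDerivAt.comp x (hd x).hasFDerivAt).fderiv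
    exact congrArg (fun L => L v) this
  have h1 := h.2.2 _ hre hcre i
  have h2 := h.2.2 _ him hcim i
  have k1 := hint hg ((hre.continuous_fderiv (by simp)).clm_apply continuous_const
    (g := fun _ => EuclideanSpace.single i 1)) (hcre.fderiv_apply (𝕜 := ℝ) _)
  have k2 := hint hg ((him.continuous_fderiv (by simp)).clm_apply continuous_const
    (g := fun _ => EuclideanSpace.single i 1)) (hcim.fderiv_apply (𝕜 := ℝ) _)
  have k3 := hint hGi hre.continuous hcre
  have k4 := hint hGi him.continuous hcim
  have e1 : ∫ x, g x * fderiv ℝ χ x (EuclideanSpace.single i 1) =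
      (∫ x, g x * (fderiv ℝ (fun x => (χ x).re) x (EuclideanSpace.single i 1) : ℂ)) +
      Complex.I * ∫ x, g x * (fderiv ℝ (fun x => (χ x).im) x (EuclideanSpace.single i 1) : ℂ) := by
    rw [← integral_const_mul, ← integral_add k1 (k2.const_mul _)]
    refine integral_congr_ae (.of_forall fun x => ?_)
    simp only [ere, eim]
    conv_lhs => rw [← Complex.re_add_im (fderiv ℝ χ x (EuclideanSpace.single i 1))]
    ring
  have e2 : ∫ x, G x i * χ x = (∫ x, G x i * ((χ x).re : ℂ)) +
      Complex.I * ∫ x, G x i * ((χ x).im : ℂ) := by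
    rw [← integral_const_mul, ← integral_add k3 (k4.const_mul _)]
    refine integral_congr_ae (.of_forall fun x => ?_)
    simp only
    conv_lhs => rw [← Complex.re_add_im (χ x)]
    ring
  rw [e1, e2, h1, h2]
  ring

/-- The weak gradient may be tested against smooth functions which are square integrable together
with their derivatives. -/
theorem integral_weakGradient {g : Eu d → ℂ} {G : Eu d → EuclideanSpace ℂ (Fin d)}
    (h : HasWeakGradient g G) (hg : MemLp g 2) (hG : MemLp G 2) {χ : Eu d → ℂ}
    (hχ : ContDiff ℝ ∞ χ) (h2 : MemLp χ 2) (i : Fin d)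
    (h2' : MemLp (fun x => fderiv ℝ χ x (EuclideanSpace.single i 1)) 2) :
    ∫ x, g x * fderiv ℝ χ x (EuclideanSpace.single i 1) = -∫ x, G x i * χ x := by
  -- The test function is truncated by `η(c_n x)` with `c_n = 1/(n+1)`, so that the cutoff is `1` on
  -- a ball of radius `n + 1`.
  let η : ContDiffBump (0 : Eu d) := ⟨1, 2, one_pos, one_lt_two⟩
  let c : ℕ → ℝ := fun n => ((n : ℝ) + 1)⁻¹
  have hc0 : ∀ n, 0 < c n := fun n => by positivity
  have hclim : Tendsto c atTop (𝓝 0) := by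
    simpa [c] using tendsto_one_div_add_atTop_nhds_zero_nat (𝕜 := ℝ)
  have hηd : ∀ x, DifferentiableAt ℝ η x := fun x =>
    (η.contDiff (n := 1)).differentiable (by simp) x
  have hχd : ∀ x, DifferentiableAt ℝ χ x := fun x => hχ.differentiable (by simp) x
  let v : Eu d := EuclideanSpace.single i 1
  let η' : Eu d → ℝ := fun x => fderiv ℝ η x v
  have hη'c : Continuous η' :=
    ((η.contDiff (n := 1)).continuous_fderiv (by simp)).clm_apply continuous_const
  have hη's : HasCompactSupport η' := η.hasCompactSupport.fderiv_apply (𝕜 := ℝ) _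
  obtain ⟨B, hB⟩ := hη'c.bounded_above_of_compact_support hη's
  let χn : ℕ → Eu d → ℂ := fun n x => (η (c n • x) : ℂ) * χ x
  have hχn : ∀ n, ContDiff ℝ ∞ (χn n) := fun n =>
    (Complex.ofRealCLM.contDiff.comp (η.contDiff.comp (contDiff_const_smul (c n)))).mul hχ
  have hχns : ∀ n, HasCompactSupport (χn n) := fun n => by
    have h1 : HasCompactSupport (fun x : Eu d => η (c n • x)) :=
      η.hasCompactSupport.comp_homeomorph (Homeomorph.smulOfNeZero (c n) (hc0 n).ne')
    exact (h1.comp_left (g := ((↑) : ℝ → ℂ)) rfl).mul_right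
  -- The derivative falling on the cutoff brings out a factor `c_n`, so this term vanishes in the
  -- limit.
  have hder : ∀ n x, fderiv ℝ (χn n) x v =
      (η (c n • x) : ℂ) * fderiv ℝ χ x v + ((c n * η' (c n • x) : ℝ) : ℂ) * χ x := by
    intro n x
    have h1 : HasFDerivAt (fun x : Eu d => c n • x) (c n • ContinuousLinearMap.id ℝ (Eu d)) x :=
      (hasFDerivAt_id x).const_smul (c n)
    have h3 := (Complex.ofRealCLM.hasFDerivAt.comp x ((hηd (c n • x)).hasFDerivAt.comp x h1)).mul
      (hχd x).hasFDerivAt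
    have h4 : fderiv ℝ (χn n) x = _ := h3.fderiv
    rw [h4]
    simp [η']
    ring
  have hηlim : ∀ x : Eu d, Tendsto (fun n => (η (c n • x) : ℂ)) atTop (𝓝 1) := fun x => by
    have h1 : Tendsto (fun n => c n • x) atTop (𝓝 0) := by simpa using hclim.smul_const x
    have h3 := (η.continuous.tendsto 0).comp h1
    have h4 : η (0 : Eu d) = 1 := η.one_of_mem_closedBall (by simp [η])
    rw [h4] at h3
    simpa [Function.comp_def] using (Complex.continuous_ofReal.tendsto 1).comp h3
  have hηle : ∀ n x, ‖(η (c n • x) : ℂ)‖ ≤ 1 := fun n x => by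
    rw [Complex.norm_real, Real.norm_of_nonneg η.nonneg]; exact η.le_one
  have hGi := memLp_apply hG i
  have hI1 : Integrable (fun x => g x * fderiv ℝ χ x v) := hg.integrable_mul h2'
  have hI2 : Integrable (fun x => g x * χ x) := hg.integrable_mul h2
  have hI3 : Integrable (fun x => G x i * χ x) := hGi.integrable_mul h2
  have hηm : ∀ n, AEStronglyMeasurable (fun x : Eu d => (η (c n • x) : ℂ)) := fun n =>
    (Complex.continuous_ofReal.comp
      (η.continuous.comp (continuous_const_smul _))).aestronglyMeasurable
  have hη'm : ∀ n, AEStronglyMeasurable (fun x : Eu d => ((c n * η' (c n • x) : ℝ) : ℂ)) :=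
    fun n => (Complex.continuous_ofReal.comp
      ((hη'c.comp (continuous_const_smul _)).const_smul (c n))).aestronglyMeasurable
  have hη'le : ∀ n (x : Eu d), ‖((c n * η' (c n • x) : ℝ) : ℂ)‖ ≤ c n * B := fun n x => by
    rw [Complex.norm_real, norm_mul, Real.norm_of_nonneg (hc0 n).le]
    exact mul_le_mul_of_nonneg_left (hB _) (hc0 n).le
  have hc1 : ∀ n, c n ≤ 1 := fun n => inv_le_one_of_one_le₀ (by simp)
  have hB0 : 0 ≤ B := (norm_nonneg _).trans (hB 0)
  have t1 : Tendsto (fun n => ∫ x, g x * fderiv ℝ (χn n) x v) atTop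
      (𝓝 (∫ x, g x * fderiv ℝ χ x v)) := by
    refine tendsto_integral_of_dominated_convergence
      (fun x => ‖g x * fderiv ℝ χ x v‖ + B * ‖g x * χ x‖) (fun n => ?_)
      (hI1.norm.add (hI2.norm.const_mul B)) (fun n => .of_forall fun x => ?_)
      (.of_forall fun x => ?_)
    · simp only [hder]
      exact hg.1.mul (((hηm n).mul h2'.1).add ((hη'm n).mul h2.1))
    · rw [hder, mul_add]
      refine (norm_add_le _ _).trans (add_le_add ?_ ?_)
      · rw [mul_left_comm, norm_mul]
        exact mul_le_of_le_one_left (norm_nonneg _) (hηle n x)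
      · rw [mul_left_comm, norm_mul]
        refine mul_le_mul_of_nonneg_right ((hη'le n x).trans ?_) (norm_nonneg _)
        exact mul_le_of_le_one_left hB0 (hc1 n)
    · simp only [hder]
      have h0 : Tendsto (fun n => ((c n * η' (c n • x) : ℝ) : ℂ)) atTop (𝓝 0) := by
        refine squeeze_zero_norm (fun n => hη'le n x) ?_
        simpa using hclim.mul_const B
      have := (((hηlim x).mul_const (fderiv ℝ χ x v)).add (h0.mul_const (χ x))).const_mul (g x)
      simpa using this
  have t2 : Tendsto (fun n => ∫ x, G x i * χn n x) atTop (𝓝 (∫ x, G x i * χ x)) := by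
    refine tendsto_integral_of_dominated_convergence
      (fun x => ‖G x i * χ x‖) (fun n => hGi.1.mul ((hηm n).mul h2.1))
      hI3.norm (fun n => .of_forall fun x => ?_) (.of_forall fun x => ?_)
    · rw [mul_left_comm, norm_mul]
      exact mul_le_of_le_one_left (norm_nonneg _) (hηle n x)
    · have := ((hηlim x).mul_const (χ x)).const_mul (G x i)
      simpa using this
  refine tendsto_nhds_unique t1 (t2.neg.congr fun n => ?_)
  exact (integral_weakGradient_complex h hg hG (hχn n) (hχns n) i).symm

end WeakGradient

/-! ### The `ξ`-moment of the Husimi transform. -/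

section XiMoment

open scoped FourierTransform

variable {d : ℕ}

/-- A Gaussian wave packet centred at `x`. -/
def wavePacket (ε : ℝ) (x w a : Eu d) : ℂ :=
  (sqrtGaussian ε (x - a) : ℂ) * Complex.exp (↑(-2 * Real.pi * inner ℝ a w) * Complex.I)

theorem wavePacket_eq (ε : ℝ) (x w a : Eu d) : wavePacket ε x w a =
    ((((Real.pi * ε) ^ ((d : ℝ) / 4))⁻¹ : ℝ) : ℂ) * Complex.exp (Complex.ofRealCLM
      (-(2 * ε)⁻¹ * ‖x - a‖ ^ 2) + Complex.ofRealCLM (-2 * Real.pi * inner ℝ a w) * Complex.I) := by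
  rw [wavePacket, sqrtGaussian, Complex.exp_add, ← mul_assoc, Complex.ofReal_mul,
    Complex.ofReal_exp]
  congr 5
  simp
  ring

theorem contDiff_wavePacket (ε : ℝ) (x w : Eu d) : ContDiff ℝ ∞ (wavePacket ε x w) := by
  have e : wavePacket ε x w = _ := funext (wavePacket_eq ε x w)
  rw [e]
  refine contDiff_const.mul (ContDiff.cexp (ContDiff.add ?_ (ContDiff.mul ?_ contDiff_const)))
  · exact Complex.ofRealCLM.contDiff.comp
      (contDiff_const.mul ((contDiff_const.sub contDiff_id).norm_sq ℝ))
  · exact Complex.ofRealCLM.contDiff.comp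
      (contDiff_const.mul (contDiff_id.inner ℝ contDiff_const))

theorem fderiv_wavePacket (ε : ℝ) (x w a : Eu d) (i : Fin d) :
    fderiv ℝ (wavePacket ε x w) a (EuclideanSpace.single i 1) =
      ((((x - a) i / ε : ℝ) : ℂ) - 2 * Real.pi * Complex.I * (w i : ℂ)) * wavePacket ε x w a := by
  have e : wavePacket ε x w = _ := funext (wavePacket_eq ε x w)
  have h1 := (((hasFDerivAt_id (𝕜 := ℝ) a).const_sub x).norm_sq).const_mul (-(2 * ε)⁻¹)
  have h2 := ((hasFDerivAt_id (𝕜 := ℝ) a).inner ℝ (hasFDerivAt_const w a)).const_mul (-2 * Real.pi)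
  have h3 := (((Complex.ofRealCLM.hasFDerivAt.comp a h1).add
    ((Complex.ofRealCLM.hasFDerivAt.comp a h2).mul_const Complex.I)).cexp).const_mul
      ((((Real.pi * ε) ^ ((d : ℝ) / 4))⁻¹ : ℝ) : ℂ)
  have h4 := h3.fderiv
  have h5 : fderiv ℝ (wavePacket ε x w) a = _ := (congrArg (fun χ => fderiv ℝ χ a) e).trans h4
  rw [h5, wavePacket_eq]
  simp [fderivInnerCLM_apply, EuclideanSpace.inner_single_left, EuclideanSpace.inner_single_right]
  field_simp
  ring

theorem norm_wavePacket {ε : ℝ} (x w a : Eu d) :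
    ‖wavePacket ε x w a‖ = ‖(sqrtGaussian ε (x - a) : ℂ)‖ := by
  rw [wavePacket, norm_mul, Complex.norm_exp_ofReal_mul_I, mul_one]

theorem memLp_coord_mul_sqrtGaussian {ε : ℝ} (hε : 0 < ε) (x : Eu d) (i : Fin d) :
    MemLp (fun a => (((x - a) i : ℝ) : ℂ) * (sqrtGaussian ε (x - a) : ℂ)) 2 := by
  have hc := continuous_sqrtGaussian (d := d) ε
  refine ⟨Continuous.aestronglyMeasurable (by fun_prop), ?_⟩
  have h : eLpNorm (fun a => (((x - a) i : ℝ) : ℂ) * (sqrtGaussian ε (x - a) : ℂ)) 2 volume ^ 2 <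
      ⊤ := by
    rw [← lintegral_enorm_sq_eq_eLpNorm, ← lintegral_sub_left_eq_self _ x]
    refine lt_of_le_of_lt (lintegral_mono fun s => ?_)
      ((lintegral_sq_gaussian_le (d := d) hε).trans_lt (by finiteness))
    simp only [sub_sub_cancel]
    rw [enorm_mul, mul_pow, ← sqrtGaussian_sq hε, ENNReal.ofReal_pow (sqrtGaussian_nonneg hε _)]
    simp only [← ofReal_norm, Complex.norm_real, Real.norm_of_nonneg (sqrtGaussian_nonneg hε _)]
    gcongr
    exact PiLp.norm_apply_le s i
  by_contra hcon
  rw [not_lt, top_le_iff] at hcon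
  rw [hcon] at h
  simp at h

/-- The localisation of the weak derivative. -/
def localizedDeriv (ε : ℝ) (g : Eu d → ℂ) (G : Eu d → EuclideanSpace ℂ (Fin d)) (i : Fin d)
    (x a : Eu d) : ℂ :=
  (G a i + ((ε⁻¹ : ℝ) : ℂ) * g a * (((x - a) i : ℝ) : ℂ)) * (sqrtGaussian ε (x - a) : ℂ)

theorem localizedDeriv_eq (ε : ℝ) (g : Eu d → ℂ) (G : Eu d → EuclideanSpace ℂ (Fin d)) (i : Fin d)
    (x a : Eu d) : localizedDeriv ε g G i x a = G a i * (sqrtGaussian ε (x - a) : ℂ) +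
      ((ε⁻¹ : ℝ) : ℂ) * (g a * ((((x - a) i : ℝ) : ℂ) * (sqrtGaussian ε (x - a) : ℂ))) := by
  rw [localizedDeriv]; ring

theorem integrable_localizedDeriv {ε : ℝ} (hε : 0 < ε) {g : Eu d → ℂ}
    {G : Eu d → EuclideanSpace ℂ (Fin d)} (hg : MemLp g 2) (hG : MemLp G 2) (i : Fin d)
    (x : Eu d) : Integrable (localizedDeriv ε g G i x) := by
  have h1 : Integrable (fun a => G a i * (sqrtGaussian ε (x - a) : ℂ)) :=
    (memLp_apply hG i).integrable_mul (memLp_sqrtGaussian hε x)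
  have h2 : Integrable (fun a => g a * ((((x - a) i : ℝ) : ℂ) * (sqrtGaussian ε (x - a) : ℂ))) :=
    hg.integrable_mul (memLp_coord_mul_sqrtGaussian hε x i)
  exact (h1.add (h2.const_mul ((ε⁻¹ : ℝ) : ℂ))).congr
    (.of_forall fun a => (localizedDeriv_eq ε g G i x a).symm)

/-- `localizedDeriv` is formally the `i`-th derivative of `localized ε g x`, the second term coming
from the Gaussian. Instead of a product rule for weak derivatives, the definition is tested on the
wave packet, which contains both the Gaussian and the exponential of the Fourier transform. -/
theorem fourier_localizedDeriv {ε : ℝ} (hε : 0 < ε) {g : Eu d → ℂ}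
    {G : Eu d → EuclideanSpace ℂ (Fin d)} (h : HasWeakGradient g G) (hg : MemLp g 2)
    (hG : MemLp G 2) (i : Fin d) (x w : Eu d) :
    𝓕 (localizedDeriv ε g G i x) w = 2 * Real.pi * Complex.I * (w i : ℂ) *
      𝓕 (localized ε g x) w := by
  have hwm : AEStronglyMeasurable (wavePacket ε x w) :=
    (contDiff_wavePacket ε x w).continuous.aestronglyMeasurable
  have hexp : ∀ a : Eu d,
      ‖Complex.exp (↑(-2 * Real.pi * inner ℝ a w) * Complex.I)‖ = 1 :=
    fun a => Complex.norm_exp_ofReal_mul_I _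
  have m1 : MemLp (wavePacket ε x w) 2 :=
    (memLp_sqrtGaussian hε x).of_le hwm (.of_forall fun a => (norm_wavePacket x w a).le)
  have m2 : MemLp (fun a => (((x - a) i : ℝ) : ℂ) * wavePacket ε x w a) 2 := by
    refine (memLp_coord_mul_sqrtGaussian hε x i).of_le
      ((Continuous.aestronglyMeasurable (by fun_prop)).mul hwm) (.of_forall fun a => ?_)
    rw [norm_mul, norm_mul, norm_wavePacket]
  have m3 : MemLp (fun a => fderiv ℝ (wavePacket ε x w) a (EuclideanSpace.single i 1)) 2 := by
    refine ((m2.const_mul ((ε⁻¹ : ℝ) : ℂ)).sub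
      (m1.const_mul (2 * Real.pi * Complex.I * (w i : ℂ)))).congr_norm
      (contDiff_fderiv_apply_continuous (contDiff_wavePacket ε x w) _).aestronglyMeasurable
      (.of_forall fun a => ?_)
    rw [fderiv_wavePacket]
    simp only [Pi.sub_apply]
    congr 1
    push_cast
    ring
  have key := integral_weakGradient h hg hG (contDiff_wavePacket ε x w) m1 i m3
  have i1 : Integrable (fun a => g a * ((((x - a) i : ℝ) : ℂ) * wavePacket ε x w a)) :=
    hg.integrable_mul m2
  have i2 : Integrable (fun a => g a * wavePacket ε x w a) := hg.integrable_mul m1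
  have i3 : Integrable (fun a => G a i * wavePacket ε x w a) := (memLp_apply hG i).integrable_mul m1
  have e1 : ∫ a, g a * fderiv ℝ (wavePacket ε x w) a (EuclideanSpace.single i 1) =
      ((ε⁻¹ : ℝ) : ℂ) * (∫ a, g a * ((((x - a) i : ℝ) : ℂ) * wavePacket ε x w a)) -
      2 * Real.pi * Complex.I * (w i : ℂ) * ∫ a, g a * wavePacket ε x w a := by
    rw [← integral_const_mul, ← integral_const_mul,
      ← integral_sub (i1.const_mul _) (i2.const_mul _)]
    refine integral_congr_ae (.of_forall fun a => ?_)
    simp only [fderiv_wavePacket]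
    push_cast
    ring
  have e2 : 𝓕 (localizedDeriv ε g G i x) w = (∫ a, G a i * wavePacket ε x w a) +
      ((ε⁻¹ : ℝ) : ℂ) * ∫ a, g a * ((((x - a) i : ℝ) : ℂ) * wavePacket ε x w a) := by
    rw [Real.fourier_eq', ← integral_const_mul, ← integral_add i3 (i1.const_mul _)]
    refine integral_congr_ae (.of_forall fun a => ?_)
    simp only [localizedDeriv_eq, wavePacket, smul_eq_mul]
    ring
  have e3 : 𝓕 (localized ε g x) w = ∫ a, g a * wavePacket ε x w a := by
    rw [Real.fourier_eq']
    refine integral_congr_ae (.of_forall fun a => ?_)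
    simp only [localized, wavePacket, smul_eq_mul]
    ring
  rw [e2, e3]
  rw [e1] at key
  linear_combination key

/-- As an inequality Plancherel needs only `h ∈ L¹`: outside `L²` the right-hand side is infinite.
This avoids checking that `localizedDeriv` is in `L²` for each `x`. -/
theorem lintegral_fourier_sq_le {h : Eu d → ℂ} (h1 : Integrable h) :
    ∫⁻ w, ‖𝓕 h w‖ₑ ^ 2 ≤ ∫⁻ x, ‖h x‖ₑ ^ 2 := by
  by_cases h2 : eLpNorm h 2 volume = ⊤
  · rw [lintegral_enorm_sq_eq_eLpNorm volume h, h2]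
    simp
  · exact (lintegral_fourier_sq h1 ⟨h1.1, lt_top_iff_ne_top.2 h2⟩).le

/-- At frequency `w = ξ/(2πε)` one has `2π w_i = ξ_i/ε`, so multiplication by `ξ_i` is, in modulus,
`ε` times the derivative of the localised function. -/
theorem lintegral_coord_slice_le {ε : ℝ} (hε : 0 < ε) {g : Eu d → ℂ}
    {G : Eu d → EuclideanSpace ℂ (Fin d)} (h : HasWeakGradient g G) (hg : MemLp g 2)
    (hG : MemLp G 2) (i : Fin d) (x : Eu d) :
    ∫⁻ ξ : Eu d, ‖ξ i‖ₑ ^ 2 * ENNReal.ofReal (husimiDensity ε g x ξ) ≤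
      ENNReal.ofReal (ε ^ 2) * ∫⁻ a, ‖localizedDeriv ε g G i x a‖ₑ ^ 2 := by
  have h2 : 0 < (2 * Real.pi * ε)⁻¹ := by positivity
  have e : ∀ ξ : Eu d, ‖ξ i‖ₑ ^ 2 * ENNReal.ofReal (husimiDensity ε g x ξ) =
      ENNReal.ofReal ((2 * Real.pi * ε) ^ d)⁻¹ * (ENNReal.ofReal (ε ^ 2) *
      ‖𝓕 (localizedDeriv ε g G i x) ((2 * Real.pi * ε)⁻¹ • ξ)‖ₑ ^ 2) := fun ξ => by
    simp only [← ofReal_norm, ← ENNReal.ofReal_pow (norm_nonneg _)]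
    rw [← ENNReal.ofReal_mul (by positivity), ← ENNReal.ofReal_mul (by positivity),
      ← ENNReal.ofReal_mul (by positivity), fourier_localizedDeriv hε h hg hG, husimiDensity]
    congr 1
    simp only [norm_mul, Complex.norm_real, Complex.norm_I, PiLp.smul_apply, smul_eq_mul,
      Real.norm_of_nonneg h2.le, Real.norm_of_nonneg Real.pi_pos.le, Complex.norm_ofNat]
    field_simp
  simp only [e]
  rw [lintegral_const_mul' _ _ ENNReal.ofReal_ne_top, lintegral_const_mul' _ _ ENNReal.ofReal_ne_top,
    lintegral_comp_smul_pos (fun w => ‖𝓕 (localizedDeriv ε g G i x) w‖ₑ ^ 2) h2, Fintype.card_fin,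
    inv_pow, inv_inv, mul_left_comm, ← mul_assoc (ENNReal.ofReal ((2 * Real.pi * ε) ^ d)⁻¹),
    ← ENNReal.ofReal_mul (by positivity), inv_mul_cancel₀ (by positivity), ENNReal.ofReal_one,
    one_mul]
  refine mul_le_mul_right ?_ _
  exact lintegral_fourier_sq_le (integrable_localizedDeriv hε hg hG i x)

/-- Integrating the slices over `x` at fixed `a` gives the Gaussian average of `|G_i(a) + ε⁻¹ g(a)
s_i|²` in `s = x - a`. The cross term is odd in `s`, and the factor `ε²` cancels `ε⁻²` in the
remaining term. -/
theorem lintegral_coord_le {ε : ℝ} (hε : 0 < ε) {g : Eu d → ℂ}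
    {G : Eu d → EuclideanSpace ℂ (Fin d)} (h : HasWeakGradient g G) (hg : MemLp g 2)
    (hG : MemLp G 2) (i : Fin d) :
    ∫⁻ y : Eu d × Eu d, ‖y.2 i‖ₑ ^ 2 * ENNReal.ofReal (husimiDensity ε g y.1 y.2) ≤
      ENNReal.ofReal (ε ^ 2) * (∫⁻ a, ‖G a i‖ₑ ^ 2) + (∫⁻ a, ‖g a‖ₑ ^ 2) *
        ∫⁻ s : Eu d, ‖s i‖ₑ ^ 2 * ENNReal.ofReal (gaussian ε s) := by
  have hm := measurable_husimiDensity_of_aestronglyMeasurable ε hg.1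
  have hγ := (continuous_gaussian (d := d) ε).measurable
  have hs := (continuous_sqrtGaussian (d := d) ε).measurable
  have hgm := hg.1.enorm
  have hGm := (memLp_apply hG i).1.enorm
  have hbm : AEMeasurable (fun y : Eu d × Eu d =>
      ‖y.2 i‖ₑ ^ 2 * ENNReal.ofReal (husimiDensity ε g y.1 y.2)) (volume.prod volume) :=
    (Measurable.mul (by fun_prop) hm.ennreal_ofReal).aemeasurable
  rw [Measure.volume_eq_prod, lintegral_prod _ hbm]
  refine (lintegral_mono fun x => lintegral_coord_slice_le hε h hg hG i x).trans ?_
  have hlm : AEStronglyMeasurable (fun p : Eu d × Eu d => localizedDeriv ε g G i p.1 p.2)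
      (volume.prod volume) := by
    unfold localizedDeriv
    refine AEStronglyMeasurable.mul (AEStronglyMeasurable.add ?_ (AEStronglyMeasurable.mul
      (AEStronglyMeasurable.mul aestronglyMeasurable_const ?_) ?_)) ?_
    · exact (memLp_apply hG i).1.comp_snd
    · exact hg.1.comp_snd
    · exact Measurable.aestronglyMeasurable (by fun_prop)
    · exact Measurable.aestronglyMeasurable (by fun_prop)
  rw [lintegral_const_mul' _ _ ENNReal.ofReal_ne_top,
    lintegral_lintegral_swap (hlm.enorm.pow_const 2)]
  have e1 : ∀ a, ∫⁻ x, ‖localizedDeriv ε g G i x a‖ₑ ^ 2 ≤ ‖G a i‖ₑ ^ 2 +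
      ENNReal.ofReal (ε⁻¹ ^ 2) * (∫⁻ s : Eu d, ‖s i‖ₑ ^ 2 * ENNReal.ofReal (gaussian ε s)) *
        ‖g a‖ₑ ^ 2 := by
    intro a
    have e2 : ∫⁻ x, ‖localizedDeriv ε g G i x a‖ₑ ^ 2 =
        ∫⁻ s : Eu d, ‖G a i + ((ε⁻¹ : ℝ) : ℂ) * g a * ((s i : ℝ) : ℂ)‖ₑ ^ 2 *
          ENNReal.ofReal (gaussian ε s) := by
      rw [← lintegral_add_right_eq_self _ a]
      refine lintegral_congr fun s => ?_
      simp only [localizedDeriv, add_sub_cancel_right]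
      rw [enorm_mul, mul_pow, ← sqrtGaussian_sq hε,
        ENNReal.ofReal_pow (sqrtGaussian_nonneg hε _)]
      congr 2
      rw [← ofReal_norm, Complex.norm_real, Real.norm_of_nonneg (sqrtGaussian_nonneg hε _)]
    rw [e2]
    refine (lintegral_sq_add_odd_gaussian_le hε
      (u := fun s : Eu d => ((ε⁻¹ : ℝ) : ℂ) * g a * ((s i : ℝ) : ℂ)) (by fun_prop)
      (fun s => by simp) (G a i)).trans (add_le_add_right (le_of_eq ?_) _)
    have e3 : ∀ s : Eu d, ‖((ε⁻¹ : ℝ) : ℂ) * g a * ((s i : ℝ) : ℂ)‖ₑ ^ 2 *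
        ENNReal.ofReal (gaussian ε s) = ENNReal.ofReal (ε⁻¹ ^ 2) * ‖g a‖ₑ ^ 2 *
        (‖s i‖ₑ ^ 2 * ENNReal.ofReal (gaussian ε s)) := fun s => by
      have e4 : ‖((ε⁻¹ : ℝ) : ℂ)‖ₑ ^ 2 = ENNReal.ofReal (ε⁻¹ ^ 2) := by
        rw [← ofReal_norm, Complex.norm_real, Real.norm_of_nonneg (by positivity),
          ENNReal.ofReal_pow (by positivity)]
      have e5 : ‖((s i : ℝ) : ℂ)‖ₑ = ‖s i‖ₑ := by
        rw [← ofReal_norm, ← ofReal_norm, Complex.norm_real]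
      rw [enorm_mul, enorm_mul, mul_pow, mul_pow, e4, e5]
      ring
    simp only [e3]
    rw [lintegral_const_mul' _ _ (by finiteness)]
    ring
  have hS : ∫⁻ s : Eu d, ‖s i‖ₑ ^ 2 * ENNReal.ofReal (gaussian ε s) ≠ ⊤ := by
    refine ne_top_of_le_ne_top ?_ ((lintegral_mono fun s => ?_).trans
      (lintegral_sq_gaussian_le (d := d) hε))
    · finiteness
    · gcongr
      rw [← ofReal_norm, ← ofReal_norm]
      exact ENNReal.ofReal_le_ofReal (PiLp.norm_apply_le s i)
  calc _ ≤ ENNReal.ofReal (ε ^ 2) * ∫⁻ a, (‖G a i‖ₑ ^ 2 + ENNReal.ofReal (ε⁻¹ ^ 2) *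
        (∫⁻ s : Eu d, ‖s i‖ₑ ^ 2 * ENNReal.ofReal (gaussian ε s)) * ‖g a‖ₑ ^ 2) := by
        gcongr with a
        exact e1 a
    _ = _ := by
      rw [lintegral_add_left' (hGm.pow_const 2), lintegral_const_mul'' _ (hgm.pow_const 2), mul_add,
        ← mul_assoc, ← mul_assoc, ← ENNReal.ofReal_mul (by positivity)]
      have : ε ^ 2 * ε⁻¹ ^ 2 = 1 := by field_simp
      rw [this, ENNReal.ofReal_one, one_mul, mul_comm (∫⁻ s : Eu d, _)]

theorem enorm_sq_eq_sum {𝕜 : Type*} [RCLike 𝕜] (v : EuclideanSpace 𝕜 (Fin d)) :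
    ‖v‖ₑ ^ 2 = ∑ i, ‖v i‖ₑ ^ 2 := by
  simp only [← ofReal_norm, ← ENNReal.ofReal_pow (norm_nonneg _)]
  rw [EuclideanSpace.norm_sq_eq, ENNReal.ofReal_sum_of_nonneg fun _ _ => by positivity]

theorem lintegral_husimiDensity_xiMoment {ε : ℝ} (hε : 0 < ε) {g : Eu d → ℂ}
    {G : Eu d → EuclideanSpace ℂ (Fin d)} (h : HasWeakGradient g G) (hg : MemLp g 2)
    (hG : MemLp G 2) :
    ∫⁻ y : Eu d × Eu d, ‖y.2‖ₑ ^ 2 * ENNReal.ofReal (husimiDensity ε g y.1 y.2) ≤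
      ENNReal.ofReal (ε ^ 2) * (∫⁻ a, ‖G a‖ₑ ^ 2) +
        ENNReal.ofReal ε * gaussianMoment d * ∫⁻ a, ‖g a‖ₑ ^ 2 := by
  have hm := measurable_husimiDensity_of_aestronglyMeasurable ε hg.1
  have hγ := (continuous_gaussian (d := d) ε).measurable
  have hGm := fun i => (memLp_apply hG i).1.enorm
  calc _ = ∑ i, ∫⁻ y : Eu d × Eu d, ‖y.2 i‖ₑ ^ 2 *
        ENNReal.ofReal (husimiDensity ε g y.1 y.2) := by
        simp only [enorm_sq_eq_sum, Finset.sum_mul]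
        rw [lintegral_finsetSum]
        exact fun i _ => Measurable.mul (by fun_prop) hm.ennreal_ofReal
    _ ≤ ∑ i, (ENNReal.ofReal (ε ^ 2) * (∫⁻ a, ‖G a i‖ₑ ^ 2) + (∫⁻ a, ‖g a‖ₑ ^ 2) *
        ∫⁻ s : Eu d, ‖s i‖ₑ ^ 2 * ENNReal.ofReal (gaussian ε s)) :=
      Finset.sum_le_sum fun i _ => lintegral_coord_le hε h hg hG i
    _ = ENNReal.ofReal (ε ^ 2) * (∫⁻ a, ‖G a‖ₑ ^ 2) +
        (∫⁻ a, ‖g a‖ₑ ^ 2) * ∫⁻ s : Eu d, ‖s‖ₑ ^ 2 * ENNReal.ofReal (gaussian ε s) := by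
      rw [Finset.sum_add_distrib, ← Finset.mul_sum, ← Finset.mul_sum]
      simp only [enorm_sq_eq_sum, Finset.sum_mul]
      rw [lintegral_finsetSum' _ fun i _ => (hGm i).pow_const 2,
        lintegral_finsetSum _ fun i _ => by fun_prop]
    _ ≤ _ := by
      rw [mul_comm (∫⁻ a, ‖g a‖ₑ ^ 2)]
      gcongr
      exact lintegral_sq_gaussian_le hε

end XiMoment

/-! ### Errors of Gaussian regularisation in `C₀` and in `L¹_z C₀`. -/

section Modulus

variable {d : ℕ}

/-- The distance in the sup norm between `h` and its Gaussian regularisation. -/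
def gaussianModulus (ε : ℝ) (h : C₀(Eu d, ℂ)) : ℝ :=
  ⨆ y : Eu d, ‖h y - ∫ x, h x * (gaussian ε (x - y) : ℂ)‖

theorem integrable_C0_mul_gaussian {ε : ℝ} (hε : 0 < ε) (h : C₀(Eu d, ℂ)) (y : Eu d) :
    Integrable (fun x => h x * (gaussian ε (x - y) : ℂ)) :=
  ((integrable_gaussian hε).comp_sub_right y).ofReal.bdd_mul (c := ‖h‖)
    h.continuous.aestronglyMeasurable (.of_forall (C0_norm_coe_le h))

theorem integral_gaussian_sub {ε : ℝ} (hε : 0 < ε) (y : Eu d) :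
    ∫ x, gaussian ε (x - y) = 1 := by
  rw [integral_sub_right_eq_self (fun x => gaussian ε x), integral_gaussian hε]

theorem norm_sub_gaussian_le {ε : ℝ} (hε : 0 < ε) (h : C₀(Eu d, ℂ)) (y : Eu d) :
    ‖h y - ∫ x, h x * (gaussian ε (x - y) : ℂ)‖ ≤ 2 * ‖h‖ := by
  refine (norm_sub_le _ _).trans ?_
  rw [two_mul]
  refine add_le_add (C0_norm_coe_le h y) ?_
  refine (norm_integral_le_of_norm_le
    (((integrable_gaussian hε).comp_sub_right y).const_mul ‖h‖) (.of_forall fun x => ?_)).trans ?_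
  · rw [norm_mul, Complex.norm_real, Real.norm_of_nonneg (gaussian_nonneg hε _)]
    exact mul_le_mul_of_nonneg_right (C0_norm_coe_le h x) (gaussian_nonneg hε _)
  · rw [integral_const_mul, integral_gaussian_sub hε, mul_one]

theorem bddAbove_gaussianModulus {ε : ℝ} (hε : 0 < ε) (h : C₀(Eu d, ℂ)) :
    BddAbove (Set.range fun y : Eu d => ‖h y - ∫ x, h x * (gaussian ε (x - y) : ℂ)‖) :=
  ⟨2 * ‖h‖, by rintro _ ⟨y, rfl⟩; exact norm_sub_gaussian_le hε h y⟩

theorem le_gaussianModulus {ε : ℝ} (hε : 0 < ε) (h : C₀(Eu d, ℂ)) (y : Eu d) :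
    ‖h y - ∫ x, h x * (gaussian ε (x - y) : ℂ)‖ ≤ gaussianModulus ε h :=
  le_ciSup (bddAbove_gaussianModulus hε h) y

theorem gaussianModulus_nonneg (ε : ℝ) (h : C₀(Eu d, ℂ)) : 0 ≤ gaussianModulus ε h :=
  Real.iSup_nonneg fun _ => norm_nonneg _

theorem gaussianModulus_le {ε : ℝ} (hε : 0 < ε) (h : C₀(Eu d, ℂ)) :
    gaussianModulus ε h ≤ 2 * ‖h‖ :=
  ciSup_le (norm_sub_gaussian_le hε h)

theorem gaussianModulus_le_add {ε : ℝ} (hε : 0 < ε) (h k : C₀(Eu d, ℂ)) :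
    gaussianModulus ε h ≤ gaussianModulus ε k + 2 * ‖h - k‖ := by
  refine ciSup_le fun y => ?_
  have e : h y - ∫ x, h x * (gaussian ε (x - y) : ℂ) =
      (k y - ∫ x, k x * (gaussian ε (x - y) : ℂ)) +
      ((h - k) y - ∫ x, (h - k) x * (gaussian ε (x - y) : ℂ)) := by
    have : ∫ x, (h - k) x * (gaussian ε (x - y) : ℂ) =
        (∫ x, h x * (gaussian ε (x - y) : ℂ)) - ∫ x, k x * (gaussian ε (x - y) : ℂ) := by
      rw [← integral_sub (integrable_C0_mul_gaussian hε h y) (integrable_C0_mul_gaussian hε k y)]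
      simp only [ZeroAtInftyContinuousMap.sub_apply, sub_mul]
    rw [this, ZeroAtInftyContinuousMap.sub_apply]
    ring
  rw [e]
  exact (norm_add_le _ _).trans
    (add_le_add (le_gaussianModulus hε k y) (norm_sub_gaussian_le hε (h - k) y))

/-- Continuity on `C₀` is what makes the modulus measurable along `z ↦ ψ z`. -/
theorem continuous_gaussianModulus {ε : ℝ} (hε : 0 < ε) :
    Continuous (gaussianModulus ε : C₀(Eu d, ℂ) → ℝ) := by
  refine (LipschitzWith.of_dist_le_mul (K := 2) fun h k => ?_).continuous
  rw [Real.dist_eq, abs_le, dist_eq_norm]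
  have h1 := gaussianModulus_le_add hε h k
  have h2 := gaussianModulus_le_add hε k h
  rw [norm_sub_rev k h] at h2
  push_cast
  constructor <;> linarith

theorem integral_sq_gaussian_le {ε : ℝ} (hε : 0 < ε) :
    Integrable (fun x : Eu d => ‖x‖ ^ 2 * gaussian ε x) ∧
      ∫ x : Eu d, ‖x‖ ^ 2 * gaussian ε x ≤ ε * gaussianMoment d := by
  have hc := continuous_gaussian (d := d) ε
  have h0 : ∀ x : Eu d, 0 ≤ ‖x‖ ^ 2 * gaussian ε x := fun x =>
    mul_nonneg (by positivity) (gaussian_nonneg hε x)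
  have h1 : ∫⁻ x : Eu d, ENNReal.ofReal (‖x‖ ^ 2 * gaussian ε x) ≤
      ENNReal.ofReal (ε * gaussianMoment d) := by
    rw [ENNReal.ofReal_mul hε.le, ENNReal.ofReal_coe_nnreal]
    refine le_trans (lintegral_mono fun x => ?_) (lintegral_sq_gaussian_le hε)
    rw [ENNReal.ofReal_mul (by positivity), ENNReal.ofReal_pow (norm_nonneg _), ofReal_norm]
  have hm : AEStronglyMeasurable (fun x : Eu d => ‖x‖ ^ 2 * gaussian ε x) :=
    Continuous.aestronglyMeasurable (by fun_prop)
  refine ⟨⟨hm, ?_⟩, ?_⟩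
  · rw [hasFiniteIntegral_iff_ofReal (.of_forall h0)]
    exact h1.trans_lt ENNReal.ofReal_lt_top
  · rw [integral_eq_lintegral_of_nonneg_ae (.of_forall h0) hm]
    exact ENNReal.toReal_le_of_le_ofReal (by positivity) h1

/-- Uniform continuity of `h` controls the points with `‖x - y‖ < η`; elsewhere Chebyshev with the
`O(ε)` second moment of the Gaussian does, uniformly in `y`. -/
theorem tendsto_gaussianModulus {ε : ℕ → ℝ} (hε : ∀ n, 0 < ε n) (hlim : Tendsto ε atTop (𝓝 0))
    (h : C₀(Eu d, ℂ)) : Tendsto (fun n => gaussianModulus (ε n) h) atTop (𝓝 0) := by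
  rw [Metric.tendsto_atTop]
  intro δ hδ
  obtain ⟨η, hη, hu⟩ := Metric.uniformContinuous_iff.1
    (ZeroAtInftyContinuousMap.uniformContinuous h) (δ / 2) (by positivity)
  have key : ∀ n, gaussianModulus (ε n) h ≤
      δ / 2 + 2 * ‖h‖ / η ^ 2 * (ε n * gaussianMoment d) := by
    intro n
    have hi := (integrable_gaussian (d := d) (hε n))
    obtain ⟨hs1, hs2⟩ := integral_sq_gaussian_le (d := d) (hε n)
    refine ciSup_le fun y => ?_
    have e : h y - ∫ x, h x * (gaussian (ε n) (x - y) : ℂ) =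
        ∫ x, (h y - h x) * (gaussian (ε n) (x - y) : ℂ) := by
      have e1 : h y = ∫ x, h y * (gaussian (ε n) (x - y) : ℂ) := by
        rw [integral_const_mul, integral_complex_ofReal, integral_gaussian_sub (hε n)]
        simp
      have e2 : Integrable fun x => h y * (gaussian (ε n) (x - y) : ℂ) :=
        ((hi.comp_sub_right y).ofReal).const_mul _
      conv_lhs => rw [e1]
      rw [← integral_sub e2 (integrable_C0_mul_gaussian (hε n) h y)]
      simp only [sub_mul]
    rw [e]
    refine (norm_integral_le_of_norm_le (g := fun x => δ / 2 * gaussian (ε n) (x - y) +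
      2 * ‖h‖ / η ^ 2 * (‖x - y‖ ^ 2 * gaussian (ε n) (x - y)))
      (((hi.comp_sub_right y).const_mul _).add ((hs1.comp_sub_right y).const_mul _))
      (.of_forall fun x => ?_)).trans ?_
    · have h0 := gaussian_nonneg (hε n) (x - y)
      rw [norm_mul, Complex.norm_real, Real.norm_of_nonneg h0, ← mul_assoc, ← add_mul]
      refine mul_le_mul_of_nonneg_right ?_ h0
      by_cases hxy : dist y x < η
      · have := (hu hxy).le
        rw [dist_eq_norm] at this
        have h3 : 0 ≤ 2 * ‖h‖ / η ^ 2 * ‖x - y‖ ^ 2 := by positivity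
        linarith
      · rw [not_lt, dist_comm, dist_eq_norm] at hxy
        have h3 : ‖h y - h x‖ ≤ 2 * ‖h‖ := by
          rw [two_mul]
          exact (norm_sub_le _ _).trans (add_le_add (C0_norm_coe_le h y) (C0_norm_coe_le h x))
        have h4 : 1 ≤ ‖x - y‖ ^ 2 / η ^ 2 := by
          rw [one_le_div (by positivity)]
          exact pow_le_pow_left₀ hη.le hxy 2
        have h5 : 2 * ‖h‖ ≤ 2 * ‖h‖ * (‖x - y‖ ^ 2 / η ^ 2) :=
          le_mul_of_one_le_right (by positivity) h4
        have h6 : 2 * ‖h‖ * (‖x - y‖ ^ 2 / η ^ 2) = 2 * ‖h‖ / η ^ 2 * ‖x - y‖ ^ 2 := by ring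
        linarith
    · rw [integral_add ((hi.comp_sub_right y).const_mul _) ((hs1.comp_sub_right y).const_mul _),
        integral_const_mul, integral_const_mul, integral_gaussian_sub (hε n), mul_one,
        integral_sub_right_eq_self (fun x => ‖x‖ ^ 2 * gaussian (ε n) x)]
      gcongr
  have hz : Tendsto (fun n => 2 * ‖h‖ / η ^ 2 * (ε n * gaussianMoment d)) atTop (𝓝 0) := by
    simpa using (hlim.mul_const ((gaussianMoment d : ℝ≥0) : ℝ)).const_mul (2 * ‖h‖ / η ^ 2)
  obtain ⟨N, hN⟩ := Metric.tendsto_atTop.1 hz (δ / 2) (by positivity)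
  refine ⟨N, fun n hn => ?_⟩
  have h1 := hN n hn
  rw [Real.dist_eq, sub_zero] at h1 ⊢
  rw [abs_of_nonneg (gaussianModulus_nonneg _ _)]
  linarith [key n, le_abs_self (2 * ‖h‖ / η ^ 2 * (ε n * gaussianMoment d))]

/-- The error made when a Wigner transform is replaced by the Husimi transform in the pairing
with `ψ`. -/
def wignerError (ε : ℝ) (ψ : L1C0 d) : ℝ :=
  ∫ z, ((1 - Real.exp (-(ε / 4 * ‖z‖ ^ 2))) * ‖ψ z‖ + gaussianModulus ε (ψ z))

theorem exp_factor_mem {ε : ℝ} (hε : 0 < ε) (z : Eu d) :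
    0 ≤ 1 - Real.exp (-(ε / 4 * ‖z‖ ^ 2)) ∧ 1 - Real.exp (-(ε / 4 * ‖z‖ ^ 2)) ≤ 1 := by
  have h1 : 0 ≤ ε / 4 * ‖z‖ ^ 2 := by positivity
  have h2 : Real.exp (-(ε / 4 * ‖z‖ ^ 2)) ≤ 1 := Real.exp_le_one_iff.2 (by linarith)
  constructor <;> linarith [Real.exp_pos (-(ε / 4 * ‖z‖ ^ 2))]

theorem wignerError_integrand_bounds {ε : ℝ} (hε : 0 < ε) (z : Eu d) (h : C₀(Eu d, ℂ)) :
    0 ≤ (1 - Real.exp (-(ε / 4 * ‖z‖ ^ 2))) * ‖h‖ + gaussianModulus ε h ∧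
    (1 - Real.exp (-(ε / 4 * ‖z‖ ^ 2))) * ‖h‖ + gaussianModulus ε h ≤ 3 * ‖h‖ := by
  obtain ⟨h1, h2⟩ := exp_factor_mem hε z
  have h3 := gaussianModulus_nonneg ε h
  have h4 := gaussianModulus_le hε h
  constructor
  · positivity
  · nlinarith [norm_nonneg h]

theorem integrable_wignerError {ε : ℝ} (hε : 0 < ε) (ψ : L1C0 d) :
    Integrable (fun z => (1 - Real.exp (-(ε / 4 * ‖z‖ ^ 2))) * ‖ψ z‖ + gaussianModulus ε (ψ z)) := by
  have hψ : Integrable ψ := L1.integrable_coeFn ψ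
  refine (hψ.norm.const_mul 3).mono' ?_ (.of_forall fun z => ?_)
  · exact ((Continuous.aestronglyMeasurable (by fun_prop)).mul hψ.1.norm).add
      ((continuous_gaussianModulus hε).comp_aestronglyMeasurable hψ.1)
  · obtain ⟨h1, h2⟩ := wignerError_integrand_bounds hε z (ψ z)
    rwa [Real.norm_of_nonneg h1]

theorem wignerError_nonneg {ε : ℝ} (hε : 0 < ε) (ψ : L1C0 d) : 0 ≤ wignerError ε ψ :=
  integral_nonneg fun z => (wignerError_integrand_bounds hε z (ψ z)).1

theorem wignerError_le {ε : ℝ} (hε : 0 < ε) (ψ : L1C0 d) : wignerError ε ψ ≤ 3 * ‖ψ‖ := by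
  rw [L1.norm_eq_integral_norm, ← integral_const_mul]
  exact integral_mono (integrable_wignerError hε ψ) ((L1.integrable_coeFn ψ).norm.const_mul 3)
    fun z => (wignerError_integrand_bounds hε z (ψ z)).2

theorem wignerError_le_add {ε : ℝ} (hε : 0 < ε) (ψ χ : L1C0 d) :
    wignerError ε ψ ≤ wignerError ε χ + 3 * ‖ψ - χ‖ := by
  rw [L1.norm_eq_integral_norm, ← integral_const_mul, wignerError, wignerError,
    ← integral_add (integrable_wignerError hε χ) ((L1.integrable_coeFn _).norm.const_mul 3)]
  refine integral_mono_ae (integrable_wignerError hε ψ)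
    ((integrable_wignerError hε χ).add ((L1.integrable_coeFn _).norm.const_mul 3)) ?_
  filter_upwards [Lp.coeFn_sub ψ χ] with z hz
  simp only [hz, Pi.sub_apply]
  obtain ⟨h1, h2⟩ := exp_factor_mem hε z
  have h3 := gaussianModulus_le_add hε (ψ z) (χ z)
  have h4 : ‖ψ z‖ ≤ ‖χ z‖ + ‖ψ z - χ z‖ := by
    simpa using norm_add_le (χ z) (ψ z - χ z)
  nlinarith [norm_nonneg (ψ z - χ z)]

theorem continuous_wignerError {ε : ℝ} (hε : 0 < ε) :
    Continuous (wignerError ε : L1C0 d → ℝ) := by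
  refine (LipschitzWith.of_dist_le_mul (K := 3) fun h k => ?_).continuous
  rw [Real.dist_eq, abs_le, dist_eq_norm]
  have h1 := wignerError_le_add hε h k
  have h2 := wignerError_le_add hε k h
  rw [norm_sub_rev k h] at h2
  push_cast
  constructor <;> linarith

/-- Both terms of the integrand vanish pointwise in `z`, and `3 ‖ψ z‖` dominates their sum. -/
theorem tendsto_wignerError {ε : ℕ → ℝ} (hε : ∀ n, 0 < ε n) (hlim : Tendsto ε atTop (𝓝 0))
    (ψ : L1C0 d) : Tendsto (fun n => wignerError (ε n) ψ) atTop (𝓝 0) := by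
  have h0 : (0 : ℝ) = ∫ _ : Eu d, (0 : ℝ) := by simp
  rw [h0]
  refine tendsto_integral_of_dominated_convergence (fun z => 3 * ‖ψ z‖)
    (fun n => (integrable_wignerError (hε n) ψ).1) ((L1.integrable_coeFn ψ).norm.const_mul 3)
    (fun n => .of_forall fun z => ?_) (.of_forall fun z => ?_)
  · obtain ⟨h1, h2⟩ := wignerError_integrand_bounds (hε n) z (ψ z)
    rwa [Real.norm_of_nonneg h1]
  · have h1 : Tendsto (fun n => 1 - Real.exp (-(ε n / 4 * ‖z‖ ^ 2))) atTop (𝓝 0) := by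
      have h2 : Continuous (fun r : ℝ => 1 - Real.exp (-(r / 4 * ‖z‖ ^ 2))) := by fun_prop
      have h3 := (h2.tendsto 0).comp hlim
      simpa [Function.comp_def] using h3
    simpa using (h1.mul_const ‖ψ z‖).add (tendsto_gaussianModulus hε hlim (ψ z))

end Modulus

/-! ### Comparison of Wigner and Husimi transforms in the dual of `𝒜`. -/

section Comparison

open scoped FourierTransform

variable {d : ℕ}

/-- Here the integrability assumption is on `𝓕 r`, not on `𝓕⁻ u`. It suits pairings with a general
`φ ∈ 𝒜`, whose slices in `ξ` need not be integrable, because those of the Husimi transform are for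
a.e. `x`. -/
theorem integral_fourierInv_mul_fourier' {u r : Eu d → ℂ} (hu : Integrable u) (hr : Integrable r)
    (hk : Integrable (𝓕 r)) : ∫ w, 𝓕⁻ u w * 𝓕 r w = ∫ z, u z * r z := by
  have hk' : Integrable (𝓕⁻ r) := by
    have e : 𝓕⁻ r = fun w => 𝓕 r (-w) := funext fun w => Real.fourierInv_eq_fourier_neg r w
    rw [e]
    exact hk.comp_neg
  have h := integral_fourierInv_mul_fourier hr hu hk'
  rw [← integral_neg_eq_self] at h
  calc _ = ∫ w, 𝓕⁻ r (-w) * 𝓕 u (-w) := by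
        refine integral_congr_ae (.of_forall fun w => ?_)
        simp only [Real.fourierInv_eq_fourier_neg, neg_neg]
        ring
    _ = ∫ z, r z * u z := h
    _ = _ := by simp only [mul_comm]

theorem stronglyMeasurable_L1C0_uncurry (ψ : L1C0 d) :
    StronglyMeasurable (fun p : Eu d × Eu d => ψ p.1 p.2) :=
  continuous_C0_eval.comp_stronglyMeasurable
    (((Lp.stronglyMeasurable ψ).comp_measurable measurable_fst).prodMk
      measurable_snd.stronglyMeasurable)

theorem integrable_L1C0_apply (ψ : L1C0 d) (x : Eu d) : Integrable (fun z => ψ z x) :=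
  (L1.integrable_coeFn ψ).norm.mono' ((stronglyMeasurable_L1C0_uncurry ψ).comp_measurable
    (measurable_id.prodMk measurable_const)).aestronglyMeasurable
    (.of_forall fun z => C0_norm_coe_le (ψ z) x)

/-- The Fubini condition common to both pairings: the kernel is bounded in `L¹_x` uniformly in `z`,
and `‖ψ z‖` is integrable in `z`. -/
theorem integrable_L1C0_mul (ψ : L1C0 d) {K : Eu d → Eu d → ℂ}
    (hK : StronglyMeasurable (fun p : Eu d × Eu d => K p.1 p.2)) {c : ℝ}
    (h : ∀ z, Integrable (fun x => K x z) ∧ ∫ x, ‖K x z‖ ≤ c) :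
    Integrable (fun p : Eu d × Eu d => ψ p.2 p.1 * K p.1 p.2) (volume.prod volume) := by
  have hmeas : AEStronglyMeasurable (fun p : Eu d × Eu d => ψ p.2 p.1 * K p.1 p.2)
      (volume.prod volume) :=
    (((stronglyMeasurable_L1C0_uncurry ψ).comp_measurable measurable_swap).mul
      hK).aestronglyMeasurable
  have hz : ∀ z, Integrable (fun x => ψ z x * K x z) := fun z =>
    (h z).1.bdd_mul (c := ‖ψ z‖) (ψ z).continuous.aestronglyMeasurable
      (.of_forall (C0_norm_coe_le (ψ z)))
  rw [integrable_prod_iff' hmeas]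
  refine ⟨.of_forall hz, ?_⟩
  refine ((L1.integrable_coeFn ψ).norm.mul_const c).mono' hmeas.norm.prod_swap.integral_prod_right'
    (.of_forall fun z => ?_)
  rw [Real.norm_of_nonneg (integral_nonneg fun _ => norm_nonneg _)]
  refine (integral_mono (hz z).norm ((h z).1.norm.const_mul ‖ψ z‖) fun x => ?_).trans ?_
  · simp only [norm_mul]
    exact mul_le_mul_of_nonneg_right (C0_norm_coe_le (ψ z) x) (norm_nonneg _)
  · rw [integral_const_mul]
    exact mul_le_mul_of_nonneg_left (h z).2 (norm_nonneg _)

theorem measurable_smoothedCorrelation (ε : ℝ) {g : Eu d → ℂ} (hm : Measurable g) :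
    StronglyMeasurable (fun p : Eu d × Eu d => smoothedCorrelation ε g p.1 p.2) := by
  have hγ := (continuous_gaussian (d := d) ε).measurable
  unfold smoothedCorrelation
  refine (Measurable.stronglyMeasurable (by fun_prop)).mul
    (StronglyMeasurable.integral_prod_right' (f := fun q : (Eu d × Eu d) × Eu d =>
      correlation ε g q.2 q.1.2 * (gaussian ε (q.1.1 - q.2) : ℂ)) ?_)
  refine Measurable.stronglyMeasurable ?_
  exact ((measurable_correlation hm).comp
    (measurable_snd.prodMk (measurable_snd.comp measurable_fst))).mul (by fun_prop)

theorem integrable_correlation_gaussian {ε : ℝ} (hε : 0 < ε) {g : Eu d → ℂ} (hm : Measurable g)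
    (hg : Integrable (fun x => ‖g x‖ ^ 2)) (z : Eu d) :
    Integrable (fun p : Eu d × Eu d => correlation ε g p.2 z * (gaussian ε (p.1 - p.2) : ℂ))
      (volume.prod volume) := by
  have hγ := (continuous_gaussian (d := d) ε).measurable
  have hc := (correlation_left (ε := ε) hm hg z).1
  have hmeas : AEStronglyMeasurable (fun p : Eu d × Eu d => correlation ε g p.2 z *
      (gaussian ε (p.1 - p.2) : ℂ)) (volume.prod volume) :=
    hc.1.comp_snd.mul (Measurable.aestronglyMeasurable (by fun_prop))
  rw [integrable_prod_iff' hmeas]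
  refine ⟨.of_forall fun y => ?_, hc.norm.congr (.of_forall fun y => ?_)⟩
  · exact (((integrable_gaussian hε).comp_sub_right y).ofReal).const_mul (correlation ε g y z)
  · simp only [norm_mul, Complex.norm_real, Real.norm_of_nonneg (gaussian_nonneg hε _)]
    rw [integral_const_mul, integral_gaussian_sub hε, mul_one]

theorem integrable_C0_correlation_gaussian {ε : ℝ} (hε : 0 < ε) {g : Eu d → ℂ} (hm : Measurable g)
    (hg : Integrable (fun x => ‖g x‖ ^ 2)) (h : C₀(Eu d, ℂ)) (z : Eu d) :
    Integrable (fun p : Eu d × Eu d => h p.1 * (correlation ε g p.2 z *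
      (gaussian ε (p.1 - p.2) : ℂ))) (volume.prod volume) := by
  have h1 := integrable_correlation_gaussian hε hm hg z
  exact h1.bdd_mul (c := ‖h‖) (h.continuous.comp continuous_fst).aestronglyMeasurable
    (.of_forall fun p => C0_norm_coe_le h p.1)

/-- Fubini moves the Gaussian average from the correlation onto the test function. -/
theorem integral_C0_smoothedCorrelation {ε : ℝ} (hε : 0 < ε) {g : Eu d → ℂ} (hm : Measurable g)
    (hg : Integrable (fun x => ‖g x‖ ^ 2)) (h : C₀(Eu d, ℂ)) (z : Eu d) :
    Integrable (fun x => h x * smoothedCorrelation ε g x z) ∧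
    ∫ x, h x * smoothedCorrelation ε g x z = ∫ y, correlation ε g y z *
      ((Real.exp (-(ε / 4 * ‖z‖ ^ 2)) : ℂ) * ∫ x, h x * (gaussian ε (x - y) : ℂ)) := by
  have hI := integrable_C0_correlation_gaussian hε hm hg h z
  have e : ∀ x, h x * smoothedCorrelation ε g x z = (Real.exp (-(ε / 4 * ‖z‖ ^ 2)) : ℂ) *
      ∫ y, h x * (correlation ε g y z * (gaussian ε (x - y) : ℂ)) := fun x => by
    rw [smoothedCorrelation, integral_const_mul]; ring
  simp only [e]
  refine ⟨hI.integral_prod_left.const_mul _, ?_⟩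
  rw [integral_const_mul, integral_integral_swap hI, ← integral_const_mul]
  refine integral_congr_ae (.of_forall fun y => ?_)
  simp only
  have e2 : ∀ x, h x * (correlation ε g y z * (gaussian ε (x - y) : ℂ)) =
      correlation ε g y z * (h x * (gaussian ε (x - y) : ℂ)) := fun x => by ring
  simp only [e2]
  rw [integral_const_mul]
  ring

theorem integral_norm_smoothedCorrelation_le {ε : ℝ} (hε : 0 < ε) {g : Eu d → ℂ} (hm : Measurable g)
    (hg : Integrable (fun x => ‖g x‖ ^ 2)) (z : Eu d) :
    Integrable (fun x => smoothedCorrelation ε g x z) ∧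
    ∫ x, ‖smoothedCorrelation ε g x z‖ ≤ ∫ x, ‖g x‖ ^ 2 := by
  have hc := correlation_left (ε := ε) hm hg z
  have h1 := integrable_correlation_gaussian hε hm hg z
  have hi : Integrable (fun x => smoothedCorrelation ε g x z) :=
    h1.integral_prod_left.const_mul _
  refine ⟨hi, le_trans ?_ hc.2⟩
  have h2 : ∀ x, ‖smoothedCorrelation ε g x z‖ ≤
      ∫ y, ‖correlation ε g y z * (gaussian ε (x - y) : ℂ)‖ := fun x => by
    rw [smoothedCorrelation, norm_mul, Complex.norm_real, Real.norm_of_nonneg (Real.exp_pos _).le]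
    refine (mul_le_of_le_one_left (norm_nonneg _) ?_).trans (norm_integral_le_integral_norm _)
    linarith [(exp_factor_mem hε z).1]
  refine (integral_mono hi.norm h1.norm.integral_prod_left h2).trans (le_of_eq ?_)
  rw [integral_integral_swap h1.norm]
  refine integral_congr_ae (.of_forall fun y => ?_)
  simp only [norm_mul, Complex.norm_real, Real.norm_of_nonneg (gaussian_nonneg hε _)]
  rw [integral_const_mul, integral_gaussian_sub hε, mul_one]

theorem integrable_husimiDensity {ε : ℝ} (hε : 0 < ε) {g : Eu d → ℂ} (hg : MemLp g 2) :
    Integrable (fun y : Eu d × Eu d => husimiDensity ε g y.1 y.2) := by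
  refine ⟨(measurable_husimiDensity_of_aestronglyMeasurable ε hg.1).aestronglyMeasurable, ?_⟩
  rw [hasFiniteIntegral_iff_ofReal (f := fun y : Eu d × Eu d => husimiDensity ε g y.1 y.2)
      (.of_forall fun y => husimiDensity_nonneg hε g y.1 y.2),
    lintegral_husimiDensity_mass hε hg, lintegral_enorm_sq_eq_eLpNorm]
  exact ENNReal.pow_lt_top hg.2

/-- The pairing of the Husimi transform with `φ`, in terms of `ψ = F_ξ φ`. -/
theorem integral_mul_husimi_eq {ε : ℝ} (hε : 0 < ε) {g : Eu d → ℂ} (hm : Measurable g)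
    (hg : MemLp g 2) {φ : C₀(Eu d × Eu d, ℂ)} {ψ : L1C0 d} (h : IsXiFourier φ ψ) :
    ∫ y : Eu d × Eu d, φ y * husimi ε g y.1 y.2 =
      ∫ z, ∫ x, ψ z x * smoothedCorrelation ε g x z := by
  have hg2 : Integrable (fun x => ‖g x‖ ^ 2) := hg.integrable_norm_pow two_ne_zero
  have hH : Integrable (fun y : Eu d × Eu d => husimi ε g y.1 y.2) := by
    simp only [husimi_eq hε hg]
    exact (integrable_husimiDensity hε hg).ofReal
  have hφH : Integrable (fun y : Eu d × Eu d => φ y * husimi ε g y.1 y.2) (volume.prod volume) :=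
    hH.bdd_mul (c := ‖φ‖) φ.continuous.aestronglyMeasurable (.of_forall (C0_norm_coe_le φ))
  have hF := integrable_L1C0_mul ψ (measurable_smoothedCorrelation ε hm)
    (integral_norm_smoothedCorrelation_le hε hm hg2)
  rw [← integral_integral_swap hF, Measure.volume_eq_prod, integral_prod _ hφH]
  refine integral_congr_ae ?_
  filter_upwards [hH.prod_right_ae] with x hx
  have hpi : (2 * Real.pi)⁻¹ ≠ 0 := by positivity
  have eH : ∀ ξ, husimi ε g x ξ = ((2 * Real.pi) ^ d : ℝ)⁻¹ *
      𝓕 (smoothedCorrelation ε g x) ((2 * Real.pi)⁻¹ • ξ) := fun ξ => by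
    rw [husimi_eq_integral hε hm hg2, Real.fourier_eq']
    congr 1
    refine integral_congr_ae (.of_forall fun z => ?_)
    simp only [smul_eq_mul]
    congr 2
    rw [inner_smul_right, real_inner_comm]
    push_cast
    field_simp
  -- Integrability of the Husimi transform on this slice is read back through the Fourier
  -- representation.
  have hk : Integrable (𝓕 (smoothedCorrelation ε g x)) := by
    rw [← integrable_comp_smul_iff volume _ hpi]
    have h1 := hx.const_mul (((2 * Real.pi) ^ d : ℝ) : ℂ)
    refine h1.congr (.of_forall fun ξ => ?_)
    simp only [eH]
    rw [← mul_assoc]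
    push_cast
    rw [mul_inv_cancel₀, one_mul]
    exact pow_ne_zero _ (mul_ne_zero two_ne_zero (Complex.ofReal_ne_zero.2 Real.pi_ne_zero))
  rw [← integral_fourierInv_mul_fourier' (integrable_L1C0_apply ψ x)
    (integrable_smoothedCorrelation hε hm hg2 x) hk]
  have key := Measure.integral_comp_smul (volume : Measure (Eu d))
    (fun w => 𝓕⁻ (fun z => ψ z x) w * 𝓕 (smoothedCorrelation ε g x) w) (2 * Real.pi)⁻¹
  simp only [finrank_euclideanSpace, Fintype.card_fin] at key
  have e : ∀ ξ, φ (x, ξ) * husimi ε g x ξ = ((((2 * Real.pi) ^ d)⁻¹ : ℝ) : ℂ) *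
      (𝓕⁻ (fun z => ψ z x) ((2 * Real.pi)⁻¹ • ξ) *
        𝓕 (smoothedCorrelation ε g x) ((2 * Real.pi)⁻¹ • ξ)) := fun ξ => by
    rw [xiFourier_eq h, eH]; push_cast; ring
  simp only [e]
  rw [integral_const_mul, key, abs_of_pos (by positivity), inv_pow, inv_inv, Complex.real_smul,
    ← mul_assoc, ← Complex.ofReal_mul, inv_mul_cancel₀ (by positivity), Complex.ofReal_one,
    one_mul]

theorem norm_wignerAct_le {ε : ℝ} {g : Eu d → ℂ} (hm : Measurable g)
    (hg : Integrable (fun x => ‖g x‖ ^ 2)) (ψ : L1C0 d) :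
    ‖wignerAct ε g ψ‖ ≤ (∫ x, ‖g x‖ ^ 2) * ‖ψ‖ := by
  rw [L1.norm_eq_integral_norm, ← integral_const_mul]
  refine norm_integral_le_of_norm_le ((L1.integrable_coeFn ψ).norm.const_mul _)
    (.of_forall fun z => ?_)
  obtain ⟨h1, h2⟩ := correlation_left (ε := ε) hm hg z
  refine (norm_integral_le_of_norm_le (h1.norm.const_mul ‖ψ z‖) (.of_forall fun x => ?_)).trans ?_
  · rw [norm_mul]
    exact mul_le_mul_of_nonneg_right (C0_norm_coe_le (ψ z) x) (norm_nonneg _)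
  · rw [integral_const_mul, mul_comm]
    exact mul_le_mul_of_nonneg_right h2 (norm_nonneg _)

theorem wignerAct_sub {ε : ℝ} {g : Eu d → ℂ} (hm : Measurable g)
    (hg : Integrable (fun x => ‖g x‖ ^ 2)) (ψ χ : L1C0 d) :
    wignerAct ε g (ψ - χ) = wignerAct ε g ψ - wignerAct ε g χ := by
  have hI := fun ψ => integrable_L1C0_mul (d := d) ψ (measurable_correlation hm).stronglyMeasurable
    (correlation_left (ε := ε) hm hg)
  unfold wignerAct
  rw [← integral_sub (hI ψ).integral_prod_right (hI χ).integral_prod_right]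
  refine integral_congr_ae ?_
  filter_upwards [Lp.coeFn_sub ψ χ] with z hz
  have hz' : ∀ ψ : L1C0 d, Integrable (fun x => ψ z x * correlation ε g x z) := fun ψ =>
    (correlation_left (ε := ε) hm hg z).1.bdd_mul (c := ‖ψ z‖)
      (ψ z).continuous.aestronglyMeasurable (.of_forall (C0_norm_coe_le (ψ z)))
  rw [← integral_sub (hz' ψ) (hz' χ), hz]
  simp only [Pi.sub_apply, ZeroAtInftyContinuousMap.sub_apply, sub_mul]

theorem continuous_wignerAct {ε : ℝ} {g : Eu d → ℂ} (hm : Measurable g)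
    (hg : Integrable (fun x => ‖g x‖ ^ 2)) : Continuous (wignerAct ε g) := by
  refine (LipschitzWith.of_dist_le_mul (K := ⟨∫ x, ‖g x‖ ^ 2, by positivity⟩)
    fun ψ χ => ?_).continuous
  rw [dist_eq_norm, dist_eq_norm, ← wignerAct_sub hm hg]
  exact norm_wignerAct_le hm hg _

/-- Wigner and Husimi transforms are asymptotically equal as elements of `𝒜'`. -/
theorem norm_wignerAct_sub_husimi_le {ε : ℝ} (hε : 0 < ε) {g : Eu d → ℂ} (hm : Measurable g)
    (hg : MemLp g 2) {φ : C₀(Eu d × Eu d, ℂ)} {ψ : L1C0 d} (h : IsXiFourier φ ψ) :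
    ‖wignerAct ε g ψ - ∫ y : Eu d × Eu d, φ y * husimi ε g y.1 y.2‖ ≤
      (∫ x, ‖g x‖ ^ 2) * wignerError ε ψ := by
  have hg2 : Integrable (fun x => ‖g x‖ ^ 2) := hg.integrable_norm_pow two_ne_zero
  have hI1 := integrable_L1C0_mul ψ (measurable_correlation hm).stronglyMeasurable
    (correlation_left (ε := ε) hm hg2)
  have hI2 := integrable_L1C0_mul ψ (measurable_smoothedCorrelation ε hm)
    (integral_norm_smoothedCorrelation_le hε hm hg2)
  rw [integral_mul_husimi_eq hε hm hg h, wignerAct,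
    ← integral_sub hI1.integral_prod_right hI2.integral_prod_right, wignerError,
    ← integral_const_mul]
  refine norm_integral_le_of_norm_le ((integrable_wignerError hε ψ).const_mul _)
    (.of_forall fun z => ?_)
  obtain ⟨h1, h2⟩ := correlation_left (ε := ε) hm hg2 z
  have hz : Integrable (fun x => ψ z x * correlation ε g x z) :=
    h1.bdd_mul (c := ‖ψ z‖) (ψ z).continuous.aestronglyMeasurable
      (.of_forall (C0_norm_coe_le (ψ z)))
  let e : ℂ := (Real.exp (-(ε / 4 * ‖z‖ ^ 2)) : ℂ)
  let c : Eu d → ℂ := fun y => ∫ x, ψ z x * (gaussian ε (x - y) : ℂ)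
  -- The error splits into the loss from the factor `e < 1` and the loss from regularising `ψ z`;
  -- both are independent of `y`, so they come out of the `L¹` norm of the correlation.
  have hB : ∀ y, ‖ψ z y - e * c y‖ ≤
      (1 - Real.exp (-(ε / 4 * ‖z‖ ^ 2))) * ‖ψ z‖ + gaussianModulus ε (ψ z) := fun y => by
    obtain ⟨k1, k2⟩ := exp_factor_mem hε z
    have e1 : ψ z y - e * c y =
        ((1 - Real.exp (-(ε / 4 * ‖z‖ ^ 2)) : ℝ) : ℂ) * ψ z y + e * (ψ z y - c y) := by
      simp only [e]; push_cast; ring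
    rw [e1]
    refine (norm_add_le _ _).trans (add_le_add ?_ ?_)
    · rw [norm_mul, Complex.norm_real, Real.norm_of_nonneg k1]
      exact mul_le_mul_of_nonneg_left (C0_norm_coe_le _ _) k1
    · rw [norm_mul, Complex.norm_real, Real.norm_of_nonneg (Real.exp_pos _).le]
      exact (mul_le_of_le_one_left (norm_nonneg _) (by linarith)).trans
        (le_gaussianModulus hε (ψ z) y)
  obtain ⟨k1, k2⟩ := wignerError_integrand_bounds hε z (ψ z)
  have hcm : StronglyMeasurable c := by
    have hγ := (continuous_gaussian (d := d) ε).measurable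
    have hψ := (ψ z).continuous.measurable
    exact StronglyMeasurable.integral_prod_right' (f := fun p : Eu d × Eu d =>
      ψ z p.2 * (gaussian ε (p.2 - p.1) : ℂ)) (Measurable.stronglyMeasurable (by fun_prop))
  have hz2 : Integrable (fun y => correlation ε g y z * (e * c y)) := by
    refine h1.mul_bdd (c := 3 * ‖ψ z‖ + ‖ψ z‖) (hcm.const_mul e).aestronglyMeasurable
      (.of_forall fun y => ?_)
    have := norm_sub_norm_le (e * c y) (ψ z y)
    rw [norm_sub_rev] at this
    linarith [hB y, C0_norm_coe_le (ψ z) y]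
  rw [(integral_C0_smoothedCorrelation hε hm hg2 (ψ z) z).2, ← integral_sub hz hz2]
  refine (norm_integral_le_of_norm_le (h1.norm.mul_const
    ((1 - Real.exp (-(ε / 4 * ‖z‖ ^ 2))) * ‖ψ z‖ + gaussianModulus ε (ψ z)))
    (.of_forall fun y => ?_)).trans ?_
  · have e2 : ψ z y * correlation ε g y z - correlation ε g y z * (e * c y) =
        correlation ε g y z * (ψ z y - e * c y) := by ring
    rw [e2, norm_mul]
    exact mul_le_mul_of_nonneg_left (hB y) (norm_nonneg _)
  · rw [integral_mul_const]
    exact mul_le_mul_of_nonneg_right h2 k1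

end Comparison

/-! ### Families depending on time: representatives and measurability. -/

section TimeDependent

variable {d : ℕ}

theorem ae_eLpNorm_le {F : Type*} [NormedAddCommGroup F] {T : ℝ} (g : ℝ → Eu d → F) :
    ∀ᵐ t ∂(timeMeasure T), ∫⁻ x, ‖g t x‖ₑ ^ 2 ≤ normLinfL2 T g ^ 2 := by
  filter_upwards [ae_le_essSup (μ := timeMeasure T) (f := fun t => eLpNorm (g t) 2 volume)] with t ht
  rw [lintegral_enorm_sq_eq_eLpNorm]
  exact pow_le_pow_left₀ zero_le ht 2

theorem memLp_two_of_lintegral {F : Type*} [NormedAddCommGroup F] {g : Eu d → F}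
    (hm : AEStronglyMeasurable g) {C : ℝ≥0} (h : ∫⁻ x, ‖g x‖ₑ ^ 2 ≤ C) : MemLp g 2 := by
  refine ⟨hm, ?_⟩
  rw [lintegral_enorm_sq_eq_eLpNorm] at h
  by_contra hcon
  rw [not_lt, top_le_iff] at hcon
  rw [hcon] at h
  simp at h

/-- A jointly measurable representative is set to zero at the times where the `L²` bound fails, so
that the bound holds for every `t`. -/
theorem exists_representative {T : ℝ} {g : ℝ → Eu d → ℂ} {C : ℝ≥0}
    (hm : AEStronglyMeasurable (fun p : ℝ × Eu d => g p.1 p.2) ((timeMeasure T).prod volume))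
    (hC : ∀ᵐ t ∂(timeMeasure T), ∫⁻ x, ‖g t x‖ₑ ^ 2 ≤ C) :
    ∃ u : ℝ → Eu d → ℂ, Measurable (fun p : ℝ × Eu d => u p.1 p.2) ∧
      (∀ t, MemLp (u t) 2 ∧ ∫⁻ x, ‖u t x‖ₑ ^ 2 ≤ C) ∧
      ∀ᵐ t ∂(timeMeasure T), g t =ᵐ[volume] u t := by
  have hmk : Measurable (hm.mk _) := hm.stronglyMeasurable_mk.measurable
  let S : Set ℝ := {t | ∫⁻ x, ‖hm.mk _ (t, x)‖ₑ ^ 2 ≤ C}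
  have hS : MeasurableSet S :=
    measurableSet_le (Measurable.lintegral_prod_right' (hmk.enorm.pow_const 2)) measurable_const
  have hSm : Measurable (fun p : ℝ × Eu d => (S ×ˢ univ).indicator (hm.mk _) p) :=
    hmk.indicator (hS.prod MeasurableSet.univ)
  have e : ∀ t x, (S ×ˢ univ).indicator (hm.mk _) (t, x) =
      if t ∈ S then hm.mk _ (t, x) else 0 := fun t x => by
    by_cases h : t ∈ S <;> simp [h]
  have hb : ∀ t, ∫⁻ x, ‖(S ×ˢ univ).indicator (hm.mk _) (t, x)‖ₑ ^ 2 ≤ C := fun t => by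
    simp only [e]
    by_cases h : t ∈ S
    · simp only [h, if_true]; exact h
    · simp [h]
  refine ⟨fun t x => (S ×ˢ univ).indicator (hm.mk _) (t, x), hSm, fun t => ⟨?_, hb t⟩, ?_⟩
  · exact memLp_two_of_lintegral
      (hSm.comp measurable_prodMk_left).aestronglyMeasurable (hb t)
  · filter_upwards [hC, Measure.ae_ae_of_ae_prod hm.ae_eq_mk] with t h1 h2
    have ht : t ∈ S := by
      change ∫⁻ x, ‖hm.mk _ (t, x)‖ₑ ^ 2 ≤ C
      refine le_trans (le_of_eq (lintegral_congr_ae ?_)) h1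
      filter_upwards [h2] with x hx
      rw [← hx]
    filter_upwards [h2] with x hx
    rw [e, if_pos ht]
    exact hx

theorem ae_memLp {T : ℝ} {g : ℝ → Eu d → ℂ} {C : ℝ≥0}
    (hm : AEStronglyMeasurable (fun p : ℝ × Eu d => g p.1 p.2) ((timeMeasure T).prod volume))
    (hC : ∀ᵐ t ∂(timeMeasure T), ∫⁻ x, ‖g t x‖ₑ ^ 2 ≤ C) :
    ∀ᵐ t ∂(timeMeasure T), MemLp (g t) 2 := by
  obtain ⟨u, -, hu, hgu⟩ := exists_representative hm hC
  filter_upwards [hgu] with t ht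
  exact (memLp_congr_ae ht).2 (hu t).1

theorem BoundedFamily.exists_bound {T : ℝ} {f : ℝ → ℝ → Eu d → ℂ} (hf : BoundedFamily T f) :
    ∃ C : ℝ≥0, ∀ ε > 0, ∀ᵐ t ∂(timeMeasure T), ∫⁻ x, ‖f ε t x‖ₑ ^ 2 ≤ C := by
  obtain ⟨C, hC⟩ := hf.2
  refine ⟨C ^ 2, fun ε hε => ?_⟩
  filter_upwards [ae_eLpNorm_le (T := T) (f ε)] with t ht
  refine ht.trans ?_
  push_cast
  exact pow_le_pow_left₀ zero_le (hC ε hε) 2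

theorem aestronglyMeasurable_husimi {T ε : ℝ} (hε : 0 < ε) {g : ℝ → Eu d → ℂ} {C : ℝ≥0}
    (hm : AEStronglyMeasurable (fun p : ℝ × Eu d => g p.1 p.2) ((timeMeasure T).prod volume))
    (hC : ∀ᵐ t ∂(timeMeasure T), ∫⁻ x, ‖g t x‖ₑ ^ 2 ≤ C) :
    AEStronglyMeasurable (fun p : ℝ × (Eu d × Eu d) => husimi ε (g p.1) p.2.1 p.2.2)
      ((timeMeasure T).prod volume) := by
  obtain ⟨u, hum, hu, hgu⟩ := exists_representative hm hC
  have h1 : Measurable (fun p : ℝ × (Eu d × Eu d) =>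
      (husimiDensity ε (u p.1) p.2.1 p.2.2 : ℂ)) :=
    Complex.measurable_ofReal.comp (measurable_husimiDensity ε hum)
  refine h1.aestronglyMeasurable.congr ?_
  filter_upwards [Measure.quasiMeasurePreserving_fst.ae hgu] with p hp
  rw [husimi_congr_ae hε hp, husimi_eq hε (hu p.1).1]

theorem lintegral_enorm_husimi {ε : ℝ} (hε : 0 < ε) {g : Eu d → ℂ} (hg : MemLp g 2)
    (m : Eu d × Eu d → ℝ≥0∞) : ∫⁻ y : Eu d × Eu d, m y * ‖husimi ε g y.1 y.2‖ₑ =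
      ∫⁻ y : Eu d × Eu d, m y * ENNReal.ofReal (husimiDensity ε g y.1 y.2) := by
  refine lintegral_congr fun y => ?_
  rw [husimi_eq hε hg, ← ofReal_norm, Complex.norm_real,
    Real.norm_of_nonneg (husimiDensity_nonneg hε g _ _)]

theorem lintegral_enorm_husimi_le {T ε : ℝ} (hε : 0 < ε) {g : ℝ → Eu d → ℂ} {C : ℝ≥0}
    (hm : AEStronglyMeasurable (fun p : ℝ × Eu d => g p.1 p.2) ((timeMeasure T).prod volume))
    (hC : ∀ᵐ t ∂(timeMeasure T), ∫⁻ x, ‖g t x‖ₑ ^ 2 ≤ C) :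
    ∀ᵐ t ∂(timeMeasure T), ∫⁻ y : Eu d × Eu d, ‖husimi ε (g t) y.1 y.2‖ₑ ≤ C := by
  filter_upwards [hC, ae_memLp hm hC] with t h1 h2
  have := lintegral_enorm_husimi hε h2 (fun _ => 1)
  simp only [one_mul] at this
  rw [this, lintegral_husimiDensity_mass hε h2]
  exact h1

instance : SecondCountableTopology (L1C0 d) :=
  haveI : Fact ((1 : ℝ≥0∞) ≠ ⊤) := ⟨ENNReal.one_ne_top⟩
  inferInstance

/-- A Carathéodory argument: the action is continuous in `ψ` and measurable in `t`, hence jointly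
measurable because `L1C0 d` is second countable. -/
theorem aestronglyMeasurable_wignerAct {T ε : ℝ} {u : ℝ → Eu d → ℂ}
    (hum : Measurable (fun p : ℝ × Eu d => u p.1 p.2)) (hu : ∀ t, MemLp (u t) 2)
    {ψ : ℝ → L1C0 d} (hψ : AEStronglyMeasurable ψ (timeMeasure T)) :
    AEStronglyMeasurable (fun t => wignerAct ε (u t) (ψ t)) (timeMeasure T) := by
  borelize (L1C0 d)
  have hut : ∀ t, Measurable (u t) := fun t => hum.comp measurable_prodMk_left
  have hc : ∀ t, Continuous fun ψ => wignerAct ε (u t) ψ := fun t =>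
    continuous_wignerAct (hut t) ((hu t).integrable_norm_pow two_ne_zero)
  have hs : ∀ ψ : L1C0 d, StronglyMeasurable fun t => wignerAct ε (u t) ψ := fun ψ => by
    unfold wignerAct
    refine StronglyMeasurable.integral_prod_right' (f := fun q : ℝ × Eu d =>
      ∫ x, ψ q.2 x * correlation ε (u q.1) x q.2) ?_
    refine StronglyMeasurable.integral_prod_right' (f := fun q : (ℝ × Eu d) × Eu d =>
      ψ q.1.2 q.2 * correlation ε (u q.1.1) q.2 q.1.2) ?_
    refine ((stronglyMeasurable_L1C0_uncurry ψ).comp_measurable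
      ((measurable_snd.comp measurable_fst).prodMk measurable_snd)).mul
      (Measurable.stronglyMeasurable ?_)
    have h1 : Measurable (fun q : (ℝ × Eu d) × Eu d => u q.1.1 (q.2 + (ε / 2) • q.1.2)) := by
      have : Measurable (fun q : (ℝ × Eu d) × Eu d => (q.1.1, q.2 + (ε / 2) • q.1.2)) := by
        fun_prop
      exact hum.comp this
    have h2 : Measurable (fun q : (ℝ × Eu d) × Eu d => u q.1.1 (q.2 - (ε / 2) • q.1.2)) := by
      have : Measurable (fun q : (ℝ × Eu d) × Eu d => (q.1.1, q.2 - (ε / 2) • q.1.2)) := by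
        fun_prop
      exact hum.comp this
    exact h1.mul (Complex.continuous_conj.measurable.comp h2)
  have hj := stronglyMeasurable_uncurry_of_continuous_of_stronglyMeasurable
    (u := fun ψ t => wignerAct ε (u t) ψ) hc hs
  have h2 : StronglyMeasurable (fun t => wignerAct ε (u t) (hψ.mk ψ t)) :=
    hj.comp_measurable (hψ.stronglyMeasurable_mk.measurable.prodMk measurable_id)
  refine h2.aestronglyMeasurable.congr ?_
  filter_upwards [hψ.ae_eq_mk] with t ht
  rw [← ht]

theorem continuous_xiFourier (x ξ : Eu d) : Continuous (fun ψ : L1C0 d =>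
    ∫ z, Complex.exp (Complex.I * (inner ℝ ξ z : ℝ)) * ψ z x) := by
  have hn : ∀ z : Eu d, ‖Complex.exp (Complex.I * (inner ℝ ξ z : ℝ))‖ = 1 := fun z => by
    simp [Complex.norm_exp]
  have hi : ∀ ψ : L1C0 d, Integrable
      (fun z => Complex.exp (Complex.I * (inner ℝ ξ z : ℝ)) * ψ z x) := fun ψ =>
    (integrable_L1C0_apply ψ x).bdd_mul (c := 1) (Continuous.aestronglyMeasurable (by fun_prop))
      (.of_forall fun z => (hn z).le)
  refine (LipschitzWith.of_dist_le_mul (K := 1) fun ψ χ => ?_).continuous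
  rw [dist_eq_norm, dist_eq_norm, ← integral_sub (hi ψ) (hi χ), L1.norm_eq_integral_norm,
    NNReal.coe_one, one_mul]
  refine norm_integral_le_of_norm_le (L1.integrable_coeFn _).norm ?_
  filter_upwards [Lp.coeFn_sub ψ χ] with z hz
  rw [← mul_sub, norm_mul, hn, one_mul, hz]
  exact C0_norm_coe_le (ψ z - χ z) x

theorem norm_le_of_isXiFourier {φ : C₀(Eu d × Eu d, ℂ)} {ψ : L1C0 d} (h : IsXiFourier φ ψ) :
    ‖φ‖ ≤ ‖ψ‖ := by
  refine C0_norm_le (norm_nonneg _) fun y => ?_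
  rw [show φ y = φ (y.1, y.2) from rfl, h, L1.norm_eq_integral_norm]
  refine norm_integral_le_of_norm_le (L1.integrable_coeFn _).norm (.of_forall fun z => ?_)
  rw [norm_mul]
  refine (mul_le_of_le_one_left (norm_nonneg _) ?_).trans (C0_norm_coe_le (ψ z) y.1)
  simp [Complex.norm_exp]

/-- The embedding of `𝒜` into `C₀` has norm at most one, and `φ(t)` is measurable because its values
are continuous functionals of `ψ(t)`. -/
theorem integrable_of_isXiFourier {T : ℝ} {φ : ℝ → C₀(Eu d × Eu d, ℂ)} {ψ : ℝ → L1C0 d}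
    (h : ∀ᵐ t ∂(timeMeasure T), IsXiFourier (φ t) (ψ t)) (hψ : Integrable ψ (timeMeasure T)) :
    Integrable φ (timeMeasure T) := by
  refine hψ.norm.mono' (aestronglyMeasurable_C0 fun y => ?_)
    (h.mono fun t ht => norm_le_of_isXiFourier ht)
  refine ((continuous_xiFourier y.1 y.2).comp_aestronglyMeasurable hψ.1).congr ?_
  filter_upwards [h] with t ht
  exact (ht y.1 y.2).symm

theorem integral_norm_sq_le {g : Eu d → ℂ} (hg : MemLp g 2) {C : ℝ≥0}
    (h : ∫⁻ x, ‖g x‖ₑ ^ 2 ≤ C) : ∫ x, ‖g x‖ ^ 2 ≤ C := by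
  have hm : AEStronglyMeasurable (fun x => ‖g x‖ ^ 2) := hg.1.norm.pow 2
  rw [integral_eq_lintegral_of_nonneg_ae (.of_forall fun x => by positivity) hm]
  refine ENNReal.toReal_le_coe_of_le_coe (le_trans (le_of_eq ?_) h)
  refine lintegral_congr fun x => ?_
  rw [ENNReal.ofReal_pow (norm_nonneg _), ofReal_norm]

/-- The Wigner transforms have the same limit as the Husimi transforms. -/
theorem wigner_tendsto_of_husimi_tendsto {T : ℝ} {f : ℝ → ℝ → Eu d → ℂ} (hf : BoundedFamily T f)
    {ε : ℕ → ℝ} (hε : ∀ n, 0 < ε n) (hlim : Tendsto ε atTop (𝓝 0)) {μ : ℝ → Measure (Eu d × Eu d)}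
    (hH : ∀ φ : ℝ → C₀(Eu d × Eu d, ℂ), Integrable φ (timeMeasure T) →
      PairingTendsto T (fun t y => φ t y) (fun n t y => husimi (ε n) (f (ε n) t) y.1 y.2) μ)
    {φ : ℝ → C₀(Eu d × Eu d, ℂ)} {ψ : ℝ → L1C0 d}
    (h : ∀ᵐ t ∂(timeMeasure T), IsXiFourier (φ t) (ψ t)) (hψ : Integrable ψ (timeMeasure T)) :
    (∀ n, IntegrableOn (fun t => wignerAct (ε n) (f (ε n) t) (ψ t)) (Ioo 0 T)) ∧
    Tendsto (fun n => ∫ t in Ioo 0 T, wignerAct (ε n) (f (ε n) t) (ψ t)) atTop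
      (𝓝 (∫ t in Ioo 0 T, ∫ y, φ t y ∂(μ t))) := by
  obtain ⟨C, hC⟩ := hf.exists_bound
  have hrep := fun n => exists_representative (hf.1 (ε n) (hε n)) (hC (ε n) (hε n))
  choose u hum hu hfu using hrep
  have hut : ∀ n t, Measurable (u n t) := fun n t => (hum n).comp measurable_prodMk_left
  have hu2 : ∀ n t, Integrable (fun x => ‖u n t x‖ ^ 2) := fun n t =>
    (hu n t).1.integrable_norm_pow two_ne_zero
  have huC : ∀ n t, ∫ x, ‖u n t x‖ ^ 2 ≤ C := fun n t => integral_norm_sq_le (hu n t).1 (hu n t).2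
  have hW : ∀ n, Integrable (fun t => wignerAct (ε n) (f (ε n) t) (ψ t)) (timeMeasure T) := by
    intro n
    have h1 : Integrable (fun t => wignerAct (ε n) (u n t) (ψ t)) (timeMeasure T) := by
      refine (hψ.norm.const_mul (C : ℝ)).mono' (aestronglyMeasurable_wignerAct (hum n)
        (fun t => (hu n t).1) hψ.1) (.of_forall fun t => ?_)
      exact (norm_wignerAct_le (hut n t) (hu2 n t) _).trans
        (mul_le_mul_of_nonneg_right (huC n t) (norm_nonneg _))
    refine h1.congr ?_
    filter_upwards [hfu n] with t ht
    exact (wignerAct_congr_ae (ε n) ht (ψ t)).symm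
  refine ⟨hW, ?_⟩
  obtain ⟨hI, hT⟩ := hH φ (integrable_of_isXiFourier h hψ)
  -- The error vanishes for each fixed `t` and is at most `3 ‖ψ t‖`, which is integrable in time.
  have hD : Tendsto (fun n => ∫ t in Ioo 0 T, (C : ℝ) * wignerError (ε n) (ψ t)) atTop (𝓝 0) := by
    refine (tendsto_integral_of_dominated_convergence (fun t => C * (3 * ‖ψ t‖))
      (f := fun _ => 0)
      (fun n => ((continuous_wignerError (hε n)).comp_aestronglyMeasurable hψ.1).const_mul (C : ℝ))
      ((hψ.norm.const_mul 3).const_mul _) (fun n => .of_forall fun t => ?_)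
      (.of_forall fun t => ?_)).trans_eq (by simp)
    · refine (Real.norm_of_nonneg (mul_nonneg C.2 (wignerError_nonneg (hε n) _))).trans_le ?_
      exact mul_le_mul_of_nonneg_left (wignerError_le (hε n) _) C.2
    · simpa using (tendsto_wignerError hε hlim (ψ t)).const_mul (C : ℝ)
  have hdiff : Tendsto (fun n => (∫ t in Ioo 0 T, wignerAct (ε n) (f (ε n) t) (ψ t)) -
      ∫ t in Ioo 0 T, ∫ y : Eu d × Eu d, φ t y * husimi (ε n) (f (ε n) t) y.1 y.2) atTop (𝓝 0) := by
    refine squeeze_zero_norm (fun n => ?_) hD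
    rw [← integral_sub (hW n) (hI n).integral_prod_left]
    refine norm_integral_le_of_norm_le ?_ ?_
    · refine ((hψ.norm.const_mul 3).const_mul (C : ℝ)).mono'
        (((continuous_wignerError (hε n)).comp_aestronglyMeasurable hψ.1).const_mul (C : ℝ))
        (.of_forall fun t => ?_)
      refine (Real.norm_of_nonneg (mul_nonneg C.2 (wignerError_nonneg (hε n) _))).trans_le ?_
      exact mul_le_mul_of_nonneg_left (wignerError_le (hε n) _) C.2
    · filter_upwards [hfu n, h] with t ht hx
      rw [wignerAct_congr_ae (ε n) ht (ψ t)]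
      simp only [husimi_congr_ae (hε n) ht]
      exact (norm_wignerAct_sub_husimi_le (hε n) (hut n t) (hu n t).1 hx).trans
        (mul_le_mul_of_nonneg_right (huC n t) (wignerError_nonneg (hε n) _))
  simpa using hdiff.add hT

end TimeDependent

/-! ### Vague compactness of finite measures. -/

section VagueCompactness

open CompactlySupported

variable {Y : Type*} [NormedAddCommGroup Y] [ProperSpace Y] [SecondCountableTopology Y]
  [MeasurableSpace Y] [BorelSpace Y]

theorem integrable_C0_of_finite {ν : Measure Y} [IsFiniteMeasure ν] (g : C₀(Y, ℝ)) :
    Integrable g ν :=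
  Integrable.of_bound g.continuous.aestronglyMeasurable ‖g‖ (.of_forall (C0_norm_coe_le g))

/-- Integration against a finite measure, as an element of the dual of `C₀`. -/
def integralC0 (ν : Measure Y) [IsFiniteMeasure ν] : StrongDual ℝ C₀(Y, ℝ) :=
  LinearMap.mkContinuous
    { toFun := fun g => ∫ y, g y ∂ν
      map_add' := fun g h => integral_add (integrable_C0_of_finite g) (integrable_C0_of_finite h)
      map_smul' := fun c g => integral_const_mul c _ } (ν.real univ) fun g => by
    rw [mul_comm]
    exact norm_integral_le_of_norm_le_const (.of_forall (C0_norm_coe_le g))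

theorem norm_integralC0_le (ν : Measure Y) [IsFiniteMeasure ν] : ‖integralC0 ν‖ ≤ ν.real univ :=
  LinearMap.mkContinuous_norm_le _ measureReal_nonneg _

/-- The inclusion of the compactly supported functions in `C₀`. -/
def toC0 : C_c(Y, ℝ) →ₗ[ℝ] C₀(Y, ℝ) where
  toFun g := ⟨g.toContinuousMap, g.hasCompactSupport.is_zero_at_infty⟩
  map_add' _ _ := rfl
  map_smul' _ _ := rfl

/-- Fatou's lemma as the cutoffs increase to `1`: bounds known only for compactly supported
functions extend to all continuous ones. -/
theorem lintegral_le_of_cutoff {μ : Measure Y} {a : Y → ℝ} (ha : Continuous a)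
    {M : ℝ≥0∞} (h : ∀ R : ℕ, ∫⁻ y, ENNReal.ofReal (cutoff R y * a y) ∂μ ≤ M) :
    ∫⁻ y, ENNReal.ofReal (a y) ∂μ ≤ M := by
  have hl : ∀ y, ENNReal.ofReal (a y) =
      liminf (fun R : ℕ => ENNReal.ofReal (cutoff R y * a y)) atTop := fun y => by
    refine (Tendsto.liminf_eq ?_).symm
    refine (ENNReal.continuous_ofReal.tendsto _).comp ?_
    simpa using (tendsto_cutoff y).mul_const (a y)
  simp only [hl]
  refine (lintegral_liminf_le fun R => ?_).trans ?_
  · exact (ENNReal.continuous_ofReal.comp ((continuous_cutoff R).mul ha)).measurable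
  · exact (liminf_le_liminf (.of_forall h)).trans_eq (by simp)

/-- Sequential vague compactness of bounded sequences of finite measures. -/
theorem exists_vague_limit {ν : ℕ → Measure Y} [∀ n, IsFiniteMeasure (ν n)] {M : ℝ≥0}
    (hM : ∀ n, ν n univ ≤ M) :
    ∃ (θ : ℕ → ℕ) (μ : Measure Y), StrictMono θ ∧ IsFiniteMeasure μ ∧
      ∀ g : Y → ℝ, Continuous g → HasCompactSupport g →
        Tendsto (fun n => ∫ y, g y ∂(ν (θ n))) atTop (𝓝 (∫ y, g y ∂μ)) := by
  have hball : ∀ n, StrongDual.toWeakDual (integralC0 (ν n)) ∈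
      WeakDual.toStrongDual ⁻¹' Metric.closedBall (0 : StrongDual ℝ C₀(Y, ℝ)) M := fun n => by
    have : ‖integralC0 (ν n)‖ ≤ M :=
      (norm_integralC0_le (ν n)).trans (ENNReal.toReal_le_coe_of_le_coe (hM n))
    rw [Set.mem_preimage, Metric.mem_closedBall]
    exact (dist_zero_right (integralC0 (ν n))).trans_le this
  -- Banach-Alaoglu in sequential form, available because `C₀` is separable.
  obtain ⟨Λ, -, θ, hθ, hΛ⟩ :=
    WeakDual.isSeqCompact_closedBall ℝ C₀(Y, ℝ) 0 (M : ℝ) hball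
  have hlim : ∀ g : C₀(Y, ℝ), Tendsto (fun n => ∫ y, g y ∂(ν (θ n))) atTop (𝓝 (Λ g)) :=
    fun g => ((WeakDual.eval_continuous g).tendsto Λ).comp hΛ
  -- The weak-* limit stays positive on compactly supported functions, so the Riesz-Markov theorem
  -- represents it by a measure.
  let L : C_c(Y, ℝ) →ₚ[ℝ] ℝ := PositiveLinearMap.mk₀ (Λ.toLinearMap ∘ₗ toC0) fun g hg =>
    ge_of_tendsto' (hlim (toC0 g)) fun n => integral_nonneg hg
  have hc : ∀ g : Y → ℝ, Continuous g → HasCompactSupport g →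
      Tendsto (fun n => ∫ y, g y ∂(ν (θ n))) atTop (𝓝 (∫ y, g y ∂(RealRMK.rieszMeasure L))) := by
    intro g hg hgs
    let G : C_c(Y, ℝ) := ⟨⟨g, hg⟩, hgs⟩
    have := RealRMK.integral_rieszMeasure L G
    rw [show (∫ y, g y ∂(RealRMK.rieszMeasure L)) = L G from this]
    exact hlim (toC0 G)
  refine ⟨θ, RealRMK.rieszMeasure L, hθ, ⟨?_⟩, hc⟩
  refine lt_of_le_of_lt ?_ (ENNReal.coe_lt_top (r := M))
  -- Mass may escape to infinity, so only the upper bound `M` survives; it is tested on cutoffs of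
  -- the constant `1`.
  have := lintegral_le_of_cutoff (μ := RealRMK.rieszMeasure L) (a := fun _ => 1) continuous_const
    (M := M) fun R => ?_
  · simpa using this
  · simp only [mul_one]
    have hi : Integrable (cutoff R : Y → ℝ) (RealRMK.rieszMeasure L) :=
      (continuous_cutoff R).integrable_of_hasCompactSupport (hasCompactSupport_cutoff R)
    rw [← ofReal_integral_eq_lintegral_ofReal hi (.of_forall (cutoff_nonneg R))]
    refine ENNReal.ofReal_le_of_le_toReal ?_
    refine le_of_tendsto' (hc _ (continuous_cutoff R) (hasCompactSupport_cutoff R)) fun n => ?_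
    refine (Real.le_norm_self _).trans ((norm_integral_le_of_norm_le_const (C := 1)
      (.of_forall fun y => ?_)).trans ?_)
    · rw [Real.norm_of_nonneg (cutoff_nonneg R y)]
      exact cutoff_le_one R y
    · rw [one_mul]
      exact ENNReal.toReal_le_coe_of_le_coe (hM _)

/-- Closed sets are handled by decreasing continuous approximations of their indicators, and Borel
sets by inner regularity. -/
theorem measure_le_of_lintegral_le {μ ν : Measure Y} [IsFiniteMeasure μ] [IsFiniteMeasure ν]
    (h : ∀ a : Y →ᵇ ℝ≥0, ∫⁻ y, a y ∂μ ≤ ∫⁻ y, a y ∂ν) : μ ≤ ν := by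
  have hF : ∀ F : Set Y, IsClosed F → μ F ≤ ν F := fun F hF =>
    le_of_tendsto_of_tendsto' (HasOuterApproxClosed.tendsto_lintegral_apprSeq hF μ)
      (HasOuterApproxClosed.tendsto_lintegral_apprSeq hF ν) fun n => h _
  refine Measure.le_intro fun A hA _ => ?_
  rw [hA.measure_eq_iSup_isClosed_of_ne_top (measure_ne_top μ A)]
  exact iSup₂_le fun F hFA => iSup_le fun hFc => (hF F hFc).trans (measure_mono hFA)

end VagueCompactness

/-! ### Measures on time and space with bounded time marginal. -/

section TimeMeasures

variable {X : Type*} [NormedAddCommGroup X] [ProperSpace X] [SecondCountableTopology X]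
  [MeasurableSpace X] [BorelSpace X]

/-- Rules out concentration in time. A function of `t` alone is truncated before passing to the
limit; a loss of mass at spatial infinity only helps the inequality. -/
theorem fst_le_of_vague {ν : ℕ → Measure (ℝ × X)} {μ : Measure (ℝ × X)}
    [∀ n, IsFiniteMeasure (ν n)] [IsFiniteMeasure μ] {τ : Measure ℝ} [IsFiniteMeasure τ]
    (hν : ∀ n, (ν n).fst ≤ τ)
    (h : ∀ g : ℝ × X → ℝ, Continuous g → HasCompactSupport g →
        Tendsto (fun n => ∫ y, g y ∂(ν n)) atTop (𝓝 (∫ y, g y ∂μ))) : μ.fst ≤ τ := by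
  refine measure_le_of_lintegral_le fun a => ?_
  have hac : Continuous fun p : ℝ × X => (a p.1 : ℝ) := by fun_prop
  have hfst : ∀ ρ : Measure (ℝ × X), ∫⁻ t, a t ∂ρ.fst = ∫⁻ p, ENNReal.ofReal (a p.1) ∂ρ := fun ρ => by
    rw [Measure.fst, lintegral_map (by fun_prop) measurable_fst]
    simp
  rw [hfst]
  refine lintegral_le_of_cutoff hac fun R => ?_
  have hcont : Continuous fun p : ℝ × X => cutoff R p * (a p.1 : ℝ) := (continuous_cutoff R).mul hac
  have hcs : HasCompactSupport fun p : ℝ × X => cutoff R p * (a p.1 : ℝ) :=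
    (hasCompactSupport_cutoff R).mul_right
  have h0 : ∀ p : ℝ × X, 0 ≤ cutoff R p * (a p.1 : ℝ) := fun p =>
    mul_nonneg (cutoff_nonneg R p) (a p.1).2
  rw [← ofReal_integral_eq_lintegral_ofReal (hcont.integrable_of_hasCompactSupport hcs)
    (.of_forall h0)]
  refine le_of_tendsto' (ENNReal.tendsto_ofReal (h _ hcont hcs)) fun n => ?_
  rw [ofReal_integral_eq_lintegral_ofReal (hcont.integrable_of_hasCompactSupport hcs)
    (.of_forall h0)]
  calc ∫⁻ p, ENNReal.ofReal (cutoff R p * (a p.1 : ℝ)) ∂(ν n)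
      ≤ ∫⁻ p, ENNReal.ofReal (a p.1) ∂(ν n) := lintegral_mono fun p => ENNReal.ofReal_le_ofReal
        (mul_le_of_le_one_left (a p.1).2 (cutoff_le_one R p))
    _ = ∫⁻ t, a t ∂(ν n).fst := (hfst _).symm
    _ ≤ ∫⁻ t, a t ∂τ := lintegral_mono' (hν n) le_rfl

theorem norm_integral_fst_mul_le {ν : Measure (ℝ × X)} {τ : Measure ℝ} (hν : ν.fst ≤ τ)
    {a : ℝ → ℂ} (ha : Integrable a τ) (b : C₀(X, ℂ)) :
    ‖∫ p, a p.1 * b p.2 ∂ν‖ ≤ (∫ t, ‖a t‖ ∂τ) * ‖b‖ := by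
  have h1 : Integrable (fun p : ℝ × X => ‖a p.1‖) ν :=
    (ha.mono_measure hν).norm.comp_measurable measurable_fst
  have h2 : ∫ p, ‖a p.1‖ ∂ν ≤ ∫ t, ‖a t‖ ∂τ := by
    have : ∫ p, ‖a p.1‖ ∂ν = ∫ t, ‖a t‖ ∂ν.fst :=
      (integral_map measurable_fst.aemeasurable (ha.mono_measure hν).norm.1).symm
    rw [this]
    exact integral_mono_measure hν (.of_forall fun t => norm_nonneg _) ha.norm
  refine (norm_integral_le_of_norm_le (h1.mul_const ‖b‖) (.of_forall fun p => ?_)).trans ?_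
  · rw [norm_mul]
    exact mul_le_mul_of_nonneg_left (C0_norm_coe_le b p.2) (norm_nonneg _)
  · rw [integral_mul_const]
    exact mul_le_mul_of_nonneg_right h2 (norm_nonneg _)

theorem integrable_fst_mul {ν : Measure (ℝ × X)} {τ : Measure ℝ} (hν : ν.fst ≤ τ)
    {a : ℝ → ℂ} (ha : Integrable a τ) (b : C₀(X, ℂ)) :
    Integrable (fun p : ℝ × X => a p.1 * b p.2) ν :=
  ((ha.mono_measure hν).comp_measurable measurable_fst).mul_bdd (c := ‖b‖)
    (b.continuous.comp continuous_snd).aestronglyMeasurable (.of_forall fun p => C0_norm_coe_le b p.2)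

theorem tendsto_integral_complex {ν : ℕ → Measure (ℝ × X)} {μ : Measure (ℝ × X)}
    [∀ n, IsFiniteMeasure (ν n)] [IsFiniteMeasure μ]
    (h : ∀ g : ℝ × X → ℝ, Continuous g → HasCompactSupport g →
        Tendsto (fun n => ∫ y, g y ∂(ν n)) atTop (𝓝 (∫ y, g y ∂μ)))
    {g : ℝ × X → ℂ} (hg : Continuous g) (hs : HasCompactSupport g) :
    Tendsto (fun n => ∫ y, g y ∂(ν n)) atTop (𝓝 (∫ y, g y ∂μ)) := by
  have hi : ∀ (ρ : Measure (ℝ × X)) [IsFiniteMeasure ρ], ∫ y, g y ∂ρ =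
      ((∫ y, (g y).re ∂ρ : ℝ) : ℂ) + ((∫ y, (g y).im ∂ρ : ℝ) : ℂ) * Complex.I := fun ρ _ =>
    (integral_re_add_im (hg.integrable_of_hasCompactSupport hs)).symm
  simp only [hi]
  have h1 := h _ (Complex.continuous_re.comp hg) (hs.comp_left (g := Complex.re) rfl)
  have h2 := h _ (Complex.continuous_im.comp hg) (hs.comp_left (g := Complex.im) rfl)
  exact ((Complex.continuous_ofReal.tendsto _).comp h1).add
    (((Complex.continuous_ofReal.tendsto _).comp h2).mul_const _)

/-- Discontinuous functions of time are allowed because all time marginals lie below `τ`: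
approximating `a` in `L¹(τ)` by a function in `C_c` costs the same under every measure involved. -/
theorem tendsto_integral_fst_mul {ν : ℕ → Measure (ℝ × X)} {μ : Measure (ℝ × X)}
    [∀ n, IsFiniteMeasure (ν n)] [IsFiniteMeasure μ] {τ : Measure ℝ} [IsFiniteMeasure τ]
    (hν : ∀ n, (ν n).fst ≤ τ) (hμ : μ.fst ≤ τ)
    (h : ∀ g : ℝ × X → ℝ, Continuous g → HasCompactSupport g →
        Tendsto (fun n => ∫ y, g y ∂(ν n)) atTop (𝓝 (∫ y, g y ∂μ)))
    {a : ℝ → ℂ} (ha : Integrable a τ) {b : C₀(X, ℂ)} (hb : HasCompactSupport b) :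
    Tendsto (fun n => ∫ p, a p.1 * b p.2 ∂(ν n)) atTop (𝓝 (∫ p, a p.1 * b p.2 ∂μ)) := by
  refine tendsto_of_approx fun δ hδ => ?_
  obtain ⟨c, hcs, hc1, hcc, hci⟩ := ha.exists_hasCompactSupport_integral_sub_le
    (ε := δ / (‖b‖ + 1)) (by positivity)
  have key : ∀ ρ : Measure (ℝ × X), ρ.fst ≤ τ →
      ‖(∫ p, a p.1 * b p.2 ∂ρ) - ∫ p, c p.1 * b p.2 ∂ρ‖ ≤ δ := fun ρ hρ => by
    rw [← integral_sub (integrable_fst_mul hρ ha b) (integrable_fst_mul hρ hci b)]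
    simp only [← sub_mul]
    refine (norm_integral_fst_mul_le (a := fun t => a t - c t) hρ (ha.sub hci) b).trans ?_
    refine (mul_le_mul_of_nonneg_right hc1 (norm_nonneg b)).trans ?_
    rw [div_mul_eq_mul_div, div_le_iff₀ (by positivity)]
    nlinarith [norm_nonneg b]
  refine ⟨_, _, tendsto_integral_complex h (g := fun p => c p.1 * b p.2)
    ((hcc.comp continuous_fst).mul (b.continuous.comp continuous_snd)) ?_,
    fun n => key _ (hν n), key _ hμ⟩
  refine HasCompactSupport.of_support_subset_isCompact
    (hcs.isCompact.prod hb.isCompact) fun p hp => ?_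
  have hp' := mul_ne_zero_iff.1 hp
  exact ⟨subset_tsupport _ hp'.1, subset_tsupport _ hp'.2⟩

/-- Disintegration of a measure with bounded time density. -/
theorem exists_kernel_of_fst_le {μ : Measure (ℝ × X)} [IsFiniteMeasure μ] {τ : Measure ℝ}
    [IsFiniteMeasure τ] {C : ℝ≥0} (h : μ.fst ≤ C • τ) :
    ∃ κ : ProbabilityTheory.Kernel ℝ X, (∀ t, κ t univ ≤ C) ∧
      ∀ F : ℝ × X → ℂ, Integrable F μ → ∫ p, F p ∂μ = ∫ t, ∫ y, F (t, y) ∂(κ t) ∂τ := by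
  have hac : μ.fst ≪ τ := (Measure.absolutelyContinuous_of_le h).trans
    Measure.smul_absolutelyContinuous
  -- The density of the time marginal with respect to `τ`, capped at `C` so that the mass bound
  -- holds for every `t` rather than almost every one.
  set r : ℝ → ℝ≥0 := fun t => (min (μ.fst.rnDeriv τ t) C).toNNReal with hr
  have hrm : Measurable r := ((Measure.measurable_rnDeriv _ _).min measurable_const).ennreal_toNNReal
  have hrC : ∀ t, r t ≤ C := fun t => by
    have : (min (μ.fst.rnDeriv τ t) C).toNNReal ≤ (C : ℝ≥0∞).toNNReal :=
      ENNReal.toNNReal_mono ENNReal.coe_ne_top (min_le_right _ _)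
    simpa using this
  have hle : ∀ᵐ t ∂τ, μ.fst.rnDeriv τ t ≤ C := by
    refine ae_le_of_forall_setLIntegral_le_of_sigmaFinite (Measure.measurable_rnDeriv _ _) fun s hs _ => ?_
    rw [Measure.setLIntegral_rnDeriv hac, setLIntegral_const]
    exact h s
  have hre : ∀ᵐ t ∂τ, (r t : ℝ≥0∞) = μ.fst.rnDeriv τ t := by
    filter_upwards [hle] with t ht
    rw [hr, ENNReal.coe_toNNReal (ne_top_of_le_ne_top ENNReal.coe_ne_top (min_le_right _ _)),
      min_eq_left ht]
  have hμ : μ.fst = τ.withDensity fun t => (r t : ℝ≥0∞) := by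
    rw [withDensity_congr_ae hre, Measure.withDensity_rnDeriv_eq _ _ hac]
  have hu : Measurable (Function.uncurry fun (t : ℝ) (_ : X) => (r t : ℝ≥0∞)) :=
    (hrm.comp measurable_fst).coe_nnreal_ennreal
  have hk : ∀ t, μ.condKernel.withDensity (fun t _ => (r t : ℝ≥0∞)) t =
      (r t : ℝ≥0∞) • μ.condKernel t := fun t => by
    rw [ProbabilityTheory.Kernel.withDensity_apply _ hu, withDensity_const]
  -- The conditional probabilities given `t`, rescaled by the density of the marginal, disintegrate
  -- `μ` with respect to `τ`.
  refine ⟨μ.condKernel.withDensity fun t _ => (r t : ℝ≥0∞), fun t => ?_, fun F hF => ?_⟩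
  · rw [hk]
    simpa using hrC t
  · simp only [hk]
    conv_lhs => rw [← μ.disintegrate μ.condKernel]
    rw [Measure.integral_compProd (by rwa [μ.disintegrate μ.condKernel])]
    conv_lhs => rw [hμ]
    rw [integral_withDensity_eq_integral_smul hrm]
    refine integral_congr_ae (.of_forall fun t => ?_)
    simp only [integral_smul_measure]
    simp [NNReal.smul_def]

end TimeMeasures

/-! ### Extraction of a convergent subsequence. -/

section Extraction

variable {X : Type*} [MeasureSpace X] [SFinite (volume : Measure X)] [NormedAddCommGroup X]
  [ProperSpace X] [SecondCountableTopology X] [BorelSpace X]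

theorem PairingTendsto.congr_ae {T : ℝ} {φ : ℝ → X → ℂ} {w w' : ℕ → ℝ → X → ℂ}
    {μ : ℝ → Measure X} (h : PairingTendsto T φ w μ)
    (hw : ∀ n, ∀ᵐ t ∂(timeMeasure T), ∀ y, w n t y = w' n t y) : PairingTendsto T φ w' μ := by
  refine ⟨fun n => (h.1 n).congr ?_, h.2.congr fun n => integral_congr_ae ?_⟩
  · filter_upwards [Measure.quasiMeasurePreserving_fst.ae (hw n)] with p hp
    rw [hp]
  · filter_upwards [hw n] with t ht
    simp only [ht]

/-- A sequence of nonnegative densities with bounded mass has a weakly convergent subsequence. -/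
theorem exists_pairingTendsto_subseq {T : ℝ} {H : ℕ → ℝ → X → ℝ} {C : ℝ≥0}
    (hm : ∀ n, Measurable (fun p : ℝ × X => H n p.1 p.2)) (h0 : ∀ n t y, 0 ≤ H n t y)
    (hC : ∀ n t, ∫⁻ y, ENNReal.ofReal (H n t y) ≤ C) :
    ∃ (θ : ℕ → ℕ) (κ : ProbabilityTheory.Kernel ℝ X), StrictMono θ ∧ (∀ t, κ t univ ≤ C) ∧
      ∀ φ : ℝ → C₀(X, ℂ), Integrable φ (timeMeasure T) →
        PairingTendsto T (fun t y => φ t y) (fun n t y => (H (θ n) t y : ℂ)) κ := by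
  -- Time is treated as one more variable: compactness is applied to the measures on the product,
  -- and the bound on the slices becomes a bound on the time marginals.
  let ν : ℕ → Measure (ℝ × X) := fun n =>
    ((timeMeasure T).prod volume).withDensity fun p => ENNReal.ofReal (H n p.1 p.2)
  have hfst : ∀ n, (ν n).fst ≤ C • timeMeasure T := fun n => by
    refine Measure.le_intro fun A hA _ => ?_
    rw [Measure.fst_apply hA, withDensity_apply _ (measurable_fst hA), ← prod_univ,
      ← Measure.prod_restrict, Measure.restrict_univ, lintegral_prod _ (hm n).ennreal_ofReal.aemeasurable]
    exact (lintegral_mono (hC n)).trans_eq (by rw [setLIntegral_const]; rfl)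
  have hmass : ∀ n, ν n univ ≤ (C * (timeMeasure T univ).toNNReal : ℝ≥0) := fun n => by
    have := hfst n univ
    rw [Measure.fst_univ] at this
    refine this.trans_eq ?_
    rw [ENNReal.coe_mul, ENNReal.coe_toNNReal (measure_ne_top _ _)]
    rfl
  have hfin : ∀ n, IsFiniteMeasure (ν n) := fun n => ⟨(hmass n).trans_lt ENNReal.coe_lt_top⟩
  obtain ⟨θ, μ, hθ, hμ, hlim⟩ := exists_vague_limit hmass
  have hμfst : μ.fst ≤ C • timeMeasure T := fst_le_of_vague (fun n => hfst (θ n)) hlim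
  obtain ⟨κ, hκ, hκi⟩ := exists_kernel_of_fst_le hμfst
  have hκf : ProbabilityTheory.IsFiniteKernel κ := ⟨C, ENNReal.coe_lt_top, hκ⟩
  refine ⟨θ, κ, hθ, hκ, fun φ hφ => pairingTendsto_of_tensor (C := C) (fun n =>
    (Complex.measurable_ofReal.comp (hm (θ n))).aestronglyMeasurable) (fun n => .of_forall fun t => ?_)
    (.of_forall hκ) (fun A hA b hb => ?_) hφ⟩
  · refine le_trans (le_of_eq (lintegral_congr fun y => ?_)) (hC (θ n) t)
    rw [← ofReal_norm, Complex.norm_real, Real.norm_of_nonneg (h0 _ _ _)]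
  -- The tensor `1_A(t) b(y)` has a merely integrable time factor, which the domination of the
  -- marginals permits.
  · have e : ∀ t y, A.indicator (fun _ => b) t y = A.indicator (fun _ => (1 : ℂ)) t * b y := by
      intro t y
      by_cases ht : t ∈ A <;> simp [ht]
    have ha : Integrable (A.indicator fun _ => (1 : ℂ)) (C • timeMeasure T) :=
      (integrable_const 1).indicator hA
    have key := tendsto_integral_fst_mul (fun n => hfst (θ n)) hμfst hlim ha hb
    rw [hκi _ (integrable_fst_mul hμfst ha b)] at key
    simp only [e]
    refine key.congr fun n => ?_
    have hi := integrable_fst_mul (hfst (θ n)) ha b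
    have hd := integral_withDensity_eq_integral_toReal_smul (μ := (timeMeasure T).prod volume)
      (hm (θ n)).ennreal_ofReal (.of_forall fun _ => ENNReal.ofReal_lt_top)
      (fun p : ℝ × X => A.indicator (fun _ => (1 : ℂ)) p.1 * b p.2)
    have hi' := (integrable_withDensity_iff_integrable_smul' (hm (θ n)).ennreal_ofReal
      (.of_forall fun _ => ENNReal.ofReal_lt_top)).1 hi
    change ∫ p, _ ∂(ν (θ n)) = _
    rw [hd, integral_prod _ hi']
    refine integral_congr_ae (.of_forall fun t => integral_congr_ae (.of_forall fun y => ?_))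
    simp only [ENNReal.toReal_ofReal (h0 _ _ _), Complex.real_smul]
    ring

end Extraction

/-! ### Existence of a Wigner measure. -/

section Existence

variable {d : ℕ}

theorem exists_isWignerMeasure {T : ℝ} {f : ℝ → ℝ → Eu d → ℂ} (hf : BoundedFamily T f) :
    ∃ (ε : ℕ → ℝ) (W : ProbabilityTheory.Kernel ℝ (Eu d × Eu d)), IsWignerMeasure T f ε W := by
  obtain ⟨C, hC⟩ := hf.exists_bound
  let e : ℕ → ℝ := fun n => 1 / ((n : ℝ) + 1)
  have he : ∀ n, 0 < e n := fun n => by positivity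
  have hrep := fun n => exists_representative (hf.1 (e n) (he n)) (hC (e n) (he n))
  choose u hum hu hfu using hrep
  obtain ⟨θ, W, hθ, hW, hlim⟩ := exists_pairingTendsto_subseq (X := Eu d × Eu d) (T := T)
    (H := fun n t y => husimiDensity (e n) (u n t) y.1 y.2) (C := C)
    (fun n => measurable_husimiDensity (e n) (hum n))
    (fun n t y => husimiDensity_nonneg (he n) _ _ _) fun n t => by
      have := (lintegral_husimiDensity_mass (he n) (hu n t).1).trans_le (hu n t).2
      simpa using this
  -- The subsequence was extracted for everywhere defined representatives; the statement returns to
  -- the original family for a.e. `t`.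
  have hH : ∀ φ : ℝ → C₀(Eu d × Eu d, ℂ), Integrable φ (timeMeasure T) →
      PairingTendsto T (fun t y => φ t y)
        (fun n t y => husimi (e (θ n)) (f (e (θ n)) t) y.1 y.2) W := by
    refine fun φ hφ => (hlim φ hφ).congr_ae fun n => ?_
    filter_upwards [hfu (θ n)] with t ht y
    rw [husimi_congr_ae (he _) ht, husimi_eq (he _) (hu _ t).1]
  have hlim0 : Tendsto (fun n => e (θ n)) atTop (𝓝 0) :=
    tendsto_one_div_add_atTop_nhds_zero_nat.comp hθ.tendsto_atTop
  exact ⟨fun n => e (θ n), W, {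
    eps_pos := fun n => he _
    eps_tendsto := hlim0
    bounded := ⟨C, hW⟩
    wigner_tendsto := fun p q _ _ hpq φ ψ h => wigner_tendsto_of_husimi_tendsto hf (fun n => he _)
      hlim0 hH h.1 (integrable_of_holderConjugate hpq h.2)
    husimi_tendsto := fun p _ _ => weakTendsto_of_forall hH p }⟩

end Existence

/-! ### Weak convergence with an unbounded weight. -/

section WeightedPairings

variable {X : Type*} [MeasureSpace X] [SFinite (volume : Measure X)] [NormedAddCommGroup X]
  [ProperSpace X] [SecondCountableTopology X] [BorelSpace X]

theorem memLp_indicator_const {T : ℝ} {F : Type*} [NormedAddCommGroup F] {A : Set ℝ}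
    (hA : MeasurableSet A) (b : F) (q : ℝ≥0∞) :
    MemLp (A.indicator fun _ => b) q (timeMeasure T) :=
  (memLp_const b).indicator hA

/-- Weak convergence of `m w_n`, for a continuous weight `m` with bounded moments. -/
theorem weighted_pairingTendsto {T : ℝ} {w : ℕ → ℝ → X → ℂ} {κ : ProbabilityTheory.Kernel ℝ X}
    [ProbabilityTheory.IsFiniteKernel κ] {C : ℝ≥0} {m : X → ℝ} (hmc : Continuous m)
    (hm0 : ∀ y, 0 ≤ m y)
    (hm : ∀ n, AEStronglyMeasurable (fun p : ℝ × X => w n p.1 p.2) ((timeMeasure T).prod volume))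
    (hw : ∀ n, ∀ᵐ t ∂(timeMeasure T), ∫⁻ y, ENNReal.ofReal (m y) * ‖w n t y‖ₑ ≤ C)
    (hκ : ∀ᵐ t ∂(timeMeasure T), ∫⁻ y, ENNReal.ofReal (m y) ∂(κ t) ≤ C)
    (h : ∀ φ : ℝ → C₀(X, ℂ), Integrable φ (timeMeasure T) →
      PairingTendsto T (fun t y => φ t y) w κ)
    {φ : ℝ → C₀(X, ℂ)} (hφ : Integrable φ (timeMeasure T)) :
    PairingTendsto T (fun t y => φ t y) (fun n t y => (m y : ℂ) * w n t y)
      (fun t => (κ t).withDensity fun y => ENNReal.ofReal (m y)) := by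
  have hu : Measurable (Function.uncurry fun (_ : ℝ) (y : X) => ENNReal.ofReal (m y)) :=
    (hmc.measurable.comp measurable_snd).ennreal_ofReal
  have hk : ∀ t, κ.withDensity (fun _ y => ENNReal.ofReal (m y)) t =
      (κ t).withDensity fun y => ENNReal.ofReal (m y) := fun t =>
    ProbabilityTheory.Kernel.withDensity_apply _ hu t
  have hs : ProbabilityTheory.IsSFiniteKernel (κ.withDensity fun _ y => ENNReal.ofReal (m y)) :=
    ProbabilityTheory.Kernel.IsSFiniteKernel.withDensity κ fun _ _ => ENNReal.ofReal_ne_top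
  have hm' : ∀ n, AEStronglyMeasurable (fun p : ℝ × X => (m p.2 : ℂ) * w n p.1 p.2)
      ((timeMeasure T).prod volume) := fun n =>
    ((Complex.continuous_ofReal.comp (hmc.comp continuous_snd)).aestronglyMeasurable).mul (hm n)
  have hw' : ∀ n, ∀ᵐ t ∂(timeMeasure T), ∫⁻ y, ‖(m y : ℂ) * w n t y‖ₑ ≤ C := fun n => by
    filter_upwards [hw n] with t ht
    refine le_trans (le_of_eq (lintegral_congr fun y => ?_)) ht
    rw [enorm_mul, ← ofReal_norm, Complex.norm_real, Real.norm_of_nonneg (hm0 y)]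
  have hκ' : ∀ᵐ t ∂(timeMeasure T), κ.withDensity (fun _ y => ENNReal.ofReal (m y)) t univ ≤ C := by
    filter_upwards [hκ] with t ht
    rw [hk, withDensity_apply _ MeasurableSet.univ, Measure.restrict_univ]
    exact ht
  have key := pairingTendsto_of_tensor (w := fun n t y => (m y : ℂ) * w n t y) hm' hw' hκ'
    (fun A hA b hb => ?_) hφ
  · rwa [show ⇑(κ.withDensity fun _ y => ENNReal.ofReal (m y)) = _ from funext hk] at key
  · have hmb : Continuous fun y => (m y : ℂ) * b y :=
      (Complex.continuous_ofReal.comp hmc).mul b.continuous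
    -- Since `b` has compact support, `m b` is again in `C₀` even though `m` is unbounded, so the
    -- unweighted convergence applies to it.
    let B : C₀(X, ℂ) := ⟨⟨fun y => (m y : ℂ) * b y, hmb⟩,
      (HasCompactSupport.mul_left hb).is_zero_at_infty⟩
    have hB : ∀ y, B y = (m y : ℂ) * b y := fun _ => rfl
    have hI : ∀ t y, A.indicator (fun _ => B) t y = (m y : ℂ) * A.indicator (fun _ => b) t y := by
      intro t y
      by_cases ht : t ∈ A <;> simp [ht, hB]
    have := (h (A.indicator fun _ => B) (memLp_one_iff_integrable.1
      (memLp_indicator_const hA B 1))).2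
    simp only [hI] at this
    simp only [hk]
    have e : ∀ t, ∫ y, A.indicator (fun _ => b) t y ∂(κ t).withDensity
        (fun y => ENNReal.ofReal (m y)) = ∫ y, (m y : ℂ) * A.indicator (fun _ => b) t y ∂(κ t) := by
      intro t
      rw [integral_withDensity_eq_integral_toReal_smul hmc.measurable.ennreal_ofReal
        (.of_forall fun _ => ENNReal.ofReal_lt_top)]
      simp only [ENNReal.toReal_ofReal (hm0 _), Complex.real_smul]
    simp only [e]
    refine this.congr fun n => ?_
    refine integral_congr_ae (.of_forall fun t => integral_congr_ae (.of_forall fun y => ?_))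
    simp only []
    ring

end WeightedPairings

/-! ### The `x`-marginal of the Husimi transform. -/

section MarginalOfHusimi

variable {d : ℕ}

theorem integral_husimiDensity_slice {ε : ℝ} (hε : 0 < ε) {g : Eu d → ℂ} (hg : MemLp g 2)
    (x : Eu d) : ∫ ξ, husimiDensity ε g x ξ = ∫ a, ‖g a‖ ^ 2 * gaussian ε (x - a) := by
  have hm : AEStronglyMeasurable (fun a => ‖g a‖ ^ 2 * gaussian ε (x - a)) :=
    (hg.1.norm.pow 2).mul
      ((continuous_gaussian ε).comp (continuous_const.sub continuous_id)).aestronglyMeasurable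
  rw [integral_eq_lintegral_of_nonneg_ae (.of_forall fun ξ => husimiDensity_nonneg hε g _ _)
    ((measurable_husimiDensity_of_aestronglyMeasurable ε hg.1).comp
      measurable_prodMk_left).aestronglyMeasurable,
    integral_eq_lintegral_of_nonneg_ae
      (.of_forall fun a => mul_nonneg (by positivity) (gaussian_nonneg hε _)) hm,
    lintegral_husimiDensity_slice hε hg]
  congr 1
  refine lintegral_congr fun a => ?_
  rw [ENNReal.ofReal_mul (by positivity), ENNReal.ofReal_pow (norm_nonneg _), ofReal_norm]

theorem integral_fst_mul_husimiDensity {ε : ℝ} (hε : 0 < ε) {g : Eu d → ℂ} (hg : MemLp g 2)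
    (b : C₀(Eu d, ℂ)) :
    ∫ y : Eu d × Eu d, b y.1 * (husimiDensity ε g y.1 y.2 : ℂ) =
      ∫ a, ((‖g a‖ ^ 2 : ℝ) : ℂ) * ∫ x, b x * (gaussian ε (x - a) : ℂ) := by
  have hg2 : Integrable (fun a => ‖g a‖ ^ 2) := hg.integrable_norm_pow two_ne_zero
  have hi : Integrable (fun y : Eu d × Eu d => b y.1 * (husimiDensity ε g y.1 y.2 : ℂ)) :=
    (integrable_husimiDensity hε hg).ofReal.bdd_mul (c := ‖b‖)
      (b.continuous.comp continuous_fst).aestronglyMeasurable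
      (.of_forall fun y => C0_norm_coe_le b y.1)
  have hsh : Integrable (fun p : Eu d × Eu d => ‖g p.2‖ ^ 2 * gaussian ε (p.1 - p.2))
      (volume.prod volume) := by
    have := ((integrable_gaussian (d := d) hε).mul_prod hg2)
    have hmp : MeasurePreserving (fun p : Eu d × Eu d => (p.1 - p.2, p.2))
        (volume.prod volume) (volume.prod volume) := measurePreserving_sub_prod volume volume
    have h2 := hmp.integrable_comp_of_integrable this
    refine h2.congr (.of_forall fun p => ?_)
    simp only [Function.comp]
    ring
  have hF : Integrable (fun p : Eu d × Eu d => b p.1 * ((‖g p.2‖ ^ 2 * gaussian ε (p.1 - p.2) : ℝ) : ℂ))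
      (volume.prod volume) :=
    hsh.ofReal.bdd_mul (c := ‖b‖) (b.continuous.comp continuous_fst).aestronglyMeasurable
      (.of_forall fun y => C0_norm_coe_le b y.1)
  rw [Measure.volume_eq_prod, integral_prod _ hi]
  simp only [integral_const_mul, integral_complex_ofReal, integral_husimiDensity_slice hε hg]
  have e : ∀ x, b x * ((∫ a, ‖g a‖ ^ 2 * gaussian ε (x - a) : ℝ) : ℂ) =
      ∫ a, b x * ((‖g a‖ ^ 2 * gaussian ε (x - a) : ℝ) : ℂ) := fun x => by
    rw [integral_const_mul, integral_complex_ofReal]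
  simp only [e]
  rw [integral_integral_swap hF]
  refine integral_congr_ae (.of_forall fun a => ?_)
  simp only
  rw [← integral_const_mul]
  refine integral_congr_ae (.of_forall fun x => ?_)
  simp only
  push_cast
  ring

/-- The marginal is `|g|² * γ_ε`, and the Gaussian moved onto `b` costs at most its modulus times
the mass. -/
theorem norm_integral_fst_mul_husimi_sub_le {ε : ℝ} (hε : 0 < ε) {g : Eu d → ℂ} (hg : MemLp g 2)
    {C : ℝ≥0} (hC : ∫⁻ x, ‖g x‖ₑ ^ 2 ≤ C) (b : C₀(Eu d, ℂ)) :
    ‖(∫ x, b x * ((‖g x‖ ^ 2 : ℝ) : ℂ)) - ∫ y : Eu d × Eu d, b y.1 * husimi ε g y.1 y.2‖ ≤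
      gaussianModulus ε b * C := by
  have hg2 : Integrable (fun a => ‖g a‖ ^ 2) := hg.integrable_norm_pow two_ne_zero
  simp only [husimi_eq hε hg]
  rw [integral_fst_mul_husimiDensity hε hg]
  have h1 : Integrable (fun x => b x * ((‖g x‖ ^ 2 : ℝ) : ℂ)) :=
    hg2.ofReal.bdd_mul (c := ‖b‖) b.continuous.aestronglyMeasurable
      (.of_forall (C0_norm_coe_le b))
  have hm : AEStronglyMeasurable (fun a => ∫ x, b x * (gaussian ε (x - a) : ℂ)) := by
    refine AEStronglyMeasurable.integral_prod_right' (f := fun p : Eu d × Eu d =>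
      b p.2 * (gaussian ε (p.2 - p.1) : ℂ)) ?_
    have := continuous_gaussian (d := d) ε
    exact Continuous.aestronglyMeasurable (by fun_prop)
  have h2 : Integrable (fun a => ((‖g a‖ ^ 2 : ℝ) : ℂ) * ∫ x, b x * (gaussian ε (x - a) : ℂ)) := by
    refine hg2.ofReal.mul_bdd (c := ‖b‖) hm (.of_forall fun a => ?_)
    refine (norm_integral_le_of_norm_le (((integrable_gaussian hε).comp_sub_right a).const_mul ‖b‖)
      (.of_forall fun x => ?_)).trans_eq ?_
    · rw [norm_mul, Complex.norm_real, Real.norm_of_nonneg (gaussian_nonneg hε _)]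
      exact mul_le_mul_of_nonneg_right (C0_norm_coe_le b x) (gaussian_nonneg hε _)
    · rw [integral_const_mul, integral_gaussian_sub hε, mul_one]
  rw [← integral_sub h1 h2]
  refine (norm_integral_le_of_norm_le (hg2.const_mul (gaussianModulus ε b))
    (.of_forall fun a => ?_)).trans ?_
  · rw [mul_comm (b a), ← mul_sub, norm_mul, Complex.norm_real, Real.norm_of_nonneg (by positivity),
      mul_comm]
    exact mul_le_mul_of_nonneg_right (le_gaussianModulus hε b a) (by positivity)
  · rw [integral_const_mul]
    exact mul_le_mul_of_nonneg_left (integral_norm_sq_le hg hC) (gaussianModulus_nonneg ε b)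

end MarginalOfHusimi

/-! ### Moment bounds for a.e. time. -/

section Moments

variable {d : ℕ} {T : ℝ}

theorem normLinfL2_const_smul (ε : ℝ) (g : ℝ → Eu d → EuclideanSpace ℂ (Fin d)) :
    normLinfL2 T (fun t x => ε • g t x) = ‖ε‖ₑ * normLinfL2 T g := by
  rw [normLinfL2, normLinfL2, ← ENNReal.essSup_const_mul]
  congr 1
  ext t
  exact eLpNorm_const_smul ε (g t) 2 volume

theorem ofReal_sq_mul_normLinfL2_sq (ε : ℝ) (g : ℝ → Eu d → EuclideanSpace ℂ (Fin d)) :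
    ENNReal.ofReal (ε ^ 2) * normLinfL2 T g ^ 2 = normLinfL2 T (fun t x => ε • g t x) ^ 2 := by
  rw [normLinfL2_const_smul, mul_pow, ← ofReal_norm, ← ENNReal.ofReal_pow (norm_nonneg _),
    Real.norm_eq_abs, sq_abs]

theorem ae_lintegral_husimi_moment {ε : ℝ} (hε : 0 < ε) {g : ℝ → Eu d → ℂ} {C : ℝ≥0}
    (hm : AEStronglyMeasurable (fun p : ℝ × Eu d => g p.1 p.2) ((timeMeasure T).prod volume))
    (hC : ∀ᵐ t ∂(timeMeasure T), ∫⁻ x, ‖g t x‖ₑ ^ 2 ≤ C) :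
    ∀ᵐ t ∂(timeMeasure T),
      ∫⁻ y : Eu d × Eu d, ENNReal.ofReal (‖y.1‖ ^ 2) * ‖husimi ε (g t) y.1 y.2‖ₑ ≤
        normLinfL2 T (fun t x => ‖x‖ • g t x) ^ 2 + ENNReal.ofReal ε * (gaussianMoment d * C) := by
  filter_upwards [ae_memLp hm hC, hC, ae_eLpNorm_le (T := T) fun t x => ‖x‖ • g t x] with t h1 h2 h3
  rw [lintegral_enorm_husimi hε h1]
  simp only [ENNReal.ofReal_pow (norm_nonneg _), ofReal_norm]
  refine (lintegral_husimiDensity_moment hε h1).trans ?_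
  rw [mul_assoc]
  gcongr

theorem ae_lintegral_husimi_xiMoment {ε : ℝ} (hε : 0 < ε) {g : ℝ → Eu d → ℂ}
    {G : ℝ → Eu d → EuclideanSpace ℂ (Fin d)} {C : ℝ≥0}
    (hm : AEStronglyMeasurable (fun p : ℝ × Eu d => g p.1 p.2) ((timeMeasure T).prod volume))
    (hC : ∀ᵐ t ∂(timeMeasure T), ∫⁻ x, ‖g t x‖ₑ ^ 2 ≤ C)
    (hG : ∀ᵐ t ∂(timeMeasure T), HasWeakGradient (g t) (G t)) {K : ℝ≥0}
    (hK : normLinfL2 T (fun t x => ε • G t x) ≤ K) :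
    ∀ᵐ t ∂(timeMeasure T),
      ∫⁻ y : Eu d × Eu d, ENNReal.ofReal (‖y.2‖ ^ 2) * ‖husimi ε (g t) y.1 y.2‖ₑ ≤
        ENNReal.ofReal (ε ^ 2) * normLinfL2 T G ^ 2 +
          ENNReal.ofReal ε * (gaussianMoment d * C) := by
  -- As `ε ≠ 0`, the bound on `ε G` makes the norm of `G` finite, which places `G t` in `L²` for
  -- a.e. `t`.
  have hfin : normLinfL2 T G ≠ ⊤ := by
    intro h
    rw [normLinfL2_const_smul, h, ENNReal.mul_top (by simpa using hε.ne')] at hK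
    simp at hK
  lift normLinfL2 T G to ℝ≥0 using hfin with N hN
  filter_upwards [ae_memLp hm hC, hC, hG, ae_eLpNorm_le (T := T) G] with t h1 h2 h3 h4
  rw [← hN] at h4
  have hG2 : MemLp (G t) 2 :=
    memLp_two_of_lintegral (C := N ^ 2) h3.2.1.aestronglyMeasurable (by simpa using h4)
  rw [lintegral_enorm_husimi hε h1]
  simp only [ENNReal.ofReal_pow (norm_nonneg _), ofReal_norm]
  refine (lintegral_husimiDensity_xiMoment hε h3 h1 hG2).trans ?_
  rw [mul_assoc (ENNReal.ofReal ε)]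
  gcongr

/-- Removes the contribution of the Gaussian's own second moment, so that the final inequalities
hold with no extra constant. -/
theorem liminf_add_ofReal_mul {ε : ℕ → ℝ} (hlim : Tendsto ε atTop (𝓝 0)) (A : ℕ → ℝ≥0∞) (K : ℝ≥0) :
    liminf (fun n => A n + ENNReal.ofReal (ε n) * K) atTop = liminf A atTop := by
  refine ENNReal.liminf_add_of_right_tendsto_zero ?_ A
  have := ENNReal.Tendsto.mul_const (b := K) (ENNReal.tendsto_ofReal hlim) (Or.inr ENNReal.coe_ne_top)
  simpa using this

end Moments

/-! ### Consequences for an arbitrary Wigner measure of the family. -/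

section Limit

variable {d : ℕ} {T : ℝ} {f : ℝ → ℝ → Eu d → ℂ} {ε : ℕ → ℝ}
  {W : ProbabilityTheory.Kernel ℝ (Eu d × Eu d)}

theorem IsWignerMeasure.isFiniteKernel (h : IsWignerMeasure T f ε W) :
    ProbabilityTheory.IsFiniteKernel W := by
  obtain ⟨C, hC⟩ := h.bounded
  exact ⟨C, ENNReal.coe_lt_top, hC⟩

/-- The assumed convergence is used only at the exponent `2`, on tensors `1_A(t) b`, and density
recovers all of `L¹(0, T; C₀)`. This is how the endpoint `p = ∞` becomes available. -/
theorem IsWignerMeasure.pairingTendsto (h : IsWignerMeasure T f ε W) (hf : BoundedFamily T f)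
    {φ : ℝ → C₀(Eu d × Eu d, ℂ)} (hφ : Integrable φ (timeMeasure T)) :
    PairingTendsto T (fun t y => φ t y) (fun n t y => husimi (ε n) (f (ε n) t) y.1 y.2) W := by
  have := h.isFiniteKernel
  obtain ⟨C, hC⟩ := hf.exists_bound
  obtain ⟨D, hD⟩ := h.bounded
  refine pairingTendsto_of_tensor (C := C + D)
    (fun n => aestronglyMeasurable_husimi (h.eps_pos n) (hf.1 _ (h.eps_pos n)) (hC _ (h.eps_pos n)))
    (fun n => ?_) (.of_forall fun t => (hD t).trans (by simp)) (fun A hA b _ => ?_) hφ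
  · filter_upwards [lintegral_enorm_husimi_le (h.eps_pos n) (hf.1 _ (h.eps_pos n))
      (hC _ (h.eps_pos n))] with t ht
    exact ht.trans (by simp)
  · have hφ2 : MemLp (A.indicator fun _ => b) 2 (timeMeasure T) := memLp_indicator_const hA b 2
    exact (h.husimi_tendsto 2 (by norm_num) (by simp) 2 inferInstance (A.indicator fun _ => b)
      (fun y => (continuous_C0_eval.comp (continuous_id.prodMk continuous_const)
        ).comp_aestronglyMeasurable (g := fun c : C₀(Eu d × Eu d, ℂ) => c y) hφ2.1) hφ2.norm).2

/-- Lower semicontinuity of moments, for the Husimi transforms. -/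
theorem IsWignerMeasure.lintegral_le_liminf (h : IsWignerMeasure T f ε W) (hf : BoundedFamily T f)
    {m : Eu d × Eu d → ℝ} (hmc : Continuous m) (hm0 : ∀ y, 0 ≤ m y) {A : ℕ → ℝ≥0∞} {K : ℝ≥0}
    (hA : ∀ n, ∀ᵐ t ∂(timeMeasure T), ∫⁻ y : Eu d × Eu d, ENNReal.ofReal (m y) *
      ‖husimi (ε n) (f (ε n) t) y.1 y.2‖ₑ ≤ A n + ENNReal.ofReal (ε n) * K) :
    ∀ᵐ t ∂(timeMeasure T), ∫⁻ y, ENNReal.ofReal (m y) ∂(W t) ≤ liminf A atTop := by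
  have := h.isFiniteKernel
  obtain ⟨C, hC⟩ := hf.exists_bound
  obtain ⟨D, hD⟩ := h.bounded
  have hL : ∀ n, ∀ᵐ t ∂(timeMeasure T), MemLp (f (ε n) t) 2 := fun n =>
    ae_memLp (hf.1 _ (h.eps_pos n)) (hC _ (h.eps_pos n))
  have key := lintegral_le_liminf_of_pairingTendsto (κ := W) (C := D)
    (H := fun n t (y : Eu d × Eu d) => husimiDensity (ε n) (f (ε n) t) y.1 y.2)
    (.of_forall hD) (fun φ hφ => (h.pairingTendsto hf hφ).congr_ae fun n => ?_) hmc hm0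
    (B := fun n => A n + ENNReal.ofReal (ε n) * K) fun n => ?_
  · rwa [liminf_add_ofReal_mul h.eps_tendsto] at key
  · filter_upwards [hL n] with t ht y
    exact husimi_eq (h.eps_pos n) ht _ _
  · filter_upwards [hL n, hA n] with t ht h2
    refine le_trans (le_of_eq (lintegral_congr fun y => ?_)) h2
    rw [husimi_eq (h.eps_pos n) ht, ← ofReal_norm, ← ofReal_norm, Complex.norm_real]

/-- The uniform bounds used in the limit of the Husimi transforms. -/
structure UniformBounds (T : ℝ) (f : ℝ → ℝ → Eu d → ℂ) (ε : ℕ → ℝ)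
    (W : ProbabilityTheory.Kernel ℝ (Eu d × Eu d)) (C : ℝ≥0) : Prop where
  mass : ∀ n, ∀ᵐ t ∂(timeMeasure T), ∫⁻ x, ‖f (ε n) t x‖ₑ ^ 2 ≤ C
  momentL2 : ∀ n, ∀ᵐ t ∂(timeMeasure T), ∫⁻ x, ‖‖x‖ • f (ε n) t x‖ₑ ^ 2 ≤ C
  xMoment : ∀ n, ∀ᵐ t ∂(timeMeasure T), ∫⁻ y : Eu d × Eu d, ENNReal.ofReal (‖y.1‖ ^ 2) *
    ‖husimi (ε n) (f (ε n) t) y.1 y.2‖ₑ ≤ C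
  xiMoment : ∀ n, ∀ᵐ t ∂(timeMeasure T), ∫⁻ y : Eu d × Eu d, ENNReal.ofReal (‖y.2‖ ^ 2) *
    ‖husimi (ε n) (f (ε n) t) y.1 y.2‖ₑ ≤ C
  limit_mass : ∀ t, W t univ ≤ C
  limit_xMoment : ∀ᵐ t ∂(timeMeasure T), ∫⁻ y, ENNReal.ofReal (‖y.1‖ ^ 2) ∂(W t) ≤ C
  limit_xiMoment : ∀ᵐ t ∂(timeMeasure T), ∫⁻ y, ENNReal.ofReal (‖y.2‖ ^ 2) ∂(W t) ≤ C

theorem IsWignerMeasure.xMoment_le_liminf (h : IsWignerMeasure T f ε W) (hf : BoundedFamily T f) :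
    ∀ᵐ t ∂(timeMeasure T), ∫⁻ y, ENNReal.ofReal (‖y.1‖ ^ 2) ∂(W t) ≤
      liminf (fun n => normLinfL2 T (fun t x => ‖x‖ • f (ε n) t x) ^ 2) atTop := by
  obtain ⟨C, hC⟩ := hf.exists_bound
  refine h.lintegral_le_liminf hf (m := fun y => ‖y.1‖ ^ 2) (by fun_prop) (fun y => by positivity)
    (K := gaussianMoment d * C) fun n => ?_
  simpa using ae_lintegral_husimi_moment (h.eps_pos n) (hf.1 _ (h.eps_pos n)) (hC _ (h.eps_pos n))

theorem IsWignerMeasure.xiMoment_le_liminf (h : IsWignerMeasure T f ε W)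
    {Df : ℝ → ℝ → Eu d → EuclideanSpace ℂ (Fin d)} (hM : MomentBounds T f Df) :
    ∀ᵐ t ∂(timeMeasure T), ∫⁻ y, ENNReal.ofReal (‖y.2‖ ^ 2) ∂(W t) ≤
      liminf (fun n => ENNReal.ofReal (ε n ^ 2) * normLinfL2 T (Df (ε n)) ^ 2) atTop := by
  obtain ⟨hf, hG, -, K, hK⟩ := hM
  obtain ⟨C, hC⟩ := hf.exists_bound
  refine h.lintegral_le_liminf hf (m := fun y => ‖y.2‖ ^ 2) (by fun_prop) (fun y => by positivity)
    (K := gaussianMoment d * C) fun n => ?_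
  simpa using ae_lintegral_husimi_xiMoment (h.eps_pos n) (hf.1 _ (h.eps_pos n))
    (hC _ (h.eps_pos n)) (hG _ (h.eps_pos n)) (hK _ (h.eps_pos n))

theorem liminf_le_of_forall_le {A : ℕ → ℝ≥0∞} {C : ℝ≥0∞} (h : ∀ n, A n ≤ C) :
    liminf A atTop ≤ C :=
  (liminf_le_liminf (.of_forall h)).trans_eq (by simp)

theorem IsWignerMeasure.exists_uniformBounds (h : IsWignerMeasure T f ε W)
    {Df : ℝ → ℝ → Eu d → EuclideanSpace ℂ (Fin d)} (hM : MomentBounds T f Df) :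
    ∃ C : ℝ≥0, UniformBounds T f ε W C := by
  have hlx := h.xMoment_le_liminf hM.1
  have hlξ := h.xiMoment_le_liminf hM
  obtain ⟨hf, hG, ⟨J, hJ⟩, K, hK⟩ := hM
  obtain ⟨C, hC⟩ := hf.exists_bound
  obtain ⟨D, hD⟩ := h.bounded
  obtain ⟨E, hE⟩ := h.eps_tendsto.bddAbove_range
  have hEn : ∀ n, ENNReal.ofReal (ε n) ≤ E.toNNReal := fun n =>
    ENNReal.ofReal_le_ofReal (hE ⟨n, rfl⟩)
  -- One constant for all the bounds; the last summand dominates the `O(ε)` corrections, the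
  -- sequence `ε n` being bounded.
  let B : ℝ≥0 := C + D + J ^ 2 + K ^ 2 + E.toNNReal * (gaussianMoment d * C)
  have h0 : ∀ r : ℝ≥0, 0 ≤ r := fun _ => zero_le
  have hE0 := h0 (E.toNNReal * (gaussianMoment d * C))
  have hCB : C ≤ B := by simp only [B]; linarith [h0 D, h0 (J ^ 2), h0 (K ^ 2)]
  have hDB : D ≤ B := by simp only [B]; linarith [h0 C, h0 (J ^ 2), h0 (K ^ 2)]
  have hJB : J ^ 2 + E.toNNReal * (gaussianMoment d * C) ≤ B := by
    simp only [B]; linarith [h0 C, h0 D, h0 (K ^ 2)]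
  have hKB : K ^ 2 + E.toNNReal * (gaussianMoment d * C) ≤ B := by
    simp only [B]; linarith [h0 C, h0 D, h0 (J ^ 2)]
  have hJ1 : J ^ 2 ≤ B := le_trans (by simp) hJB
  have hK1 : K ^ 2 ≤ B := le_trans (by simp) hKB
  have hxn : ∀ n, normLinfL2 T (fun t x => ‖x‖ • f (ε n) t x) ^ 2 ≤ (J ^ 2 : ℝ≥0) := fun n => by
    rw [ENNReal.coe_pow]
    exact pow_le_pow_left₀ zero_le (hJ _ (h.eps_pos n)) 2
  have hξn : ∀ n, ENNReal.ofReal (ε n ^ 2) * normLinfL2 T (Df (ε n)) ^ 2 ≤ (K ^ 2 : ℝ≥0) :=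
    fun n => by
      rw [ofReal_sq_mul_normLinfL2_sq, ENNReal.coe_pow]
      exact pow_le_pow_left₀ zero_le (hK _ (h.eps_pos n)) 2
  refine ⟨B, ?_, ?_, ?_, ?_, ?_, ?_, ?_⟩
  · exact fun n => (hC _ (h.eps_pos n)).mono fun t ht => ht.trans (by exact_mod_cast hCB)
  · intro n
    filter_upwards [ae_eLpNorm_le (T := T) fun t x => ‖x‖ • f (ε n) t x] with t ht
    exact ht.trans ((hxn n).trans (by exact_mod_cast hJ1))
  · intro n
    filter_upwards [ae_lintegral_husimi_moment (h.eps_pos n) (hf.1 _ (h.eps_pos n))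
      (hC _ (h.eps_pos n))] with t ht
    refine ht.trans ((add_le_add (hxn n) (mul_le_mul_left (hEn n) _)).trans ?_)
    exact_mod_cast hJB
  · intro n
    filter_upwards [ae_lintegral_husimi_xiMoment (h.eps_pos n) (hf.1 _ (h.eps_pos n))
      (hC _ (h.eps_pos n)) (hG _ (h.eps_pos n)) (hK _ (h.eps_pos n))] with t ht
    refine ht.trans ((add_le_add (hξn n) (mul_le_mul_left (hEn n) _)).trans ?_)
    exact_mod_cast hKB
  · exact fun t => (hD t).trans (by exact_mod_cast hDB)
  · exact hlx.mono fun t ht => ht.trans ((liminf_le_of_forall_le hxn).trans (by exact_mod_cast hJ1))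
  · exact hlξ.mono fun t ht => ht.trans ((liminf_le_of_forall_le hξn).trans (by exact_mod_cast hK1))

end Limit

/-! ### Narrow convergence of the Husimi transforms and of the density. -/

section StrongConvergence

variable {d : ℕ} {T : ℝ} {f : ℝ → ℝ → Eu d → ℂ} {ε : ℕ → ℝ}
  {W : ProbabilityTheory.Kernel ℝ (Eu d × Eu d)} {C : ℝ≥0}

theorem enorm_sq_le_add (y : Eu d × Eu d) :
    ‖y‖ₑ ^ 2 ≤ ENNReal.ofReal (‖y.1‖ ^ 2) + ENNReal.ofReal (‖y.2‖ ^ 2) := by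
  rw [← ENNReal.ofReal_add (by positivity) (by positivity), ← ofReal_norm,
    ← ENNReal.ofReal_pow (norm_nonneg _)]
  refine ENNReal.ofReal_le_ofReal ?_
  rw [Prod.norm_def]
  rcases max_cases ‖y.1‖ ‖y.2‖ with h | h <;> rw [h.1] <;> nlinarith [sq_nonneg ‖y.1‖, sq_nonneg ‖y.2‖]

/-- The `x`- and `ξ`-moments together bound the moment of the norm of the product space, which is a
maximum; hence the constant `C + C`. -/
theorem IsWignerMeasure.narrow_pairingTendsto (h : IsWignerMeasure T f ε W)
    (hf : BoundedFamily T f) (hB : UniformBounds T f ε W C)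
    {φ : ℝ → (Eu d × Eu d) →ᵇ ℂ} (hφ : ∀ y, AEStronglyMeasurable (fun t => φ t y) (timeMeasure T))
    (hN : Integrable (fun t => ‖φ t‖) (timeMeasure T)) :
    PairingTendsto T (fun t y => φ t y) (fun n t y => husimi (ε n) (f (ε n) t) y.1 y.2) W := by
  have := h.isFiniteKernel
  have h2 : ∀ c : ℝ≥0∞, c ≤ C → c ≤ ((C + C : ℝ≥0) : ℝ≥0∞) := fun c hc => hc.trans (by simp)
  have hm := fun n => hf.1 _ (h.eps_pos n)
  refine SemiclassicalWigner.narrow_pairingTendsto (C := C + C)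
    (fun n => aestronglyMeasurable_husimi (h.eps_pos n) (hm n) (hB.mass n))
    (fun n => (lintegral_enorm_husimi_le (h.eps_pos n) (hm n) (hB.mass n)).mono fun t => h2 _)
    (.of_forall fun t => h2 _ (hB.limit_mass t)) (fun n => ?_)
    (fun φ hφ => h.pairingTendsto hf hφ) hφ hN
  filter_upwards [ae_memLp (hm n) (hB.mass n), hB.xMoment n, hB.xiMoment n] with t h1 h3 h4
  have hmeas : Measurable fun y : Eu d × Eu d => ‖husimi (ε n) (f (ε n) t) y.1 y.2‖ₑ := by
    simp only [husimi_eq (h.eps_pos n) h1]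
    exact (Complex.measurable_ofReal.comp
      (measurable_husimiDensity_of_aestronglyMeasurable (ε n) h1.1)).enorm
  calc _ ≤ ∫⁻ y : Eu d × Eu d,
        (ENNReal.ofReal (‖y.1‖ ^ 2) * ‖husimi (ε n) (f (ε n) t) y.1 y.2‖ₑ +
          ENNReal.ofReal (‖y.2‖ ^ 2) * ‖husimi (ε n) (f (ε n) t) y.1 y.2‖ₑ) := by
        refine lintegral_mono fun y => ?_
        rw [← add_mul]
        exact mul_le_mul_left (enorm_sq_le_add y) _
    _ ≤ ((C + C : ℝ≥0) : ℝ≥0∞) := by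
        rw [lintegral_add_left (by fun_prop), ENNReal.coe_add]
        exact add_le_add h3 h4

theorem aestronglyMeasurable_sq {g : ℝ → Eu d → ℂ}
    (hm : AEStronglyMeasurable (fun p : ℝ × Eu d => g p.1 p.2) ((timeMeasure T).prod volume)) :
    AEStronglyMeasurable (fun p : ℝ × Eu d => ((‖g p.1 p.2‖ ^ 2 : ℝ) : ℂ))
      ((timeMeasure T).prod volume) :=
  Complex.continuous_ofReal.comp_aestronglyMeasurable (hm.norm.pow 2)

theorem enorm_ofReal_sq (z : ℂ) : ‖((‖z‖ ^ 2 : ℝ) : ℂ)‖ₑ = ‖z‖ₑ ^ 2 := by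
  rw [← ofReal_norm, Complex.norm_real, norm_pow, norm_norm, ENNReal.ofReal_pow (norm_nonneg _),
    ofReal_norm]

/-- A function of `x` alone does not vanish as `ξ → ∞`, so narrow convergence of the Husimi
transforms is essential here. Replacing their marginal by `|f|²` costs an error that tends to zero
uniformly in `t`. -/
theorem IsWignerMeasure.tendsto_density_tensor (h : IsWignerMeasure T f ε W)
    (hf : BoundedFamily T f) (hB : UniformBounds T f ε W C) {A : Set ℝ} (hA : MeasurableSet A)
    (b : C₀(Eu d, ℂ)) :
    Tendsto (fun n => ∫ t in Ioo 0 T, ∫ x, A.indicator (fun _ => b) t x *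
      ((‖f (ε n) t x‖ ^ 2 : ℝ) : ℂ)) atTop
      (𝓝 (∫ t in Ioo 0 T, ∫ x, A.indicator (fun _ => b) t x ∂(density (W t)))) := by
  have hm := fun n => hf.1 _ (h.eps_pos n)
  let β : (Eu d × Eu d) →ᵇ ℂ := b.toBCF.compContinuous ⟨Prod.fst, continuous_fst⟩
  have hβ : ∀ y, β y = b y.1 := fun _ => rfl
  let Φ : ℝ → (Eu d × Eu d) →ᵇ ℂ := A.indicator fun _ => β
  have hΦ : ∀ t y, Φ t y = A.indicator (fun _ => b) t y.1 := fun t y => by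
    by_cases ht : t ∈ A <;> simp [Φ, ht, hβ]
  have hΦL : MemLp Φ 1 (timeMeasure T) := memLp_indicator_const hA β 1
  obtain ⟨hI, hT⟩ := h.narrow_pairingTendsto hf hB (φ := Φ)
    (fun y => (continuous_eval_const y).comp_aestronglyMeasurable hΦL.1)
    (memLp_one_iff_integrable.1 hΦL).norm
  have elim : ∀ t, ∫ x, A.indicator (fun _ => b) t x ∂(density (W t)) = ∫ y, Φ t y ∂(W t) := by
    intro t
    simp only [hΦ]
    exact integral_map measurable_fst.aemeasurable
      (A.indicator (fun _ => b) t).continuous.aestronglyMeasurable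
  simp only [elim]
  have hJ : ∀ n, Integrable (fun p : ℝ × Eu d => A.indicator (fun _ => b) p.1 p.2 *
      ((‖f (ε n) p.1 p.2‖ ^ 2 : ℝ) : ℂ)) ((timeMeasure T).prod volume) := fun n => by
    have hL : MemLp (A.indicator fun _ => b) 1 (timeMeasure T) := memLp_indicator_const hA b 1
    refine integrable_of_slice_bound (N := fun t => ‖A.indicator (fun _ => b) t‖ * C)
      (F := fun t x => A.indicator (fun _ => b) t x * ((‖f (ε n) t x‖ ^ 2 : ℝ) : ℂ))
      ((aestronglyMeasurable_C0_uncurry hL.1).mul (aestronglyMeasurable_sq (hm n)))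
      ((memLp_one_iff_integrable.1 hL).norm.mul_const (C : ℝ)) ?_
    filter_upwards [hB.mass n] with t ht
    exact lintegral_C0_mul_le (by simpa only [enorm_ofReal_sq] using ht)
  have hdiff : Tendsto (fun n => (∫ t in Ioo 0 T, ∫ x, A.indicator (fun _ => b) t x *
      ((‖f (ε n) t x‖ ^ 2 : ℝ) : ℂ)) - ∫ t in Ioo 0 T, ∫ y : Eu d × Eu d,
      Φ t y * husimi (ε n) (f (ε n) t) y.1 y.2) atTop (𝓝 0) := by
    have hg : Tendsto (fun n => gaussianModulus (ε n) b * C * (timeMeasure T).real univ)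
        atTop (𝓝 0) := by
      simpa using ((tendsto_gaussianModulus h.eps_pos h.eps_tendsto b).mul_const (C : ℝ)).mul_const
        ((timeMeasure T).real univ)
    refine squeeze_zero_norm (fun n => ?_) hg
    rw [← integral_sub (hJ n).integral_prod_left (hI n).integral_prod_left]
    refine norm_integral_le_of_norm_le_const ?_
    filter_upwards [hB.mass n, ae_memLp (hm n) (hB.mass n)] with t h1 h2
    simp only [hΦ]
    by_cases ht : t ∈ A
    · simp only [indicator_of_mem ht]
      exact norm_integral_fst_mul_husimi_sub_le (h.eps_pos n) h2 h1 b
    · simpa [indicator_of_notMem ht] using mul_nonneg (gaussianModulus_nonneg (ε n) b) C.2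
  simpa using hdiff.add hT

/-- Tensors give weak convergence, and tightness of `|f|²` comes directly from the bound on `x f`.
-/
theorem IsWignerMeasure.density_pairingTendsto (h : IsWignerMeasure T f ε W)
    (hf : BoundedFamily T f) (hB : UniformBounds T f ε W C)
    {φ : ℝ → Eu d →ᵇ ℂ} (hφ : ∀ y, AEStronglyMeasurable (fun t => φ t y) (timeMeasure T))
    (hN : Integrable (fun t => ‖φ t‖) (timeMeasure T)) :
    PairingTendsto T (fun t y => φ t y) (fun n t x => ((‖f (ε n) t x‖ ^ 2 : ℝ) : ℂ))
      (fun t => density (W t)) := by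
  have := h.isFiniteKernel
  have hk : ⇑(W.map Prod.fst) = fun t => density (W t) := funext fun t =>
    ProbabilityTheory.Kernel.map_apply _ measurable_fst t
  have hm := fun n => aestronglyMeasurable_sq (hf.1 _ (h.eps_pos n))
  have hw : ∀ n, ∀ᵐ t ∂(timeMeasure T), ∫⁻ x, ‖((‖f (ε n) t x‖ ^ 2 : ℝ) : ℂ)‖ₑ ≤ C := fun n => by
    simpa only [enorm_ofReal_sq] using hB.mass n
  have hκ : ∀ᵐ t ∂(timeMeasure T), W.map Prod.fst t univ ≤ C := .of_forall fun t => by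
    rw [ProbabilityTheory.Kernel.map_apply' _ measurable_fst _ MeasurableSet.univ]
    exact hB.limit_mass t
  have key := SemiclassicalWigner.narrow_pairingTendsto (κ := W.map Prod.fst) hm hw hκ
    (fun n => (hB.momentL2 n).mono fun t ht => ?_)
    (fun φ hφ => pairingTendsto_of_tensor hm hw hκ (fun A hA b _ => ?_) hφ) hφ hN
  · rwa [hk] at key
  · refine le_trans (le_of_eq (lintegral_congr fun x => ?_)) ht
    rw [enorm_ofReal_sq, enorm_smul, mul_pow, enorm_norm]
  · rw [hk]
    exact h.tendsto_density_tensor hf hB hA b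

/-- Narrow convergence of the density, tested on functions constant in `x`. -/
theorem IsWignerMeasure.tendsto_norm_sq (h : IsWignerMeasure T f ε W)
    (hf : BoundedFamily T f) (hB : UniformBounds T f ε W C) {θ : ℝ → ℂ}
    (hθ : Integrable θ (timeMeasure T)) :
    Tendsto (fun n => ∫ t in Ioo 0 T, θ t * ((∫ x, ‖f (ε n) t x‖ ^ 2 : ℝ) : ℂ)) atTop
      (𝓝 (∫ t in Ioo 0 T, θ t * ((density (W t)).real univ : ℂ))) := by
  have key := (h.density_pairingTendsto hf hB
    (φ := fun t => BoundedContinuousFunction.const (Eu d) (θ t)) (fun y => hθ.1)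
    (by simpa using hθ.norm)).2
  simp only [BoundedContinuousFunction.const_apply, integral_const_mul, integral_const,
    integral_complex_ofReal, Complex.real_smul] at key
  simpa only [mul_comm (θ _)] using key

end StrongConvergence

end SemiclassicalWigner

end

/-! ### The theorem. -/

open SemiclassicalWigner in
theorem mainTheorem11 (d : ℕ) (hd : 1 ≤ d) (T : ℝ) (hT : 0 < T)
    (f : ℝ → ℝ → Eu d → ℂ) (hf : BoundedFamily T f) :
    (∃ (ε : ℕ → ℝ) (W : ProbabilityTheory.Kernel ℝ (Eu d × Eu d)), IsWignerMeasure T f ε W) ∧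
    ∀ (ε : ℕ → ℝ) (W : ProbabilityTheory.Kernel ℝ (Eu d × Eu d)), IsWignerMeasure T f ε W →
      ∀ Df : ℝ → ℝ → Eu d → EuclideanSpace ℂ (Fin d), MomentBounds T f Df →
        (∀ p : ℝ≥0∞, 1 < p →
          NarrowTendsto T p (fun n t y => husimi (ε n) (f (ε n) t) y.1 y.2) (fun t => W t) ∧
          WeakTendsto T p
            (fun n t y => ((‖y.1‖ ^ 2 : ℝ) : ℂ) * husimi (ε n) (f (ε n) t) y.1 y.2)
            (fun t => xMoment (W t)) ∧
          WeakTendsto T p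
            (fun n t y => ((‖y.2‖ ^ 2 : ℝ) : ℂ) * husimi (ε n) (f (ε n) t) y.1 y.2)
            (fun t => xiMoment (W t)) ∧
          NarrowTendsto T p (fun n t x => ((‖f (ε n) t x‖ ^ 2 : ℝ) : ℂ))
            (fun t => density (W t)) ∧
          ∀ q : ℝ≥0∞, p.HolderConjugate q → ∀ θ : ℝ → ℂ, MemLp θ q (timeMeasure T) →
            Tendsto (fun n => ∫ t in Ioo 0 T, θ t * ((∫ x, ‖f (ε n) t x‖ ^ 2 : ℝ) : ℂ)) atTop
              (𝓝 (∫ t in Ioo 0 T, θ t * ((density (W t)).real univ : ℂ)))) ∧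
        (∀ᵐ t ∂(timeMeasure T),
          ∫⁻ y, ENNReal.ofReal (‖y.1‖ ^ 2) ∂(W t) ≤
            liminf (fun n => normLinfL2 T (fun t x => ‖x‖ • f (ε n) t x) ^ 2) atTop) ∧
        (∀ᵐ t ∂(timeMeasure T),
          ∫⁻ y, ENNReal.ofReal (‖y.2‖ ^ 2) ∂(W t) ≤
            liminf (fun n => ENNReal.ofReal (ε n ^ 2) * normLinfL2 T (Df (ε n)) ^ 2) atTop) := by
  refine ⟨exists_isWignerMeasure hf, fun ε W h Df hM => ?_⟩
  obtain ⟨C, hB⟩ := h.exists_uniformBounds hM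
  have := h.isFiniteKernel
  have hm := fun n => aestronglyMeasurable_husimi (h.eps_pos n) (hf.1 _ (h.eps_pos n)) (hB.mass n)
  -- Each convergence holds for test functions merely `L¹` in time, which covers every `p` at once.
  refine ⟨fun p _ => ⟨narrowTendsto_of_forall (fun φ hφ hN => h.narrow_pairingTendsto hf hB hφ hN) p,
    weakTendsto_of_forall (fun φ hφ => ?_) p, weakTendsto_of_forall (fun φ hφ => ?_) p,
    narrowTendsto_of_forall (fun φ hφ hN => h.density_pairingTendsto hf hB hφ hN) p,
    fun q hq θ hθ => h.tendsto_norm_sq hf hB (integrable_of_holderConjugate hq hθ)⟩,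
    h.xMoment_le_liminf hf, h.xiMoment_le_liminf hM⟩
  · exact weighted_pairingTendsto (m := fun y : Eu d × Eu d => ‖y.1‖ ^ 2) (by fun_prop)
      (fun y => by positivity) hm hB.xMoment hB.limit_xMoment
      (fun φ hφ => h.pairingTendsto hf hφ) hφ
  · exact weighted_pairingTendsto (m := fun y : Eu d × Eu d => ‖y.2‖ ^ 2) (by fun_prop)
      (fun y => by positivity) hm hB.xiMoment hB.limit_xiMoment
      (fun φ hφ => h.pairingTendsto hf hφ) hφ
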